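/- **Setting.** Let $n\ge 2$, let $M\subset\mathbb R^n$ be a compact oriented smoothly embedded submanifold (without boundary) of dimension $n-2$, and let $U\supset M$ be a convex bounded open subset of $\mathbb R^n$. *Differential chains.* For an open convex set $V$ in a Euclidean space $E$, a Dirac $k$-chain in $V$ is a finitely supported function $V\to\Lambda^k E$, written $\sum_i(p_i;\alpha_i)$. The mass $\|\alpha\|$ of $\alpha\in\Lambda^kE$ is the infimum of $\sum_j\|\alpha_j\|$ over all finite decompositions $\alpha=\sum_j\alpha_j$ into simple $k$-vectors, where $\|v_1\wedge\dots\wedge v_k\|=\sqrt{\det\langle v_i,v_j\rangle}$. Let $\Delta_u(p;\alpha)=(p+u;\alpha)-(p;\alpha)$, extended linearly, and $\Delta_{\{u_1,\dots,u_j\}}=\Delta_{u_j}\circ\dots\circ\Delta_{u_1}$. The norm $\|A\|_{B^r}$ of a Dirac chain $A$ in $V$ is the infimum of $\sum_i\|u_{i,1}\|\cdots\|u_{i,j_i}\|\,\|\alpha_i\|$ over all finite decompositions $A=\sum_i\Delta_{\{u_{i,1},\dots,u_{i,j_i}\}}(p_i;\alpha_i)$ with $0\le j_i\le r$ such that the convex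 hull of the support of each term lies in $V$. The completion in this norm is the Banach space $\hat{\mathcal B}^r_k(V)$; for $r\le s$ the identity on Dirac chains induces the linking map $\hat{\mathcal B}^r_k(V)\to\hat{\mathcal B}^s_k(V)$. A $k$-form is of class $B^r$ if it is bounded ($r=0$), respectively $C^{r-1}$ with bounded derivatives of order $\le r-1$ and Lipschitz derivatives of order $r-1$ ($r\ge1$); for $J\in\hat{\mathcal B}^r_k(V)$ the integral $\int_J\omega$ is the continuous extension of $\sum_i(p_i;\alpha_i)\mapsto\sum_i\omega(p_i;\alpha_i)$. The support $\operatorname{supp}(J)$ is the set of $p\in E$ such that for every $\varepsilon>0$ there is a form $\eta$ of class $B^r$ on $V$, vanishing outside the ball of radius $\varepsilon$ about $p$, with $\int_J\eta\ne0$. *Operators* (continuous extensions from Dirac chains). Extrusion: $E_X(p;\alpha)=(p;X(p)\wedge\alpha)$. Boundary: $\partial=\sum_iP_{e_i}E_{e_i}^\dagger:\hat{\mathcal B}^r_k\to\hat{\mathcal B}^{r+1}_{k-1}$, $r\ge1$, where $(e_i)$ is an orthonormal basis, $P_v(p;\alpha)=\lim_{t\to0}\big((p+tv;\alpha/t)-(p;\alpha/t)\big)$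 and $E_v^\dagger(p;v_1\wedge\dots\wedge v_k)=\sum_i(-1)^{i+1}\langle v,v_i\rangle(p;v_1\wedge\dots\widehat{v_i}\dots\wedge v_k)$; $\partial=0$ on $0$-chains. Prederivative: $P_X=E_X\partial+\partial E_X$. Pushforward: $G_*(p;\alpha)=(G(p);DG_p\alpha)$. Let $\widetilde M\in\hat{\mathcal B}^1_{n-2}(U)$ be the chain with $\int_{\widetilde M}\omega=\int_M\omega$ for all $\omega$ of class $B^1$. *The data $Y$ and $F$.* Let $Y$ be a smooth vector field on $U$, bounded with all its derivatives, such that $Y(p)$ is a unit vector normal to $M$ for each $p\in M$. Let $F:[0,1]\times U\to U$ be smooth, with bounded derivatives of all orders $\ge1$ on $(0,1)\times U$, such that $F(0,p)=p$ and $F(1,p)=q$ for all $p\in U$, where $q\in U$ is fixed, and $\partial_tF(0,p)=Y(p)$ for all $p\in M$. The cone operator is $\kappa_Y(J)=F_*(\widetilde{(0,1)}\,\hat\times\,J):\hat{\mathcal B}^r_k(U)\to\hat{\mathcal B}^r_{k+1}(U)$, where $\hat\times$ is the Cartesian wedge product and $\widetilde{(0,1)}$ is the chain representing the interval $(0,1)$.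 *Spanning sets.* A simple link of $M$ is an embedded circle $S\subset\mathbb R^n\setminus M$ whose linking number with one connected component of $M$ is $\pm1$ and with every other component is $0$; the linking number with a component $M_i$ is the degree of $M_i\times S\to S^{n-1}$, $(s,r)\mapsto (s-r)/|s-r|$. A compact set $X$ spans $M$ if it meets every simple link of $M$. Let $\mathcal S^{n-1}$ be the normalized $(n-1)$-dimensional Hausdorff spherical measure (coverings by balls). Call $X$ reduced if $\mathcal H^{n-1}(X\cap O(p,r))>0$ for all $p\in X$ and $r>0$, $O(p,r)$ being the open ball. Let $\mathfrak S^*(M,U)$ be the collection of reduced compact subsets $X\subset U$ with $\mathcal S^{n-1}(X)<\infty$ that span $M$, and $\mathfrak m=\inf\{\mathcal S^{n-1}(X):X\in\mathfrak S^*(M,U)\}$. *Film chains.* A chain in $\hat{\mathcal B}^r_n(U)$ is positive if it is a limit of Dirac $n$-chains $\sum(p_i;\alpha_i)$ with positively oriented $\alpha_i$. Let $\mathcal C(U)$ be the set of positive $J\in\hat{\mathcal B}^1_n(U)$ with $\operatorname{supp}(J)\subset U$; such $J$ corresponds to the finite Borel measure $\mu_J$ on $U$ with $\int f\,d\mu_J=\int_Jf\,dV$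 for all bounded Lipschitz $f$ on $U$. Let $\mathcal F(M,Y,U)$ be the set of $S\in\hat{\mathcal B}^2_{n-1}(U)$ such that, up to linking maps, $\partial S=P_Y\widetilde M$, $\kappa_YS\in\mathcal C(U)$, and $\mu_{\kappa_YS}=\mathcal S^{n-1}\lfloor_X$ for some $X\in\mathfrak S^*(M,U)$. Put $\mathcal A^{n-1}(S)=\int_{\kappa_YS}dV$ and $c_0=\operatorname{diam}(U)\operatorname{vol}(M)$, and let $\mathcal T(M,Y,U)$ be the set of all limits in $\hat{\mathcal B}^2_{n-1}(U)$ of sequences in $\mathcal F(M,Y,U)$ whose members satisfy $\mathcal A^{n-1}\le c_0$. **Theorem.** If $S_0\in\mathcal T(M,Y,U)$ is $\mathcal A^{n-1}$-minimizing, i.e. $\mathcal A^{n-1}(S_0)=\mathfrak m$, then $\operatorname{supp}(\kappa_YS_0)$ is contained in the convex hull of $M$. -/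

import Mathlib

open Set Filter Topology MeasureTheory
open scoped ContDiff NNReal ENNReal

noncomputable section

namespace FilmChain

/-! ### Multivectors -/

section Multivectors

variable {E : Type*} [NormedAddCommGroup E] [InnerProductSpace ℝ E]

/-- The mass of the simple `k`-vector `v 0 ∧ ⋯ ∧ v (k - 1)`. -/
def simpleMass {k : ℕ} (v : Fin k → E) : ℝ :=
  Real.sqrt (Matrix.of fun i j => inner ℝ (v i) (v j)).det

/-- A representation of `α` as a finite sum of simple `k`-vectors. The scalar coefficients only
matter for `k = 0`, where the simple vectors are the scalars. -/
def IsSimpleSum {k : ℕ} (L : List (ℝ × (Fin k → E))) (α : ⋀[ℝ]^k E) : Prop :=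
  α = (L.map fun a => a.1 • exteriorPower.ιMulti ℝ k a.2).sum

/-- The mass of a `k`-vector: the infimum of the total mass over all ways of writing it as a
finite sum of simple `k`-vectors. -/
def massNorm {k : ℕ} (α : ⋀[ℝ]^k E) : ℝ :=
  sInf {s | ∃ L : List (ℝ × (Fin k → E)), IsSimpleSum L α ∧
    s = (L.map fun a => |a.1| * simpleMass a.2).sum}

/-- The exterior product of a `k`-vector and an `l`-vector. -/
def wedge {k l m : ℕ} (h : k + l = m) (α : ⋀[ℝ]^k E) (β : ⋀[ℝ]^l E) : ⋀[ℝ]^m E :=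
  ⟨α.1 * β.1, h ▸ SetLike.mul_mem_graded α.2 β.2⟩

/-- A vector, seen as a `1`-vector. -/
def oneVector (v : E) : ⋀[ℝ]^1 E := exteriorPower.ιMulti ℝ 1 fun _ => v

/-- `v_0 ∧ ⋯ ∧ v_k ↦ ∑ i, (-1) ^ i ⟨u, v_i⟩ v_0 ∧ ⋯ (omit v_i) ⋯ ∧ v_k`. -/
def contract {k : ℕ} (u : E) : ⋀[ℝ]^(k + 1) E →ₗ[ℝ] ⋀[ℝ]^k E :=
  exteriorPower.alternatingMapLinearEquiv
    (AlternatingMap.alternatizeUncurryFin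
      ((innerₗ E u).smulRight (exteriorPower.ιMulti ℝ k)))

/-- The value of a `k`-covector on a `k`-vector. -/
def covectorEval {k : ℕ} (φ : E [⋀^Fin k]→L[ℝ] ℝ) : ⋀[ℝ]^k E →ₗ[ℝ] ℝ :=
  exteriorPower.alternatingMapLinearEquiv φ.toAlternatingMap

theorem simpleMass_nonneg {k : ℕ} (v : Fin k → E) : 0 ≤ simpleMass v := Real.sqrt_nonneg _

theorem cost_nonneg {k : ℕ} (L : List (ℝ × (Fin k → E))) :
    0 ≤ (L.map fun a => |a.1| * simpleMass a.2).sum := by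
  apply List.sum_nonneg
  intro x hx
  obtain ⟨a, _, rfl⟩ := List.mem_map.1 hx
  exact mul_nonneg (abs_nonneg _) (simpleMass_nonneg _)

theorem massNorm_nonneg {k : ℕ} (α : ⋀[ℝ]^k E) : 0 ≤ massNorm α := by
  apply Real.sInf_nonneg
  rintro s ⟨L, _, rfl⟩
  exact cost_nonneg L

theorem massNorm_le {k : ℕ} {L : List (ℝ × (Fin k → E))} {α : ⋀[ℝ]^k E} (h : IsSimpleSum L α) :
    massNorm α ≤ (L.map fun a => |a.1| * simpleMass a.2).sum := by
  refine csInf_le (a := _) ?_ ?_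
  · refine ⟨0, ?_⟩
    rintro s ⟨L, _, rfl⟩
    exact cost_nonneg L
  · exact ⟨L, h, rfl⟩

theorem exists_isSimpleSum {k : ℕ} (α : ⋀[ℝ]^k E) :
    ∃ L : List (ℝ × (Fin k → E)), IsSimpleSum L α := by
  have h : α ∈ Submodule.span ℝ (Set.range (exteriorPower.ιMulti ℝ k (M := E))) := by
    rw [exteriorPower.ιMulti_span]; trivial
  induction h using Submodule.span_induction with
  | mem x hx => obtain ⟨v, rfl⟩ := hx; exact ⟨[(1, v)], by simp [IsSimpleSum]⟩
  | zero => exact ⟨[], by simp [IsSimpleSum]⟩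
  | add x y _ _ hx hy =>
    obtain ⟨L, hL⟩ := hx
    obtain ⟨L', hL'⟩ := hy
    exact ⟨L ++ L', by rw [IsSimpleSum] at *; rw [List.map_append, List.sum_append, ← hL, ← hL']⟩
  | smul c x _ hx =>
    obtain ⟨L, hL⟩ := hx
    refine ⟨L.map fun a => (c * a.1, a.2), ?_⟩
    rw [IsSimpleSum] at *
    rw [hL, List.smul_sum, List.map_map, List.map_map]
    congr 1
    apply List.map_congr_left
    intro a _
    simp [mul_smul]

theorem massNorm_smul_le {k : ℕ} (c : ℝ) (α : ⋀[ℝ]^k E) :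
    massNorm (c • α) ≤ |c| * massNorm α := by
  rw [massNorm, massNorm, ← smul_eq_mul, ← Real.sInf_smul_of_nonneg (abs_nonneg c)]
  obtain ⟨L₀, hL₀⟩ := exists_isSimpleSum α
  refine le_csInf ?_ ?_
  · exact ⟨_, ⟨_, ⟨L₀, hL₀, rfl⟩, rfl⟩⟩
  rintro _ ⟨_, ⟨L, hL, rfl⟩, rfl⟩
  have h : IsSimpleSum (L.map fun a => (c * a.1, a.2)) (c • α) := by
    rw [IsSimpleSum] at *
    rw [hL, List.smul_sum, List.map_map, List.map_map]
    congr 1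
    apply List.map_congr_left
    intro a _
    simp [mul_smul]
  refine (massNorm_le h).trans (le_of_eq ?_)
  simp only [smul_eq_mul]
  rw [List.map_map, ← List.sum_map_mul_left]
  congr 1
  apply List.map_congr_left
  intro a _
  simp [abs_mul, mul_assoc]

end Multivectors

/-! ### Dirac chains, the `B^r` norms and differential chains -/

section Chains

variable {E : Type*} [NormedAddCommGroup E] [InnerProductSpace ℝ E]

/-- Translation of Dirac chains in the whole space through the vector `u`. -/
def translate {k : ℕ} (u : E) (A : E →₀ ⋀[ℝ]^k E) : E →₀ ⋀[ℝ]^k E :=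
  A.mapDomain fun p => p + u

/-- The difference chain `Δ_{us} (p; α)`. -/
def diffChain {k : ℕ} (us : List E) (p : E) (α : ⋀[ℝ]^k E) : E →₀ ⋀[ℝ]^k E :=
  us.foldr (fun u A => translate u A - A) (Finsupp.single p α)

/-- `D` decomposes `A` as a sum of `j`-difference `k`-chains inside `U`, with `0 ≤ j ≤ r`. -/
def IsDecomposition {k : ℕ} (U : Set E) (r : ℕ) (D : List (List E × E × ⋀[ℝ]^k E))
    (A : U →₀ ⋀[ℝ]^k E) : Prop :=
  (∀ a ∈ D, a.1.length ≤ r ∧ convexHull ℝ ((diffChain a.1 a.2.1 a.2.2).support : Set E) ⊆ U) ∧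
    A.mapDomain Subtype.val = (D.map fun a => diffChain a.1 a.2.1 a.2.2).sum

/-- The sum of the `‖u_1‖ ⋯ ‖u_j‖ ‖α‖` over the terms of a decomposition. -/
def decompositionCost {k : ℕ} (D : List (List E × E × ⋀[ℝ]^k E)) : ℝ :=
  (D.map fun a => (a.1.map fun u => ‖u‖).prod * massNorm a.2.2).sum

/-- The norm `‖A‖_{B^{r,U}}`. -/
def bNorm {k : ℕ} (U : Set E) (r : ℕ) (A : U →₀ ⋀[ℝ]^k E) : ℝ :=
  sInf {s | ∃ D : List (List E × E × ⋀[ℝ]^k E), IsDecomposition U r D A ∧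
    s = decompositionCost D}

/-- Dirac `k`-chains in `U`, with the norm `‖·‖_{B^{r,U}}`. -/
def Dirac (U : Set E) (k _r : ℕ) : Type _ := U →₀ ⋀[ℝ]^k E

instance (U : Set E) (k r : ℕ) : AddCommGroup (Dirac U k r) :=
  inferInstanceAs (AddCommGroup (U →₀ ⋀[ℝ]^k E))

instance (U : Set E) (k r : ℕ) : Module ℝ (Dirac U k r) :=
  inferInstanceAs (Module ℝ (U →₀ ⋀[ℝ]^k E))

theorem decompositionCost_nonneg {k : ℕ} (D : List (List E × E × ⋀[ℝ]^k E)) :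
    0 ≤ decompositionCost D := by
  apply List.sum_nonneg
  intro x hx
  obtain ⟨a, _, rfl⟩ := List.mem_map.1 hx
  refine mul_nonneg (List.prod_nonneg ?_) (massNorm_nonneg _)
  intro y hy
  obtain ⟨u, _, rfl⟩ := List.mem_map.1 hy
  exact norm_nonneg _

theorem bNorm_le {k : ℕ} {U : Set E} {r : ℕ} {D : List (List E × E × ⋀[ℝ]^k E)}
    {A : U →₀ ⋀[ℝ]^k E} (h : IsDecomposition U r D A) : bNorm U r A ≤ decompositionCost D := by
  refine csInf_le ?_ ?_
  · refine ⟨0, ?_⟩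
    rintro s ⟨L, _, rfl⟩
    exact decompositionCost_nonneg L
  · exact ⟨D, h, rfl⟩

theorem IsDecomposition.append {k : ℕ} {U : Set E} {r : ℕ} {D D' : List (List E × E × ⋀[ℝ]^k E)}
    {A A' : U →₀ ⋀[ℝ]^k E} (h : IsDecomposition U r D A) (h' : IsDecomposition U r D' A') :
    IsDecomposition U r (D ++ D') (A + A') := by
  refine ⟨fun a ha => ?_, ?_⟩
  · rcases List.mem_append.1 ha with ha | ha
    · exact h.1 a ha
    · exact h'.1 a ha
  · rw [Finsupp.mapDomain_add, h.2, h'.2, List.map_append, List.sum_append]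

theorem decompositionCost_append {k : ℕ} (D D' : List (List E × E × ⋀[ℝ]^k E)) :
    decompositionCost (D ++ D') = decompositionCost D + decompositionCost D' := by
  simp [decompositionCost]

theorem exists_isDecomposition {k : ℕ} (U : Set E) (r : ℕ) (A : U →₀ ⋀[ℝ]^k E) :
    ∃ D, IsDecomposition U r D A := by
  induction A using Finsupp.induction_linear with
  | zero => exact ⟨[], by simp [IsDecomposition]⟩
  | add A A' h h' =>
    obtain ⟨D, hD⟩ := h
    obtain ⟨D', hD'⟩ := h'
    exact ⟨_, hD.append hD'⟩
  | single p α =>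
    refine ⟨[([], (p : E), α)], ?_, ?_⟩
    · intro a ha
      obtain rfl := List.mem_singleton.1 ha
      refine ⟨Nat.zero_le _, ?_⟩
      refine (convexHull_mono (t := {(p : E)}) ?_).trans ?_
      · intro x hx
        have := Finsupp.support_single_subset (Finset.mem_coe.1 hx)
        simpa using this
      · simp
    · simp [diffChain, Finsupp.mapDomain_single]

theorem diffChain_smul {k : ℕ} (c : ℝ) (us : List E) (p : E) (α : ⋀[ℝ]^k E) :
    diffChain us p (c • α) = c • diffChain us p α := by
  induction us with
  | nil => simp [diffChain]
  | cons u us ih =>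
    have h : ∀ β : ⋀[ℝ]^k E,
        diffChain (u :: us) p β = translate u (diffChain us p β) - diffChain us p β :=
      fun _ => rfl
    rw [h, h, ih, translate, translate, Finsupp.mapDomain_smul]
    ext x
    simp [smul_sub]

theorem bNorm_smul_le {k : ℕ} (U : Set E) (r : ℕ) (c : ℝ) (A : U →₀ ⋀[ℝ]^k E) :
    bNorm U r (c • A) ≤ |c| * bNorm U r A := by
  rw [bNorm, bNorm, ← smul_eq_mul, ← Real.sInf_smul_of_nonneg (abs_nonneg c)]
  obtain ⟨D₀, hD₀⟩ := exists_isDecomposition U r A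
  refine le_csInf ?_ ?_
  · exact ⟨_, ⟨_, ⟨D₀, hD₀, rfl⟩, rfl⟩⟩
  rintro _ ⟨_, ⟨D, hD, rfl⟩, rfl⟩
  have h : IsDecomposition U r (D.map fun a => (a.1, a.2.1, c • a.2.2)) (c • A) := by
    refine ⟨fun a ha => ?_, ?_⟩
    · obtain ⟨b, hb, rfl⟩ := List.mem_map.1 ha
      refine ⟨(hD.1 b hb).1, (convexHull_mono ?_).trans (hD.1 b hb).2⟩
      intro x hx
      rw [Finset.mem_coe, diffChain_smul] at hx
      exact Finset.mem_coe.2 (Finsupp.support_smul hx)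
    · rw [Finsupp.mapDomain_smul, hD.2, List.smul_sum, List.map_map, List.map_map]
      refine congrArg List.sum (List.map_congr_left fun a _ => ?_)
      simp only [Function.comp_apply, diffChain_smul]
  refine (bNorm_le h).trans ?_
  simp only [smul_eq_mul, decompositionCost]
  rw [List.map_map, ← List.sum_map_mul_left]
  apply List.sum_le_sum
  intro a _
  have h1 : 0 ≤ (a.1.map fun u => ‖u‖).prod := by
    refine List.prod_nonneg ?_
    intro y hy
    obtain ⟨u, _, rfl⟩ := List.mem_map.1 hy
    exact norm_nonneg _
  have := mul_le_mul_of_nonneg_left (massNorm_smul_le c a.2.2) h1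
  simp only [Function.comp]
  linarith

theorem bNorm_add_le {k : ℕ} (U : Set E) (r : ℕ) (A B : U →₀ ⋀[ℝ]^k E) :
    bNorm U r (A + B) ≤ bNorm U r A + bNorm U r B := by
  obtain ⟨D₀, hD₀⟩ := exists_isDecomposition U r A
  obtain ⟨D₁, hD₁⟩ := exists_isDecomposition U r B
  rw [← sub_le_iff_le_add]
  refine le_csInf ?_ ?_
  · exact ⟨_, ⟨D₀, hD₀, rfl⟩⟩
  rintro _ ⟨D, hD, rfl⟩
  rw [sub_le_comm]
  refine le_csInf ?_ ?_
  · exact ⟨_, ⟨D₁, hD₁, rfl⟩⟩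
  rintro _ ⟨D', hD', rfl⟩
  have := bNorm_le (hD.append hD')
  rw [decompositionCost_append] at this
  linarith

/-- `‖·‖_{B^{r,U}}` as a seminorm. -/
def bSeminorm (U : Set E) (k r : ℕ) : Seminorm ℝ (Dirac U k r) :=
  Seminorm.ofSMulLE (fun A => bNorm U r A)
    (le_antisymm
      ((bNorm_le (k := k) (U := U) (r := r) (D := []) (A := 0) (by simp [IsDecomposition])).trans
        (by simp [decompositionCost]))
      (Real.sInf_nonneg (by rintro _ ⟨D, _, rfl⟩; exact decompositionCost_nonneg D)))
    (bNorm_add_le U r) (fun c A => bNorm_smul_le U r c A)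

instance (U : Set E) (k r : ℕ) : SeminormedAddCommGroup (Dirac U k r) :=
  (bSeminorm U k r).toSeminormedAddCommGroup

instance (U : Set E) (k r : ℕ) : NormedSpace ℝ (Dirac U k r) where
  norm_smul_le c A := (map_smul_eq_mul (bSeminorm U k r) c A).le

/-- The Banach space of differential `k`-chains of class `B^r` in `U`. -/
abbrev Chain (U : Set E) (k r : ℕ) : Type _ := UniformSpace.Completion (Dirac U k r)

/-- The `k`-element `(p; α)`, where `p` is taken in `U` (and `0` if `p` is not in `U`). -/
def element (U : Set E) {k r : ℕ} (p : E) (α : ⋀[ℝ]^k E) : Dirac U k r :=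
  open Classical in if h : p ∈ U then Finsupp.single ⟨p, h⟩ α else 0

/-- The sum of `f (p; α)` over the `k`-elements `(p; α)` of a Dirac chain. -/
def Dirac.sum {U : Set E} {k r : ℕ} {G : Type*} [AddCommMonoid G] (A : Dirac U k r)
    (f : E → ⋀[ℝ]^k E → G) : G :=
  Finsupp.sum (show U →₀ ⋀[ℝ]^k E from A) fun p α => f p α

/-- The linking map, the continuous extension of the identity on Dirac chains. -/
def link {U : Set E} {k : ℕ} (r s : ℕ) : Chain U k r → Chain U k s :=
  UniformSpace.Completion.extension fun A : Dirac U k r => ((show Dirac U k s from A :) : Chain U k s)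

end Chains

/-! ### Differential forms of class `B^r`, integration and supports -/

section Forms

variable {E : Type*} [NormedAddCommGroup E] [InnerProductSpace ℝ E]

/-- Functions of class `B^r` on a convex open set `V`: bounded functions for `r = 0`; for `r ≥ 1`,
functions of class `C^{r-1}` with bounded derivatives of order `≤ r - 1` whose derivative of order
`r - 1` is Lipschitz. (On a convex set the intrinsic metric is the restricted one.) -/
def IsClassB {G : Type*} [NormedAddCommGroup G] [NormedSpace ℝ G] (V : Set E) (f : E → G) :
    ℕ → Prop
  | 0 => ∃ C : ℝ, ∀ x ∈ V, ‖f x‖ ≤ C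
  | r + 1 => ContDiffOn ℝ r f V ∧
      (∀ j ≤ r, ∃ C : ℝ, ∀ x ∈ V, ‖iteratedFDeriv ℝ j f x‖ ≤ C) ∧
      ∃ K : ℝ≥0, LipschitzOnWith K (iteratedFDeriv ℝ r f) V

/-- The integral of a differential `k`-form over a differential chain: the continuous extension of
`∑ (p_i; α_i) ↦ ∑ η(p_i; α_i)`. -/
def integral {U : Set E} {k r : ℕ} (η : E → E [⋀^Fin k]→L[ℝ] ℝ) : Chain U k r → ℝ :=
  UniformSpace.Completion.extension fun A : Dirac U k r => A.sum fun p α => covectorEval (η p) α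

/-- The support of a differential chain. -/
def support {U : Set E} {k r : ℕ} (J : Chain U k r) : Set E :=
  {p | ∀ ε > 0, ∃ η : E → E [⋀^Fin k]→L[ℝ] ℝ, IsClassB U η r ∧
    (∀ x ∈ U, x ∉ Metric.ball p ε → η x = 0) ∧ integral η J ≠ 0}

end Forms

/-! ### Operators on differential chains -/

section Operators

variable {E : Type*} [NormedAddCommGroup E] [InnerProductSpace ℝ E]

/-- Extrusion `E_X`, the continuous extension of `(p; α) ↦ (p; X(p) ∧ α)`. -/
def extrude {U : Set E} {k r : ℕ} (X : E → E) : Chain U k r → Chain U (k + 1) r :=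
  UniformSpace.Completion.extension fun A : Dirac U k r =>
    ((A.sum fun p α => element U p (wedge (Nat.add_comm 1 k) (oneVector (X p)) α) :
      Dirac U (k + 1) r) : Chain U (k + 1) r)

/-- Retraction `E_u^†` of Dirac chains along a constant vector field. -/
def retractDirac {U : Set E} {k r : ℕ} (u : E) (A : Dirac U (k + 1) r) : Dirac U k r :=
  A.sum fun p α => element U p (contract u α)

/-- The prederivative `P_v` on Dirac chains, `(p; α) ↦ lim_{t → 0} (p + t v; α / t) - (p; α / t)`,
the limit being taken in the `B^{r+1}` norm. -/
def prederivDirac {U : Set E} {k r : ℕ} (v : E) (A : Dirac U k r) : Chain U k (r + 1) :=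
  limUnder (𝓝[≠] (0 : ℝ)) fun t =>
    ((A.sum fun p α => element U (p + t • v) (t⁻¹ • α) - element U p (t⁻¹ • α) :
      Dirac U k (r + 1)) : Chain U k (r + 1))

/-- Boundary, the continuous extension of `∑ i, P_{e_i} E_{e_i}^†`, `(e_i)` orthonormal. -/
def boundary [FiniteDimensional ℝ E] {U : Set E} {k r : ℕ} :
    Chain U (k + 1) r → Chain U k (r + 1) :=
  UniformSpace.Completion.extension fun A : Dirac U (k + 1) r =>
    ∑ i, prederivDirac (stdOrthonormalBasis ℝ E i) (retractDirac (stdOrthonormalBasis ℝ E i) A)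

/-- The prederivative `P_X = E_X ∂ + ∂ E_X` (with `∂ = 0` on `0`-chains). -/
def prederivative [FiniteDimensional ℝ E] {U : Set E} (X : E → E) :
    {k r : ℕ} → Chain U k r → Chain U k (r + 1)
  | 0, _, J => boundary (extrude X J)
  | _ + 1, _, J => extrude X (boundary J) + boundary (extrude X J)

/-- Pushforward `F_*`, the continuous extension of `(p; α) ↦ (F(p); F_{p*} α)`. -/
def pushforward {E' : Type*} [NormedAddCommGroup E'] [InnerProductSpace ℝ E']
    {U : Set E} {k r : ℕ} (F : E → E') (W : Set E') : Chain U k r → Chain W k r :=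
  UniformSpace.Completion.extension fun A : Dirac U k r =>
    ((A.sum fun p α => element W (F p) (exteriorPower.map k (fderiv ℝ F p).toLinearMap α) :
      Dirac W k r) : Chain W k r)

/-- The product `V × U` in the Euclidean product `ℝ × E`. -/
def prodSet (V : Set ℝ) (U : Set E) : Set (WithLp 2 (ℝ × E)) := {z | z.fst ∈ V ∧ z.snd ∈ U}

/-- The inclusion of the first factor in the Euclidean product `ℝ × E`. -/
def inclLeft : ℝ →ₗ[ℝ] WithLp 2 (ℝ × E) :=
  (WithLp.linearEquiv 2 ℝ (ℝ × E)).symm.toLinearMap ∘ₗ LinearMap.inl ℝ ℝ E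

/-- The inclusion of the second factor in the Euclidean product `ℝ × E`. -/
def inclRight : E →ₗ[ℝ] WithLp 2 (ℝ × E) :=
  (WithLp.linearEquiv 2 ℝ (ℝ × E)).symm.toLinearMap ∘ₗ LinearMap.inr ℝ ℝ E

/-- The Cartesian wedge product of Dirac chains in `V ⊆ ℝ` and in `U ⊆ E`, where the product
carries the `B^s` norm. -/
def crossDirac {V : Set ℝ} {U : Set E} {j k r r' : ℕ} {m : ℕ} (s : ℕ) (h : j + k = m)
    (Q : Dirac V j r) (A : Dirac U k r') : Dirac (prodSet V U) m s :=
  Q.sum fun t β => A.sum fun p α =>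
    element (prodSet V U) (WithLp.toLp 2 (t, p))
      (wedge h (exteriorPower.map j inclLeft β) (exteriorPower.map k inclRight α))

/-- The differential `1`-chain of class `B^1` representing the interval `(0,1)`. -/
def unitIntervalChain : Chain (Ioo (0 : ℝ) 1) 1 1 :=
  Classical.epsilon fun J => ∀ η : ℝ → ℝ [⋀^Fin 1]→L[ℝ] ℝ, IsClassB (Ioo (0 : ℝ) 1) η 1 →
    integral η J = ∫ t in Ioo (0 : ℝ) 1, η t fun _ => 1

/-- `J ↦ (0,1) × J`: on a Dirac chain `A` this is the value at the chain of the interval of the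
continuous extension of `Q ↦ Q × A`; on all chains it is the continuous extension from there. -/
def intervalCross {U : Set E} {k r : ℕ} :
    Chain U k r → Chain (prodSet (Ioo 0 1) U) (k + 1) r :=
  UniformSpace.Completion.extension fun A : Dirac U k r =>
    UniformSpace.Completion.extension
      (fun Q : Dirac (Ioo (0 : ℝ) 1) 1 1 =>
        ((crossDirac r (Nat.add_comm 1 k) Q A : Dirac (prodSet (Ioo 0 1) U) (k + 1) r) :
          Chain (prodSet (Ioo 0 1) U) (k + 1) r))
      unitIntervalChain

/-- The cone operator `κ_F J = F_* ((0,1) × J)`. -/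
def cone {U : Set E} {k r : ℕ} (F : WithLp 2 (ℝ × E) → E) (J : Chain U k r) :
    Chain U (k + 1) r :=
  pushforward F U (intervalCross J)

/-- `F` is a smooth null-homotopy of `U` to the point `q`, with all derivatives bounded, so that
it induces a cone operator on chains of every class. -/
structure IsSmoothNullHomotopy (U : Set E) (q : E) (F : WithLp 2 (ℝ × E) → E) : Prop where
  mem : q ∈ U
  mapsTo : MapsTo F (prodSet (Icc 0 1) U) U
  start : ∀ p ∈ U, F (WithLp.toLp 2 (0, p)) = p
  finish : ∀ p ∈ U, F (WithLp.toLp 2 (1, p)) = q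
  smooth : ContDiffOn ℝ ∞ F (prodSet (Icc 0 1) U)
  bounded : ∀ r, IsClassB (prodSet (Ioo 0 1) U) (fderiv ℝ F) r

end Operators

/-! ### Hausdorff measures and oriented submanifolds -/

section Geometry

variable {E : Type*} [NormedAddCommGroup E] [InnerProductSpace ℝ E] [MeasurableSpace E]
  [BorelSpace E]

/-- The Lebesgue measure of the unit ball of `ℝ^m`. -/
def unitBallVolume (m : ℕ) : ℝ≥0∞ := volume (Metric.ball (0 : EuclideanSpace ℝ (Fin m)) 1)

/-- Normalized `m`-dimensional Hausdorff measure (`μH[m]` is built from `diam ^ m`). -/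
def hausdorff (m : ℕ) : Measure E := (unitBallVolume m / 2 ^ m) • μH[(m : ℝ)]

/-- Normalized `m`-dimensional Hausdorff spherical measure: it is built from coverings by balls,
a ball of radius `ρ` having weight `α_m ρ ^ m`; other sets have infinite weight. -/
def spherical (m : ℕ) : Measure E :=
  Measure.mkMetric' fun s => ⨅ (c : E) (ρ : ℝ≥0) (_ : s = Metric.closedBall c ρ),
    unitBallVolume m * (ρ : ℝ≥0∞) ^ m

/-- The core of `X` in dimension `m`. -/
def core (m : ℕ) (X : Set E) : Set E :=
  {p ∈ X | ∀ ρ > 0, 0 < hausdorff m (X ∩ Metric.ball p ρ)}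

/-- `M` is a smoothly embedded submanifold (without boundary) of codimension `c`: locally it is
the zero set of a smooth submersion to `ℝ^c`. -/
def IsSubmanifold (c : ℕ) (M : Set E) : Prop :=
  ∀ p ∈ M, ∃ W : Set E, IsOpen W ∧ p ∈ W ∧ ∃ g : E → EuclideanSpace ℝ (Fin c),
    ContDiffOn ℝ ∞ g W ∧ Function.Surjective (fderiv ℝ g p) ∧ M ∩ W = {x ∈ W | g x = 0}

/-- The tangent vectors of `M` at `p`: the velocities at `p` of curves in `M`. -/
def tangentVectors (M : Set E) (p : E) : Set E :=
  {v | ∃ γ : ℝ → E, γ 0 = p ∧ (∀ t, γ t ∈ M) ∧ HasDerivAt γ v 0}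

/-- `τ` orients the `d`-dimensional submanifold `M`: it is a continuous field on `M` of unit simple
`d`-vectors that span the tangent spaces. -/
structure IsOrientation {d : ℕ} (M : Set E) (τ : E → ⋀[ℝ]^d E) : Prop where
  continuousOn : ∀ φ : ⋀[ℝ]^d E →ₗ[ℝ] ℝ, ContinuousOn (fun p => φ (τ p)) M
  tangent : ∀ p ∈ M, ∃ e : Fin d → E, Orthonormal ℝ e ∧
    (Submodule.span ℝ (range e) : Set E) = tangentVectors M p ∧
    (τ p = exteriorPower.ιMulti ℝ d e ∨ τ p = -exteriorPower.ιMulti ℝ d e)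

/-- The integral of a `d`-form over an oriented `d`-dimensional submanifold. -/
def submanifoldIntegral {d : ℕ} (M : Set E) (τ : E → ⋀[ℝ]^d E) (η : E → E [⋀^Fin d]→L[ℝ] ℝ) : ℝ :=
  ∫ p in M, covectorEval (η p) (τ p) ∂(hausdorff d)

/-- The differential chain of class `B^1` in `U` that represents the oriented submanifold `M`. -/
def submanifoldChain {d : ℕ} (U M : Set E) (τ : E → ⋀[ℝ]^d E) : Chain U d 1 :=
  Classical.epsilon fun J => ∀ η : E → E [⋀^Fin d]→L[ℝ] ℝ, IsClassB U η 1 →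
    integral η J = submanifoldIntegral M τ η

end Geometry

/-! ### Linking numbers and spanning sets -/

section Spanning

/-- Singular homology with integer coefficients. -/
abbrev homology (m : ℕ) (A : Type) [TopologicalSpace A] : ModuleCat.{0} ℤ :=
  ((AlgebraicTopology.singularHomologyFunctor (ModuleCat.{0} ℤ) m).obj (ModuleCat.of ℤ ℤ)).obj
    (TopCat.of A)

/-- The map induced in singular homology. -/
def homologyMap (m : ℕ) {A B : Type} [TopologicalSpace A] [TopologicalSpace B] (f : C(A, B)) :
    homology m A → homology m B :=
  (((AlgebraicTopology.singularHomologyFunctor (ModuleCat.{0} ℤ) m).obj (ModuleCat.of ℤ ℤ)).map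
    (TopCat.ofHom f)).hom

/-- `a` is a generator of the top homology group, i.e. the fundamental class for one of the two
orientations of a closed connected orientable manifold `A`. -/
def IsFundamentalClass (m : ℕ) {A : Type} [TopologicalSpace A] (a : homology m A) : Prop :=
  ∀ x : homology m A, ∃ j : ℤ, x = j • a

/-- The map `f` between closed connected orientable `m`-manifolds has degree `± k`. -/
def HasDegreeUpToSign (m : ℕ) {A B : Type} [TopologicalSpace A] [TopologicalSpace B] (f : C(A, B))
    (k : ℤ) : Prop :=
  ∃ (a : homology m A) (b : homology m B), IsFundamentalClass m a ∧ IsFundamentalClass m b ∧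
    homologyMap m f a = k • b

variable {E : Type} [NormedAddCommGroup E] [InnerProductSpace ℝ E]

/-- The map `(s, z) ↦ (s - γ z) / ‖s - γ z‖` from `N × S¹` to the unit sphere. -/
def linkingMap (N : Set E) (γ : C(Circle, E)) (h : Disjoint N (range γ)) :
    C(N × Circle, Metric.sphere (0 : E) 1) where
  toFun x := ⟨‖(x.1 : E) - γ x.2‖⁻¹ • ((x.1 : E) - γ x.2), by
    have h0 : (x.1 : E) - γ x.2 ≠ 0 := fun h0 =>
      Set.disjoint_left.1 h x.1.2 ⟨x.2, (sub_eq_zero.1 h0).symm⟩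
    simp [norm_smul, norm_ne_zero_iff.2 h0]⟩
  continuous_toFun := by
    refine Continuous.subtype_mk ?_ _
    refine Continuous.smul (Continuous.inv₀ (by fun_prop) fun x => ?_) (by fun_prop)
    exact norm_ne_zero_iff.2 fun h0 =>
      Set.disjoint_left.1 h x.1.2 ⟨x.2, (sub_eq_zero.1 h0).symm⟩

/-- The linking number of `N` and the closed curve `γ` is `± k`. -/
def HasLinkingNumber (N : Set E) (γ : C(Circle, E)) (k : ℤ) : Prop :=
  ∃ h : Disjoint N (range γ),
    HasDegreeUpToSign (Module.finrank ℝ E - 1) (linkingMap N γ h) k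

/-- `γ` is a simple link of `M`: an embedded circle in the complement of `M` that has linking
number `± 1` with one of the connected components of `M` and `0` with all the others. -/
def IsSimpleLink (M : Set E) (γ : C(Circle, E)) : Prop :=
  Function.Injective γ ∧ Disjoint M (range γ) ∧
    ∃ p ∈ M, HasLinkingNumber (connectedComponentIn M p) γ 1 ∧
      ∀ q ∈ M, connectedComponentIn M q ≠ connectedComponentIn M p →
        HasLinkingNumber (connectedComponentIn M q) γ 0

/-- `X` spans `M`: every simple link of `M` intersects `X`. -/
def Spans (X M : Set E) : Prop :=
  ∀ γ : C(Circle, E), IsSimpleLink M γ → (X ∩ range γ).Nonempty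

end Spanning

/-! ### Film chains -/

section Film

variable {d : ℕ}

/-- The volume form `dV` of `ℝ^n`. -/
def volumeForm (n : ℕ) : EuclideanSpace ℝ (Fin n) [⋀^Fin n]→L[ℝ] ℝ where
  __ := (EuclideanSpace.basisFun (Fin n) ℝ).toBasis.det
  cont := by
    change Continuous fun v => (EuclideanSpace.basisFun (Fin n) ℝ).toBasis.det v
    simp only [Module.Basis.det_apply]
    refine Continuous.matrix_det (continuous_matrix fun i j => ?_)
    simp only [Module.Basis.toMatrix_apply, OrthonormalBasis.coe_toBasis_repr_apply,
      EuclideanSpace.basisFun_repr]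
    fun_prop

/-- Positive Dirac `n`-chains. -/
def IsPositiveDirac {n r : ℕ} {U : Set (EuclideanSpace ℝ (Fin n))} (A : Dirac U n r) : Prop :=
  ∀ p : U, 0 ≤ covectorEval (volumeForm n) ((show U →₀ ⋀[ℝ]^n (EuclideanSpace ℝ (Fin n)) from A) p)

/-- Positive differential `n`-chains: limits of positive Dirac chains. -/
def IsPositive {n r : ℕ} {U : Set (EuclideanSpace ℝ (Fin n))} (J : Chain U n r) : Prop :=
  ∃ A : ℕ → Dirac U n r, (∀ i, IsPositiveDirac (A i)) ∧
    Tendsto (fun i => (A i : Chain U n r)) atTop (𝓝 J)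

/-- The cone `C(U)` of positive chains of class `B^1` with support in `U`. -/
def positiveCone {n : ℕ} (U : Set (EuclideanSpace ℝ (Fin n))) : Set (Chain U n 1) :=
  {J | IsPositive J ∧ support J ⊆ U}

/-- `μ` is the finite Borel measure `μ_J` corresponding to the positive chain `J`, that is, the one
with `∫ f dμ = ∫_J f dV` for all bounded Lipschitz `f` on `U`. -/
def IsMeasureOf {n : ℕ} {U : Set (EuclideanSpace ℝ (Fin n))} (J : Chain U n 1)
    (μ : Measure (EuclideanSpace ℝ (Fin n))) : Prop :=
  IsFiniteMeasure μ ∧ μ Uᶜ = 0 ∧ ∀ f : EuclideanSpace ℝ (Fin n) → ℝ, IsClassB U f 1 →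
    ∫ x in U, f x ∂μ = integral (fun x => f x • volumeForm n) J

/-- The reduced compact subsets of `U` with finite `S^{n-1}`-measure that span `M`; `n = d + 2`. -/
def spanningSets (M U : Set (EuclideanSpace ℝ (Fin (d + 2)))) :
    Set (Set (EuclideanSpace ℝ (Fin (d + 2)))) :=
  {X | IsCompact X ∧ X ⊆ U ∧ core (d + 1) X = X ∧ spherical (d + 1) X < ⊤ ∧ Spans X M}

/-- The infimum of the `S^{n-1}`-measures of the sets in `spanningSets M U`. -/
def minimalSize (M U : Set (EuclideanSpace ℝ (Fin (d + 2)))) : ℝ≥0∞ :=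
  ⨅ X ∈ spanningSets M U, spherical (d + 1) X

/-- Film chains. The identities `∂S = P_Y M` and `κ_Y S ∈ C(U)` are read through the linking
maps. -/
def filmChains (M : Set (EuclideanSpace ℝ (Fin (d + 2))))
    (τ : EuclideanSpace ℝ (Fin (d + 2)) → ⋀[ℝ]^d (EuclideanSpace ℝ (Fin (d + 2))))
    (Y : EuclideanSpace ℝ (Fin (d + 2)) → EuclideanSpace ℝ (Fin (d + 2)))
    (F : WithLp 2 (ℝ × EuclideanSpace ℝ (Fin (d + 2))) → EuclideanSpace ℝ (Fin (d + 2)))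
    (U : Set (EuclideanSpace ℝ (Fin (d + 2)))) : Set (Chain U (d + 1) 2) :=
  {S | boundary S = link 2 3 (prederivative Y (submanifoldChain U M τ)) ∧
    ∃ J ∈ positiveCone U, link 1 2 J = cone F S ∧
      ∃ X ∈ spanningSets M U, IsMeasureOf J ((spherical (d + 1)).restrict X)}

/-- The area functional `A^{n-1}(S)`, the integral of `dV` over `κ_Y S`. -/
def area (F : WithLp 2 (ℝ × EuclideanSpace ℝ (Fin (d + 2))) → EuclideanSpace ℝ (Fin (d + 2)))
    {U : Set (EuclideanSpace ℝ (Fin (d + 2)))} (S : Chain U (d + 1) 2) : ℝ :=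
  integral (fun _ => volumeForm (d + 2)) (cone F S)

/-- The constant `c₀ = diam(U) vol(M)`. -/
def areaBound (M U : Set (EuclideanSpace ℝ (Fin (d + 2)))) : ℝ :=
  Metric.diam U * (hausdorff d M).toReal

/-- The collection `T(M, Y, U)` of limits of film chains of area at most `c₀`. -/
def limitChains (M : Set (EuclideanSpace ℝ (Fin (d + 2))))
    (τ : EuclideanSpace ℝ (Fin (d + 2)) → ⋀[ℝ]^d (EuclideanSpace ℝ (Fin (d + 2))))
    (Y : EuclideanSpace ℝ (Fin (d + 2)) → EuclideanSpace ℝ (Fin (d + 2)))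
    (F : WithLp 2 (ℝ × EuclideanSpace ℝ (Fin (d + 2))) → EuclideanSpace ℝ (Fin (d + 2)))
    (U : Set (EuclideanSpace ℝ (Fin (d + 2)))) : Set (Chain U (d + 1) 2) :=
  {S | ∃ T : ℕ → Chain U (d + 1) 2,
    (∀ i, T i ∈ filmChains M τ Y F U ∧ area F (T i) ≤ areaBound M U) ∧
      Tendsto T atTop (𝓝 S)}

end Film

end FilmChain

end

noncomputable section

namespace FilmChain

/-! ### Nearest point maps and squeezing towards convex sets -/

section NearestPoint

variable {E : Type*} [NormedAddCommGroup E] [InnerProductSpace ℝ E]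

/-! A point `p` outside the convex hull of `M` is cut off by a closed ball that contains `M` but not
`p` (`exists_closedBall_superset`). Moving points towards that ball along the rays from their
nearest points (`squeeze`) increases no distance, and near `p` it decreases distances by a definite
factor `θ < 1`, because the radial projection onto a ball contracts uniformly away from it. A
squeeze with positive factor is a homeomorphism fixing `M`, joined to the identity through such
homeomorphisms. Carrying a simple link along this isotopy keeps its linking numbers, so images of
spanning sets still span (`IsNearestPointMap.spans_squeeze`). Since the squeeze towards the ball may
leave `U`, it is taken small and followed by a squeeze towards a compact convex subset of `U`.

Consequently, for a small ball `B` about `p`, each admissible `X` yields an admissible set of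
measure at most `S(X \ B) + θ ^ (d + 1) * S(X ∩ B)`, where `S` is the spherical measure
(`exists_minimalSize_le`). Comparison with the infimum `m` bounds `S(X ∩ B)` by a constant times the
excess `S(X) - m`.

If film chains carried by sets `X i` converge to a minimizer `S₀`, their areas `S(X i)` tend to `m`,
hence `S(X i ∩ B)` tends to `0`. The integral over the cone of `S₀` of any form vanishing outside
`B` is the limit of integrals over `X i ∩ B`, so it is `0`, and `p` is not in the support.

The limits require the cone operator and integration to be continuous in the `B^2` norm. The
operators are `UniformSpace.Completion.extension`s, which extend a map only if it is uniformly
continuous, so bounds on Dirac chains are needed. A linear map on Dirac chains is `B^2`-bounded once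
its values on elements have bounded first and second differences (`norm_lift_le_of_second`). This
turns continuity into difference estimates for the product with the interval
(`continuous_intervalCross`) and for the pushforward (`continuous_pushforward`). -/

/-- `π` sends each point to its nearest point in the convex set `C`. -/
def IsNearestPointMap (C : Set E) (π : E → E) : Prop :=
  ∀ x, π x ∈ C ∧ ∀ w ∈ C, inner ℝ (x - π x) (w - π x) ≤ 0

/-- Moving each point along the ray from its nearest point by the factor `t`. -/
def squeeze (π : E → E) (t : ℝ) (x : E) : E := π x + t • (x - π x)

theorem exists_isNearestPointMap {C : Set E} (hne : C.Nonempty) (hcompl : IsComplete C)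
    (hC : Convex ℝ C) : ∃ π : E → E, IsNearestPointMap C π := by
  choose π hπ using fun x => exists_norm_eq_iInf_of_complete_convex hne hcompl hC x
  exact ⟨π, fun x => ⟨(hπ x).1, (norm_eq_iInf_iff_real_inner_le_zero hC (hπ x).1).1 (hπ x).2⟩⟩

theorem norm_squeeze_sub_self (π : E → E) (t : ℝ) (x : E) :
    ‖squeeze π t x - x‖ = |1 - t| * ‖x - π x‖ := by
  have : squeeze π t x - x = -((1 - t) • (x - π x)) := by
    simp only [squeeze, sub_smul, one_smul]
    abel
  rw [this, norm_neg, norm_smul, Real.norm_eq_abs]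

theorem norm_squeeze_sub_le (π : E → E) (t : ℝ) (x y : E) :
    ‖squeeze π t x - squeeze π t y‖ ≤ |1 - t| * ‖π x - π y‖ + |t| * ‖x - y‖ := by
  have : squeeze π t x - squeeze π t y = (1 - t) • (π x - π y) + t • (x - y) := by
    simp only [squeeze, smul_sub, sub_smul, one_smul]
    abel
  rw [this]
  refine (norm_add_le _ _).trans ?_
  rw [norm_smul, norm_smul, Real.norm_eq_abs, Real.norm_eq_abs]

namespace IsNearestPointMap

variable {C : Set E} {π : E → E}

/-- Firm nonexpansiveness: add the obtuse-angle inequalities at `π x`, tested with `π y`, and at `π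
y`, tested with `π x`. -/
theorem norm_sq_le (h : IsNearestPointMap C π) (x y : E) :
    ‖π x - π y‖ ^ 2 ≤ inner ℝ (x - y) (π x - π y) := by
  have h1 := (h x).2 _ (h y).1
  have h2 := (h y).2 _ (h x).1
  have h3 : inner ℝ (x - y) (π x - π y) - ‖π x - π y‖ ^ 2 =
      -inner ℝ (x - π x) (π y - π x) - inner ℝ (y - π y) (π x - π y) := by
    rw [← real_inner_self_eq_norm_sq, ← neg_sub (π x) (π y), inner_neg_right, neg_neg,
      ← inner_sub_left, ← inner_sub_left]
    congr 1
    abel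
  linarith

theorem norm_sub_le (h : IsNearestPointMap C π) (x y : E) : ‖π x - π y‖ ≤ ‖x - y‖ := by
  have h1 := (h.norm_sq_le x y).trans (real_inner_le_norm _ _)
  by_contra! h2
  nlinarith [norm_nonneg (x - y)]

/-- Uniqueness of the nearest point: the obtuse-angle conditions at `z` and at `π x` add up to `‖π x
- z‖ ^ 2 ≤ 0`. -/
theorem eq_of_forall_inner_le (h : IsNearestPointMap C π) {x z : E} (hz : z ∈ C)
    (hx : ∀ w ∈ C, inner ℝ (x - z) (w - z) ≤ 0) : π x = z := by
  have h1 := hx _ (h x).1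
  have h2 := (h x).2 _ hz
  have h3 : ‖π x - z‖ ^ 2 = inner ℝ (x - z) (π x - z) + inner ℝ (x - π x) (z - π x) := by
    rw [← real_inner_self_eq_norm_sq, ← neg_sub (π x) z, inner_neg_right (x - π x),
      ← sub_eq_add_neg, ← inner_sub_left]
    congr 1
    abel
  have h4 : ‖π x - z‖ = 0 := by nlinarith [norm_nonneg (π x - z)]
  exact sub_eq_zero.1 (norm_eq_zero.1 h4)

theorem apply_of_mem (h : IsNearestPointMap C π) {x : E} (hx : x ∈ C) : π x = x :=
  h.eq_of_forall_inner_le hx (by simp)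

/-- Rescaling `x - π x` by a nonnegative factor keeps it in the normal cone of `C` at `π x`.
Therefore the factors of squeezes multiply, and the inverse of a squeeze is the squeeze with the
inverse factor. -/
theorem apply_squeeze (h : IsNearestPointMap C π) {t : ℝ} (ht : 0 ≤ t) (x : E) :
    π (squeeze π t x) = π x := by
  refine h.eq_of_forall_inner_le (h x).1 fun w hw => ?_
  rw [squeeze, add_sub_cancel_left, real_inner_smul_left]
  exact mul_nonpos_of_nonneg_of_nonpos ht ((h x).2 w hw)

theorem squeeze_of_mem (h : IsNearestPointMap C π) (t : ℝ) {x : E} (hx : x ∈ C) :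
    squeeze π t x = x := by simp [squeeze, h.apply_of_mem hx]

theorem squeeze_squeeze (h : IsNearestPointMap C π) {t : ℝ} (ht : 0 ≤ t) (s : ℝ) (x : E) :
    squeeze π s (squeeze π t x) = squeeze π (s * t) x := by
  rw [squeeze, h.apply_squeeze ht, squeeze, squeeze, add_sub_cancel_left, mul_smul]

theorem squeeze_inv (h : IsNearestPointMap C π) {t : ℝ} (ht : 0 < t) (x : E) :
    squeeze π t⁻¹ (squeeze π t x) = x := by
  rw [h.squeeze_squeeze ht.le, inv_mul_cancel₀ ht.ne']
  simp [squeeze]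

theorem squeeze_inv' (h : IsNearestPointMap C π) {t : ℝ} (ht : 0 < t) (x : E) :
    squeeze π t (squeeze π t⁻¹ x) = x := by
  simpa using h.squeeze_inv (inv_pos.2 ht) x

theorem lipschitzWith_squeeze (h : IsNearestPointMap C π) (t : ℝ) :
    LipschitzWith (Real.toNNReal (|1 - t| + |t|)) (squeeze π t) := by
  refine LipschitzWith.of_dist_le_mul fun x y => ?_
  rw [Real.coe_toNNReal _ (by positivity), dist_eq_norm, dist_eq_norm, add_mul]
  refine (norm_squeeze_sub_le π t x y).trans ?_
  gcongr
  exact h.norm_sub_le x y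

theorem lipschitzWith_one_squeeze (h : IsNearestPointMap C π) {t : ℝ} (h0 : 0 ≤ t) (h1 : t ≤ 1) :
    LipschitzWith 1 (squeeze π t) := by
  have := h.lipschitzWith_squeeze t
  rwa [abs_of_nonneg (sub_nonneg.2 h1), abs_of_nonneg h0, sub_add_cancel, Real.toNNReal_one]
    at this

theorem continuous (h : IsNearestPointMap C π) : Continuous π :=
  (LipschitzWith.of_dist_le_mul (K := 1) fun x y => by
    simpa [dist_eq_norm] using h.norm_sub_le x y).continuous

/-- If the factor is positive, then points outside `M ⊆ C` stay outside `M`. -/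
theorem squeeze_notMem (h : IsNearestPointMap C π) {M : Set E} (hM : M ⊆ C) {t : ℝ} (ht : 0 < t)
    {x : E} (hx : x ∉ M) : squeeze π t x ∉ M := by
  intro h1
  have h2 := h.squeeze_of_mem t⁻¹ (hM h1)
  rw [h.squeeze_inv ht] at h2
  exact hx (h2 ▸ h1)

/-- Outside the ball the nearest point is the radial projection; the obtuse-angle condition is
Cauchy–Schwarz. -/
theorem eq_of_norm_sub_ge {c : E} {R : ℝ} (hR : 0 < R)
    (h : IsNearestPointMap (Metric.closedBall c R) π) {x : E} (hx : R ≤ ‖x - c‖) :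
    π x = c + (R / ‖x - c‖) • (x - c) := by
  have hr : 0 < ‖x - c‖ := hR.trans_le hx
  refine h.eq_of_forall_inner_le ?_ fun w hw => ?_
  · rw [mem_closedBall_iff_norm, add_sub_cancel_left, norm_smul, Real.norm_eq_abs,
      abs_of_nonneg (by positivity), div_mul_cancel₀ _ hr.ne']
  · rw [mem_closedBall_iff_norm] at hw
    have e1 : x - (c + (R / ‖x - c‖) • (x - c)) = (1 - R / ‖x - c‖) • (x - c) := by
      rw [sub_smul, one_smul]; abel
    have e2 : w - (c + (R / ‖x - c‖) • (x - c)) = (w - c) - (R / ‖x - c‖) • (x - c) := by abel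
    rw [e1, e2, real_inner_smul_left, inner_sub_right, real_inner_smul_right,
      real_inner_self_eq_norm_sq]
    have h1 : R / ‖x - c‖ ≤ 1 := (div_le_one hr).2 hx
    have h2 := real_inner_le_norm (x - c) (w - c)
    have h3 : R / ‖x - c‖ * ‖x - c‖ ^ 2 = R * ‖x - c‖ := by field_simp
    refine mul_nonpos_of_nonneg_of_nonpos (by linarith) ?_
    rw [h3]
    nlinarith

/-- The nearest point map of a ball contracts distances uniformly away from the ball. -/
theorem norm_sub_le_of_ball {c : E} {R k : ℝ} (hR : 0 < R) (hk : 1 ≤ k)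
    (h : IsNearestPointMap (Metric.closedBall c R) π) {x y : E} (hx : k * R ≤ ‖x - c‖)
    (hy : k * R ≤ ‖y - c‖) : ‖π x - π y‖ ≤ k⁻¹ * ‖x - y‖ := by
  have hx' : R ≤ ‖x - c‖ := le_trans (by nlinarith) hx
  have hy' : R ≤ ‖y - c‖ := le_trans (by nlinarith) hy
  rw [h.eq_of_norm_sub_ge hR hx', h.eq_of_norm_sub_ge hR hy', add_sub_add_left_eq_sub]
  have e : x - y = (x - c) - (y - c) := by abel
  rw [e]
  generalize x - c = a at *
  generalize y - c = b at *
  have ha : 0 < ‖a‖ := hR.trans_le hx'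
  have hb : 0 < ‖b‖ := hR.trans_le hy'
  have hk0 : 0 < k := by linarith
  rw [← div_eq_inv_mul, le_div_iff₀ hk0, mul_comm]
  refine le_of_sq_le_sq ?_ (norm_nonneg _)
  rw [mul_pow, norm_sub_sq_real, norm_sub_sq_real, norm_smul, norm_smul, real_inner_smul_left,
    real_inner_smul_right, Real.norm_eq_abs, Real.norm_eq_abs, abs_of_nonneg (by positivity),
    abs_of_nonneg (by positivity), div_mul_cancel₀ _ ha.ne', div_mul_cancel₀ _ hb.ne']
  set i : ℝ := inner ℝ a b
  have hi : i ≤ ‖a‖ * ‖b‖ := real_inner_le_norm a b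
  -- The squared distance of the projections is `2 R² / (‖a‖ ‖b‖)` times `‖a‖ ‖b‖ - ⟨a, b⟩`. As `k R
  -- ≤ ‖a‖, ‖b‖`, multiplying by `k²` gives at most `2 (‖a‖ ‖b‖ - ⟨a, b⟩)`, which falls short of `‖a
  -- - b‖²` by `(‖a‖ - ‖b‖)²`.
  have h2 : R ^ 2 - 2 * (R / ‖a‖ * (R / ‖b‖ * i)) + R ^ 2 =
      2 * R ^ 2 / (‖a‖ * ‖b‖) * (‖a‖ * ‖b‖ - i) := by field_simp; ring
  rw [h2]
  have h3 : k ^ 2 * (2 * R ^ 2 / (‖a‖ * ‖b‖) * (‖a‖ * ‖b‖ - i)) ≤ 2 * (‖a‖ * ‖b‖ - i) := by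
    rw [← mul_assoc]
    refine mul_le_mul_of_nonneg_right ?_ (by linarith)
    rw [← mul_div_assoc, div_le_iff₀ (by positivity)]
    have := mul_le_mul hx hy (by positivity) ha.le
    nlinarith
  nlinarith [sq_nonneg (‖a‖ - ‖b‖)]

end IsNearestPointMap

end NearestPoint

/-! ### Isotopy invariance of the spanning condition -/

section Isotopy

theorem homologyMap_congr (m : ℕ) {A B : Type} [TopologicalSpace A] [TopologicalSpace B]
    {f g : C(A, B)} (H : f.Homotopy g) : homologyMap m f = homologyMap m g := by
  have H' : TopCat.Homotopy (TopCat.ofHom f) (TopCat.ofHom g) := H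
  have := H'.congr_homologyMap_singularChainComplexFunctor (ModuleCat.of ℤ ℤ) m
  exact funext fun x => congrArg (fun φ => φ.hom x) this

variable {E : Type} [NormedAddCommGroup E] [InnerProductSpace ℝ E]

/-- The linking number is invariant under homotopies of the curve in the complement of `N`. -/
theorem HasLinkingNumber.of_homotopy {N : Set E} {γ γ' : C(Circle, E)} {k : ℤ}
    (h : HasLinkingNumber N γ k) (H : γ.Homotopy γ') (hH : ∀ x, H x ∉ N) :
    HasLinkingNumber N γ' k := by
  obtain ⟨hd, a, b, ha, hb, hab⟩ := h
  have hd' : Disjoint N (range γ') := by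
    rw [Set.disjoint_right]
    rintro _ ⟨z, rfl⟩ hz
    exact hH (1, z) (by simpa using hz)
  have hne : ∀ x : unitInterval × (N × Circle), (x.2.1 : E) - H (x.1, x.2.2) ≠ 0 :=
    fun x h0 => hH (x.1, x.2.2) (sub_eq_zero.1 h0 ▸ x.2.1.2)
  refine ⟨hd', a, b, ha, hb, ?_⟩
  rw [← hab]
  have G : (linkingMap N γ hd).Homotopy (linkingMap N γ' hd') :=
    { toFun := fun x => ⟨‖(x.2.1 : E) - H (x.1, x.2.2)‖⁻¹ • ((x.2.1 : E) - H (x.1, x.2.2)), by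
        simp [norm_smul, norm_ne_zero_iff.2 (hne x)]⟩
      continuous_toFun := by
        refine Continuous.subtype_mk ?_ _
        refine Continuous.smul (Continuous.inv₀ (by fun_prop) fun x => ?_) (by fun_prop)
        exact norm_ne_zero_iff.2 (hne x)
      map_zero_left := fun x => by
        apply Subtype.ext
        simp [linkingMap]
      map_one_left := fun x => by
        apply Subtype.ext
        simp [linkingMap] }
  rw [homologyMap_congr _ G]

/-- Apply the inverse squeeze to a link `γ`. The squeezes with factors running from `1` to `t⁻¹` are
positive throughout, so they move `γ` in the complement of `M` and keep every linking number. The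
resulting simple link meets `X`, and squeezing the common point back gives a point of `γ` in the
image of `X`. -/
theorem IsNearestPointMap.spans_squeeze {C M X : Set E} {π : E → E} (h : IsNearestPointMap C π)
    (hM : M ⊆ C) {t : ℝ} (ht : 0 < t) (hX : Spans X M) : Spans (squeeze π t '' X) M := by
  rintro γ ⟨hinj, hdisj, p, hp, hp1, hp0⟩
  have ht' : 0 < t⁻¹ := inv_pos.2 ht
  let γ' : C(Circle, E) :=
    ⟨fun z => squeeze π t⁻¹ (γ z), (h.lipschitzWith_squeeze _).continuous.comp γ.continuous⟩
  let H : γ.Homotopy γ' :=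
    { toFun := fun x => squeeze π (1 + (x.1 : ℝ) * (t⁻¹ - 1)) (γ x.2)
      continuous_toFun := by
        have := h.continuous
        unfold squeeze
        fun_prop
      map_zero_left := fun z => by simp [squeeze]
      map_one_left := fun z => by simp [γ'] }
  have hpos : ∀ s : unitInterval, 0 < 1 + (s : ℝ) * (t⁻¹ - 1) := fun s => by
    have h0 := s.2.1
    have h1 := s.2.2
    rcases eq_or_lt_of_le h0 with h2 | h2
    · rw [← h2]; norm_num
    · nlinarith [mul_pos h2 ht']
  have hH : ∀ x, H x ∉ M := fun x =>
    h.squeeze_notMem hM (hpos x.1) fun hx => Set.disjoint_left.1 hdisj hx ⟨x.2, rfl⟩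
  have hH' : ∀ q x, H x ∉ connectedComponentIn M q := fun q x hx =>
    hH x (connectedComponentIn_subset M q hx)
  have hlink : IsSimpleLink M γ' := by
    refine ⟨fun z w hzw => hinj ?_, ?_, p, hp, hp1.of_homotopy H (hH' p), fun q hq hqp =>
      (hp0 q hq hqp).of_homotopy H (hH' q)⟩
    · have := congrArg (squeeze π t) hzw
      simpa [γ', h.squeeze_inv' ht] using this
    · rw [Set.disjoint_right]
      rintro _ ⟨z, rfl⟩ hz
      exact hH (1, z) (by simpa using hz)
  obtain ⟨x, hx, z, rfl⟩ := hX γ' hlink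
  exact ⟨γ z, ⟨_, hx, by simp [γ', h.squeeze_inv' ht]⟩, z, rfl⟩

end Isotopy

/-! ### Hausdorff and spherical measures of images -/

section Images

/-- Since `f` is `1`-Lipschitz, the image of a ball about `x` stays in the ball of the same radius
about `f x`; since the left inverse `g` is Lipschitz, the image of a set of positive Hausdorff
measure has positive measure. -/
theorem core_image {E : Type*} [NormedAddCommGroup E] [MeasurableSpace E] [BorelSpace E] {m : ℕ}
    {X : Set E} {f g : E → E} {K : ℝ≥0} (hf : LipschitzWith 1 f)
    (hg : LipschitzWith K g) (hgf : Function.LeftInverse g f) (hX : core m X = X) :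
    core m (f '' X) = f '' X := by
  refine Subset.antisymm (fun x hx => hx.1) ?_
  rintro _ ⟨x, hx, rfl⟩
  refine ⟨⟨x, hx, rfl⟩, fun ρ hρ => ?_⟩
  have h1 : 0 < hausdorff m (X ∩ Metric.ball x ρ) := (hX.ge hx).2 ρ hρ
  have h2 : f '' (X ∩ Metric.ball x ρ) ⊆ f '' X ∩ Metric.ball (f x) ρ := by
    rintro _ ⟨y, ⟨hy, hy'⟩, rfl⟩
    refine ⟨⟨y, hy, rfl⟩, ?_⟩
    rw [Metric.mem_ball] at *
    exact (hf.dist_le_mul y x).trans_lt (by simpa using hy')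
  refine lt_of_lt_of_le ?_ (measure_mono h2)
  have h3 := (hg.to_rightInverse hgf).le_hausdorffMeasure_image (d := m) (by positivity)
    (X ∩ Metric.ball x ρ)
  simp only [hausdorff, Measure.smul_apply, smul_eq_mul, CanonicallyOrderedAdd.mul_pos] at h1 ⊢
  refine ⟨h1.1, ?_⟩
  have h4 := h1.2.trans_le h3
  exact (CanonicallyOrderedAdd.mul_pos.1 h4).2

variable {E : Type*} [NormedAddCommGroup E] [InnerProductSpace ℝ E] [MeasurableSpace E]
  [BorelSpace E] [Nontrivial E]

/-- A covering ball of radius `ρ` goes into the ball of radius `θ ρ` about the image of its centre,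
so weights scale by `θ ^ m`. The centre need not lie in `A`, which is why the Lipschitz bound is
assumed on a set `A'` containing every ball of radius `2 r₀` about points of `A`. -/
theorem spherical_image_le {m : ℕ} {f : E → E} {A A' : Set E} {θ : ℝ≥0} (hθ : 0 < θ) (hθ1 : θ ≤ 1)
    {r₀ : ℝ} (hr₀ : 0 < r₀) (hA : ∀ x ∈ A, Metric.closedBall x (2 * r₀) ⊆ A')
    (hf : LipschitzOnWith θ f A') (hAm : MeasurableSet A) (hfA : MeasurableSet (f '' A)) :
    spherical m (f '' A) ≤ (θ : ℝ≥0∞) ^ m * spherical m A := by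
  set w : Set E → ℝ≥0∞ := fun s => ⨅ (c : E) (ρ : ℝ≥0) (_ : s = Metric.closedBall c ρ),
    unitBallVolume m * (ρ : ℝ≥0∞) ^ m with hw
  have hθ0 : (θ : ℝ≥0∞) ^ m ≠ 0 := pow_ne_zero _ (by exact_mod_cast hθ.ne')
  have hθt : (θ : ℝ≥0∞) ^ m ≠ ⊤ := by finiteness
  have key : ∀ r : ℝ≥0∞, r ≤ ENNReal.ofReal (2 * r₀) →
      ((θ : ℝ≥0∞) ^ m)⁻¹ • OuterMeasure.restrict A
        (OuterMeasure.comap f (OuterMeasure.mkMetric'.pre w r)) ≤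
        OuterMeasure.mkMetric'.pre w r := by
    intro r hr
    -- `pre w r` is the largest outer measure dominated by `w` on sets of diameter at most `r`, so
    -- only closed balls have to be tested: `w` is infinite on all other sets.
    rw [OuterMeasure.mkMetric'.le_pre]
    intro s hs
    refine le_iInf fun c => le_iInf fun ρ => le_iInf fun h => ?_
    subst h
    simp only [smul_apply, OuterMeasure.restrict_apply, OuterMeasure.comap_apply,
      smul_eq_mul]
    rcases (Metric.closedBall c (ρ : ℝ) ∩ A).eq_empty_or_nonempty with h0 | ⟨a, hac, haA⟩
    · simp [h0]
    -- In a nontrivial space a ball of radius `ρ` has diameter exactly `2 ρ`, so the bound on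
    -- diameters bounds the radius.
    have hρ : 2 * (ρ : ℝ) = Metric.diam (Metric.closedBall c (ρ : ℝ)) :=
      (Metric.diam_closedBall_eq c ρ.2).symm
    have hρr : ENNReal.ofReal (2 * ρ) ≤ r := by
      rw [hρ, Metric.diam, ENNReal.ofReal_toReal]
      · exact hs
      · exact (Metric.isBounded_closedBall.ediam_ne_top)
    have hρ0 : (ρ : ℝ) ≤ r₀ := by
      have := (ENNReal.ofReal_le_ofReal_iff (by positivity)).1 (hρr.trans hr)
      linarith
    have hsub : Metric.closedBall c (ρ : ℝ) ⊆ A' := by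
      refine Subset.trans ?_ (hA a haA)
      intro y hy
      rw [Metric.mem_closedBall] at *
      linarith [dist_triangle_right y a c]
    have himg : f '' (Metric.closedBall c (ρ : ℝ) ∩ A) ⊆
        Metric.closedBall (f c) ((θ * ρ : ℝ≥0) : ℝ) := by
      rintro _ ⟨y, ⟨hy, _⟩, rfl⟩
      rw [Metric.mem_closedBall]
      refine (hf.dist_le_mul y (hsub hy) c (hsub (Metric.mem_closedBall_self ρ.2))).trans ?_
      rw [NNReal.coe_mul]
      gcongr
      exact hy
    have hle : OuterMeasure.mkMetric'.pre w r (f '' (Metric.closedBall c (ρ : ℝ) ∩ A)) ≤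
        unitBallVolume m * ((θ * ρ : ℝ≥0) : ℝ≥0∞) ^ m := by
      refine (measure_mono himg).trans ((OuterMeasure.mkMetric'.pre_le ?_).trans ?_)
      · refine le_trans ?_ hρr
        have : Metric.diam (Metric.closedBall (f c) ((θ * ρ : ℝ≥0) : ℝ)) ≤ 2 * ρ := by
          rw [Metric.diam_closedBall_eq _ (NNReal.coe_nonneg _), NNReal.coe_mul]
          have : (θ : ℝ) ≤ 1 := by exact_mod_cast hθ1
          nlinarith [ρ.2]
        refine le_trans ?_ (ENNReal.ofReal_le_ofReal this)
        rw [Metric.diam, ENNReal.ofReal_toReal]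
        exact Metric.isBounded_closedBall.ediam_ne_top
      · exact iInf_le_of_le (f c) (iInf_le_of_le (θ * ρ) (iInf_le_of_le rfl le_rfl))
    refine (mul_le_mul_right hle _).trans (le_of_eq ?_)
    rw [ENNReal.coe_mul, mul_pow, mul_left_comm, ← mul_assoc _ _ ((ρ : ℝ≥0∞) ^ m),
      ENNReal.inv_mul_cancel hθ0 hθt, one_mul]
  rw [spherical, Measure.mkMetric', toMeasure_apply _ _ hAm, toMeasure_apply _ _ hfA]
  refine le_of_tendsto_of_tendsto (OuterMeasure.mkMetric'.tendsto_pre w (f '' A))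
    (ENNReal.Tendsto.const_mul (OuterMeasure.mkMetric'.tendsto_pre w A) (Or.inr hθt)) ?_
  have hev : ∀ᶠ r in 𝓝[>] (0 : ℝ≥0∞), r ≤ ENNReal.ofReal (2 * r₀) := by
    refine mem_nhdsWithin_of_mem_nhds (Iic_mem_nhds ?_)
    simpa using hr₀
  filter_upwards [hev] with r hr
  have := key r hr A
  simp only [smul_apply, OuterMeasure.restrict_apply, OuterMeasure.comap_apply,
    smul_eq_mul, inter_self] at this
  rw [mul_comm, ← ENNReal.div_le_iff_le_mul (Or.inl hθ0) (Or.inl hθt), div_eq_mul_inv, mul_comm]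
  exact this

end Images

/-! ### Contractions towards the convex hull -/

section Contraction

variable {E : Type*} [NormedAddCommGroup E] [InnerProductSpace ℝ E] [FiniteDimensional ℝ E]

theorem sum_ite_mem_range_invFun {ι κ G : Type*} [Fintype ι] [Fintype κ] [Nonempty ι]
    [AddCommMonoid G] (e : ι ↪ κ) [∀ j, Decidable (j ∈ range e)] (a : ι → G) :
    ∑ j, (if j ∈ range e then a (Function.invFun e j) else 0) = ∑ i, a i := by
  symm
  refine Finset.sum_of_injOn e e.injective.injOn (by simp) ?_ ?_
  · intro j _ hj
    rw [if_neg]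
    simpa using hj
  · intro i _
    rw [if_pos ⟨i, rfl⟩, Function.leftInverse_invFun e.injective i]

/-- By Carathéodory's theorem the hull is the continuous image of a simplex times a power of `M`;
shorter convex combinations are padded with zero weights. -/
theorem isCompact_convexHull {M : Set E} (hM : IsCompact M) : IsCompact (convexHull ℝ M) := by
  set D := Module.finrank ℝ E + 1
  let f : (Fin D → ℝ) × (Fin D → E) → E := fun x => ∑ i, x.1 i • x.2 i
  have hf : Continuous f := by fun_prop
  have hc : IsCompact (f '' (stdSimplex ℝ (Fin D) ×ˢ Set.univ.pi fun _ => M)) :=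
    ((isCompact_stdSimplex ℝ (Fin D)).prod (isCompact_univ_pi fun _ => hM)).image hf
  convert hc using 1
  refine Subset.antisymm (fun x hx => ?_) ?_
  · obtain ⟨ι, _, z, w, hz, hai, hw, hw1, rfl⟩ := eq_pos_convex_span_of_mem_convexHull hx
    have hcard : Fintype.card ι ≤ Fintype.card (Fin D) := by
      rw [Fintype.card_fin]
      exact hai.card_le_finrank_succ.trans
        (Nat.add_le_add_right (Submodule.finrank_le _) 1)
    obtain ⟨e⟩ := Function.Embedding.nonempty_of_card_le hcard
    have : Nonempty ι := by
      by_contra h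
      rw [not_nonempty_iff] at h
      simp at hw1
    classical
    refine ⟨(fun j => if j ∈ range e then w (Function.invFun e j) else 0,
      fun j => z (Function.invFun e j)), ⟨⟨fun j => ?_, ?_⟩, fun j _ => hz ⟨_, rfl⟩⟩, ?_⟩
    · dsimp only
      split_ifs
      · exact (hw _).le
      · exact le_rfl
    · exact (sum_ite_mem_range_invFun e w).trans hw1
    · rw [← sum_ite_mem_range_invFun e fun i => w i • z i]
      refine Finset.sum_congr rfl fun j _ => ?_
      dsimp only
      split_ifs <;> simp
  · rintro _ ⟨⟨w, z⟩, ⟨⟨hw, hw1⟩, hz⟩, rfl⟩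
    exact (convex_convexHull ℝ M).sum_mem (fun i _ => hw i) hw1
      fun i _ => subset_convexHull ℝ M (hz i trivial)

/-- A point outside the convex hull of a compact set can be separated from it by a ball. -/
theorem exists_closedBall_superset [Nontrivial E] {M : Set E} (hM : IsCompact M) {p : E}
    (hp : p ∉ convexHull ℝ M) : ∃ (c : E) (R : ℝ), 0 < R ∧ M ⊆ Metric.closedBall c R ∧
      R < ‖p - c‖ := by
  rcases M.eq_empty_or_nonempty with rfl | ⟨b₀, hb₀⟩
  · obtain ⟨v, hv⟩ := exists_ne (0 : E)
    have : 0 < ‖v‖ := norm_pos_iff.2 hv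
    exact ⟨p - v, ‖v‖ / 2, by positivity, empty_subset _, by simpa using this⟩
  obtain ⟨f, u, hfp, hfu⟩ := geometric_hahn_banach_point_closed (convex_convexHull ℝ M)
    (isCompact_convexHull hM).isClosed hp
  obtain ⟨e, rfl⟩ := (InnerProductSpace.toDual ℝ E).surjective f
  simp only [InnerProductSpace.toDual_apply_apply] at hfp hfu
  obtain ⟨D, hD⟩ := hM.isBounded.subset_closedBall p
  set D' := |D| + 1
  have hD' : 0 < D' := by positivity
  set σ := u - inner ℝ e p
  have hσ : 0 < σ := sub_pos.2 hfp
  -- The centre is `p + T • e`, far along the separating normal. As `⟨e, b - p⟩ > σ`, expanding the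
  -- square gives `‖b - (p + T • e)‖² < ‖T • e‖² + D'² - 2 T σ`, and `T σ = D'²` makes this the
  -- squared radius `‖T • e‖² - D'²`, smaller than the squared distance of `p` from the centre.
  set T := D' ^ 2 / σ
  have hT : 0 < T := by positivity
  have hTσ : T * σ = D' ^ 2 := div_mul_cancel₀ _ hσ.ne'
  have hb : ∀ b ∈ M, ‖b - (p + T • e)‖ ^ 2 < ‖T • e‖ ^ 2 - D' ^ 2 := by
    intro b hb
    have h1 : ‖b - p‖ < D' := by
      have := hD hb
      rw [mem_closedBall_iff_norm] at this
      linarith [le_abs_self D, this]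
    have h2 := hfu b (subset_convexHull ℝ M hb)
    have h3 : b - (p + T • e) = (b - p) - T • e := by abel
    rw [h3, norm_sub_sq_real, real_inner_smul_right, real_inner_comm, inner_sub_right]
    have h4 : T * σ ≤ T * (inner ℝ e b - inner ℝ e p) :=
      mul_le_mul_of_nonneg_left (by simp only [σ]; linarith) hT.le
    nlinarith [norm_nonneg (b - p)]
  have hpos : 0 < ‖T • e‖ ^ 2 - D' ^ 2 := (sq_nonneg _).trans_lt (hb b₀ hb₀)
  refine ⟨p + T • e, Real.sqrt (‖T • e‖ ^ 2 - D' ^ 2), Real.sqrt_pos.2 hpos, fun b hbM => ?_, ?_⟩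
  · rw [mem_closedBall_iff_norm]
    exact Real.le_sqrt_of_sq_le (hb b hbM).le
  · rw [sub_add_cancel_left, norm_neg, Real.sqrt_lt' (by nlinarith [norm_nonneg (T • e)])]
    nlinarith

end Contraction

/-! ### Shrinking spanning sets near a point off the convex hull -/

section SpanningContraction

variable {d : ℕ}

/-- Away from the convex hull of `M`, spanning sets can be made uniformly smaller. -/
theorem exists_minimalSize_le {M U : Set (EuclideanSpace ℝ (Fin (d + 2)))} (hM : IsCompact M)
    (hUo : IsOpen U) (hUc : Convex ℝ U) (hUb : Bornology.IsBounded U) (hne : U.Nonempty)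
    (hMU : M ⊆ U) {p : EuclideanSpace ℝ (Fin (d + 2))} (hp : p ∉ convexHull ℝ M) :
    ∃ ε > 0, ∃ θ : ℝ≥0, θ < 1 ∧ ∀ X ∈ spanningSets M U,
      minimalSize M U ≤ spherical (d + 1) (X \ Metric.ball p ε) +
        (θ : ℝ≥0∞) ^ (d + 1) * spherical (d + 1) (X ∩ Metric.ball p ε) := by
  obtain ⟨q, hq⟩ := hne
  obtain ⟨c, R, hR, hMB, hRp⟩ := exists_closedBall_superset hM hp
  -- This compact convex subset of `U` contains `M`, and `q` keeps it nonempty when `M` is empty.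
  -- The half squeeze towards it creates the room that absorbs the displacement caused by the
  -- squeeze towards the ball.
  set K := convexHull ℝ (insert q M) with hK
  have hKU : K ⊆ U := convexHull_min (insert_subset hq hMU) hUc
  have hKc : IsCompact K := isCompact_convexHull (hM.insert q)
  have hMK : M ⊆ K := (subset_insert q M).trans (subset_convexHull ℝ _)
  obtain ⟨π₁, h₁⟩ := exists_isNearestPointMap (C := Metric.closedBall c R) ⟨c, by simp [hR.le]⟩
    Metric.isClosed_closedBall.isComplete (convex_closedBall c R)
  obtain ⟨π₂, h₂⟩ := exists_isNearestPointMap (C := K)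
    ⟨q, subset_convexHull ℝ _ (mem_insert q M)⟩ hKc.isComplete (convex_convexHull ℝ _)
  obtain ⟨η, hη, hηU⟩ := hKc.exists_cthickening_subset_open hUo hKU
  obtain ⟨D, hD⟩ := hUb.subset_closedBall c
  -- A bound for `‖x - π₁ x‖` on `U`. With `s * N ≤ η / 2` the squeeze towards the ball displaces
  -- points of `U` by at most `η / 2`.
  set N := |D| + R
  have hN : 0 < N := by positivity
  set s : ℝ := min (1 / 2) (η / (2 * N)) with hs
  have hs0 : 0 < s := by positivity
  have hs1 : s ≤ 1 / 2 := min_le_left _ _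
  have hsN : s * N ≤ η / 2 := by
    have : s ≤ η / (2 * N) := min_le_right _ _
    rw [le_div_iff₀ (by positivity)] at this
    linarith
  set Ψ : EuclideanSpace ℝ (Fin (d + 2)) → EuclideanSpace ℝ (Fin (d + 2)) :=
    squeeze π₂ (1 / 2) ∘ squeeze π₁ (1 - s) with hΨ
  have hL₁ : LipschitzWith 1 (squeeze π₁ (1 - s)) :=
    h₁.lipschitzWith_one_squeeze (by linarith) (by linarith)
  have hL₂ : LipschitzWith 1 (squeeze π₂ (1 / 2)) :=
    h₂.lipschitzWith_one_squeeze (by norm_num) (by norm_num)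
  have hΨL : LipschitzWith 1 Ψ := by
    have := hL₂.comp hL₁
    rwa [one_mul] at this
  have hΨinj : Function.Injective Ψ :=
    (Function.LeftInverse.injective (h₂.squeeze_inv (by norm_num))).comp
      (Function.LeftInverse.injective (h₁.squeeze_inv (by linarith)))
  have hΨU : MapsTo Ψ U U := by
    intro x hx
    set y := squeeze π₁ (1 - s) x with hy
    have hyx : ‖y - x‖ ≤ η / 2 := by
      rw [norm_squeeze_sub_self, sub_sub_cancel, abs_of_pos hs0]
      refine le_trans (mul_le_mul_of_nonneg_left ?_ hs0.le) hsN
      have e1 := mem_closedBall_iff_norm.1 (hD hx)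
      have e2 := mem_closedBall_iff_norm'.1 (h₁ x).1
      have e3 := norm_add_le (x - c) (c - π₁ x)
      rw [sub_add_sub_cancel] at e3
      linarith [le_abs_self D]
    set w := squeeze π₂ (1 / 2) y - squeeze π₂ (1 / 2) x with hw
    have hwn : ‖w‖ ≤ η / 2 := by
      have := hL₂.dist_le_mul y x
      rw [dist_eq_norm, dist_eq_norm, NNReal.coe_one, one_mul] at this
      exact this.trans hyx
    -- The image is the midpoint of `x` and a point within `η` of `π₂ x ∈ K`; both lie in the convex
    -- set `U`.
    have e : Ψ x = (1 / 2 : ℝ) • (π₂ x + (2 : ℝ) • w) + (1 / 2 : ℝ) • x := by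
      have : Ψ x = w + squeeze π₂ (1 / 2) x := (sub_add_cancel _ _).symm
      rw [this, squeeze]
      module
    rw [e]
    refine hUc (hηU ?_) hx (by norm_num) (by norm_num) (by norm_num)
    refine Metric.mem_cthickening_of_dist_le _ (π₂ x) _ _ (h₂ x).1 ?_
    rw [dist_eq_norm, add_sub_cancel_left, norm_smul]
    norm_num
    linarith
  set P := ‖p - c‖
  -- Chosen so that `k R` is halfway between the radius `R` and the distance `P` from `p` to the
  -- centre.
  set k := (1 + P / R) / 2 with hk
  have hPR : 1 < P / R := (one_lt_div hR).2 hRp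
  have hk1 : 1 < k := by rw [hk]; linarith
  have hkR : k * R = (R + P) / 2 := by rw [hk]; field_simp
  have hki : k⁻¹ < 1 := inv_lt_one_of_one_lt₀ hk1
  have hki0 : 0 < k⁻¹ := inv_pos.2 (by linarith)
  -- The squeeze is `s` times the projection, which is `k⁻¹`-Lipschitz beyond radius `k R`, plus `1
  -- - s` times the identity.
  set θ : ℝ≥0 := ⟨s * k⁻¹ + (1 - s), by nlinarith⟩ with hθ
  have hθ0 : 0 < θ := by
    rw [← NNReal.coe_pos]
    change 0 < s * k⁻¹ + (1 - s)
    nlinarith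
  have hθ1 : θ < 1 := by
    rw [← NNReal.coe_lt_coe]
    change s * k⁻¹ + (1 - s) < 1
    nlinarith
  set A' := {x | k * R ≤ ‖x - c‖} with hA'
  have hΨA' : LipschitzOnWith θ Ψ A' := by
    refine LipschitzOnWith.of_dist_le_mul fun x hx y hy => ?_
    refine (hL₂.dist_le_mul _ _).trans ?_
    rw [dist_eq_norm, dist_eq_norm, NNReal.coe_one, one_mul]
    refine (norm_squeeze_sub_le π₁ (1 - s) x y).trans ?_
    rw [sub_sub_cancel, abs_of_pos hs0, abs_of_nonneg (by linarith)]
    have := h₁.norm_sub_le_of_ball hR hk1.le hx hy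
    change _ ≤ (s * k⁻¹ + (1 - s)) * ‖x - y‖
    nlinarith
  -- Balls of radius `2 * ((P - R) / 12)` about points of this ball stay within `(P - R) / 3` of
  -- `p`, hence beyond radius `k R = (R + P) / 2`, where `Ψ` is `θ`-Lipschitz.
  refine ⟨(P - R) / 6, by linarith, θ, hθ1, fun X hX => ?_⟩
  obtain ⟨hXc, hXU, hXcore, hXfin, hXspan⟩ := hX
  set B := Metric.ball p ((P - R) / 6)
  have hmeas : ∀ S : Set (EuclideanSpace ℝ (Fin (d + 2))), MeasurableSet S →
      MeasurableSet (Ψ '' S) :=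
    fun S hS => hS.image_of_continuousOn_injOn hΨL.continuous.continuousOn hΨinj.injOn
  have hle1 : ∀ S : Set (EuclideanSpace ℝ (Fin (d + 2))), MeasurableSet S →
      spherical (d + 1) (Ψ '' S) ≤ spherical (d + 1) S := fun S hS => by
    simpa using spherical_image_le (m := d + 1) (A' := univ) one_pos le_rfl one_pos
      (fun _ _ => subset_univ _) hΨL.lipschitzOnWith hS (hmeas S hS)
  have hX' : Ψ '' X ∈ spanningSets M U := by
    refine ⟨hXc.image hΨL.continuous, (hΨU.mono_left hXU).image_subset, ?_,
      (hle1 X hXc.measurableSet).trans_lt hXfin, ?_⟩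
    · rw [hΨ, image_comp]
      exact core_image hL₂ (h₂.lipschitzWith_squeeze _) (h₂.squeeze_inv (by norm_num))
        (core_image hL₁ (h₁.lipschitzWith_squeeze _) (h₁.squeeze_inv (by linarith)) hXcore)
    · rw [hΨ, image_comp]
      exact h₂.spans_squeeze hMK (by norm_num) (h₁.spans_squeeze hMB (by linarith) hXspan)
  have hball : spherical (d + 1) (Ψ '' (X ∩ B)) ≤
      (θ : ℝ≥0∞) ^ (d + 1) * spherical (d + 1) (X ∩ B) := by
    refine spherical_image_le hθ0 hθ1.le (r₀ := (P - R) / 12) (by linarith) ?_ hΨA'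
      (hXc.measurableSet.inter measurableSet_ball) (hmeas _ (hXc.measurableSet.inter
        measurableSet_ball))
    intro x hx y hy
    have e1 := mem_ball_iff_norm'.1 hx.2
    have e2 := mem_closedBall_iff_norm'.1 hy
    have e3 := norm_add₃_le (a := p - x) (b := x - y) (c := y - c)
    rw [sub_add_sub_cancel, sub_add_sub_cancel] at e3
    change k * R ≤ ‖y - c‖
    rw [hkR]
    linarith
  calc minimalSize M U ≤ spherical (d + 1) (Ψ '' X) := iInf₂_le _ hX'
    _ ≤ spherical (d + 1) (Ψ '' (X \ B)) + spherical (d + 1) (Ψ '' (X ∩ B)) := by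
        rw [← sdiff_union_inter X B, image_union]
        simpa using measure_union_le (μ := spherical (d + 1)) (Ψ '' (X \ B)) (Ψ '' (X ∩ B))
    _ ≤ _ := add_le_add (hle1 _ (hXc.measurableSet.diff measurableSet_ball)) hball

end SpanningContraction

/-! ### The mass norm on multivectors -/

section MassNorm

variable {E : Type*} [NormedAddCommGroup E] [InnerProductSpace ℝ E]

/-- The Gram matrix of the rows of `A` is `A * Aᵀ`, with determinant `A.det ^ 2`. -/
theorem simpleMass_sum_smul {k : ℕ} {e : Fin k → E} (he : Orthonormal ℝ e)
    (A : Matrix (Fin k) (Fin k) ℝ) : simpleMass (fun i => ∑ j, A i j • e j) = |A.det| := by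
  have h : (Matrix.of fun i j => inner ℝ (∑ l, A i l • e l) (∑ l, A j l • e l)) =
      A * A.transpose := by
    ext i j
    rw [Matrix.of_apply, he.inner_sum, Matrix.mul_apply]
    simp
  rw [simpleMass, h, Matrix.det_mul, Matrix.det_transpose, ← sq, Real.sqrt_sq_eq_abs]

/-- Both sides are alternating in the rows of `A`, so it suffices to compare them on permutations of
the standard basis. -/
theorem _root_.AlternatingMap.map_sum_smul {ι R N G : Type*} [CommRing R] [AddCommGroup N]
    [Module R N] [AddCommGroup G] [Module R G] [Fintype ι] [DecidableEq ι]
    (Φ : N [⋀^ι]→ₗ[R] G) (e : ι → N) (A : Matrix ι ι R) :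
    Φ (fun i => ∑ j, A i j • e j) = A.det • Φ e := by
  have h : Φ.compLinearMap (Fintype.linearCombination R e) =
      (LinearMap.toSpanSingleton R G (Φ e)).compAlternatingMap (Pi.basisFun R ι).det := by
    refine (Pi.basisFun R ι).ext_alternating fun v hv => ?_
    obtain ⟨σ, rfl⟩ : ∃ σ : Equiv.Perm ι, v = σ :=
      ⟨Equiv.ofBijective v (Finite.injective_iff_bijective.1 hv), rfl⟩
    have h1 := Φ.map_perm e σ
    have h2 := (Pi.basisFun R ι).det.map_perm (Pi.basisFun R ι) σ
    simp only [Function.comp_def] at h1 h2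
    simp only [AlternatingMap.compLinearMap_apply, LinearMap.compAlternatingMap_apply, h2,
      Module.Basis.det_self]
    simp [Fintype.linearCombination_apply_single, h1]
  have := congrArg (fun Ψ => Ψ fun i => A i) h
  simp only [AlternatingMap.compLinearMap_apply, LinearMap.compAlternatingMap_apply,
    Fintype.linearCombination_apply, LinearMap.toSpanSingleton_apply] at this
  rw [this]
  congr 1
  rw [Module.Basis.det_apply, ← Matrix.det_transpose A]
  rfl

/-- Write `v` in an orthonormal basis of its span: `Φ v` and the mass both acquire the factor `|det
A|`. For dependent vectors `Φ v = 0`. -/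
theorem norm_map_le_simpleMass {G : Type*} [SeminormedAddCommGroup G] [NormedSpace ℝ G] {k : ℕ}
    (Φ : E [⋀^Fin k]→ₗ[ℝ] G) {C : ℝ} (hC : 0 ≤ C)
    (h : ∀ e : Fin k → E, Orthonormal ℝ e → ‖Φ e‖ ≤ C) (v : Fin k → E) :
    ‖Φ v‖ ≤ C * simpleMass v := by
  by_cases hv : LinearIndependent ℝ v
  · set S := Submodule.span ℝ (range v)
    have hfin : Module.finrank ℝ S = k := by simpa using finrank_span_eq_card hv
    have : FiniteDimensional ℝ S := FiniteDimensional.span_of_finite ℝ (finite_range v)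
    let b : OrthonormalBasis (Fin k) ℝ S := (stdOrthonormalBasis ℝ S).reindex (finCongr hfin)
    have hb : Orthonormal ℝ fun j => (b j : E) := by
      have := b.orthonormal.comp_linearIsometry S.subtypeₗᵢ
      simpa [Function.comp_def] using this
    let A : Matrix (Fin k) (Fin k) ℝ :=
      fun i j => b.repr ⟨v i, Submodule.subset_span (mem_range_self i)⟩ j
    have hvA : v = fun i => ∑ j, A i j • (b j : E) := by
      funext i
      have := congrArg S.subtype
        (b.sum_repr ⟨v i, Submodule.subset_span (mem_range_self i)⟩)
      rw [map_sum] at this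
      exact this.symm
    rw [hvA, simpleMass_sum_smul hb, Φ.map_sum_smul, norm_smul, Real.norm_eq_abs, mul_comm]
    exact mul_le_mul_of_nonneg_right (h _ hb) (abs_nonneg _)
  · rw [Φ.map_linearDependent v hv, norm_zero]
    exact mul_nonneg hC (simpleMass_nonneg v)

theorem norm_lift_le_massNorm {G : Type*} [SeminormedAddCommGroup G] [NormedSpace ℝ G] {k : ℕ}
    (Φ : E [⋀^Fin k]→ₗ[ℝ] G) {C : ℝ} (hC : 0 ≤ C)
    (h : ∀ e : Fin k → E, Orthonormal ℝ e → ‖Φ e‖ ≤ C) (α : ⋀[ℝ]^k E) :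
    ‖exteriorPower.alternatingMapLinearEquiv Φ α‖ ≤ C * massNorm α := by
  rw [massNorm, ← smul_eq_mul, ← Real.sInf_smul_of_nonneg hC]
  obtain ⟨L₀, hL₀⟩ := exists_isSimpleSum α
  refine le_csInf ⟨_, ⟨_, ⟨L₀, hL₀, rfl⟩, rfl⟩⟩ ?_
  rintro _ ⟨_, ⟨L, hL, rfl⟩, rfl⟩
  rw [IsSimpleSum] at hL
  rw [hL, map_list_sum, List.map_map]
  simp only [smul_eq_mul]
  rw [← List.sum_map_mul_left]
  clear hL
  induction L with
  | nil => simp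
  | cons a L ih =>
    simp only [List.map_cons, List.sum_cons]
    refine (norm_add_le _ _).trans (add_le_add ?_ ih)
    simp only [Function.comp_apply, map_smul, norm_smul, Real.norm_eq_abs,
      exteriorPower.alternatingMapLinearEquiv_apply_ιMulti]
    rw [mul_left_comm]
    exact mul_le_mul_of_nonneg_left (norm_map_le_simpleMass Φ hC h _) (abs_nonneg _)

theorem norm_covectorEval_le {k : ℕ} (φ : E [⋀^Fin k]→L[ℝ] ℝ) (α : ⋀[ℝ]^k E) :
    ‖covectorEval φ α‖ ≤ ‖φ‖ * massNorm α :=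
  norm_lift_le_massNorm _ (norm_nonneg _) (fun e he => by
    simpa [he.1] using φ.le_opNorm e) α

theorem massNorm_add_le {k : ℕ} (α β : ⋀[ℝ]^k E) : massNorm (α + β) ≤ massNorm α + massNorm β := by
  obtain ⟨L₀, hL₀⟩ := exists_isSimpleSum α
  obtain ⟨L₁, hL₁⟩ := exists_isSimpleSum β
  rw [← sub_le_iff_le_add]
  refine le_csInf ⟨_, ⟨L₀, hL₀, rfl⟩⟩ ?_
  rintro _ ⟨L, hL, rfl⟩
  rw [sub_le_comm]
  refine le_csInf ⟨_, ⟨L₁, hL₁, rfl⟩⟩ ?_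
  rintro _ ⟨L', hL', rfl⟩
  have h : IsSimpleSum (L ++ L') (α + β) := by
    rw [IsSimpleSum] at *
    rw [List.map_append, List.sum_append, ← hL, ← hL']
  have := massNorm_le h
  rw [List.map_append, List.sum_append] at this
  linarith

/-- The mass as a seminorm. -/
def massSeminorm (E : Type*) [NormedAddCommGroup E] [InnerProductSpace ℝ E] (k : ℕ) :
    Seminorm ℝ (⋀[ℝ]^k E) :=
  Seminorm.ofSMulLE massNorm
    (le_antisymm ((massNorm_le (L := []) (by simp [IsSimpleSum])).trans (by simp))
      (massNorm_nonneg _)) massNorm_add_le massNorm_smul_le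

variable [FiniteDimensional ℝ E]

/-- Expanded in an orthonormal basis, orthonormal vectors have coordinates at most `1` in absolute
value, which bounds `Φ` on them. Applied to functionals this shows that the mass is a norm, and it
makes all algebraic operations on multivectors bounded. -/
theorem exists_norm_le_massNorm {G : Type*} [SeminormedAddCommGroup G] [NormedSpace ℝ G] {k : ℕ}
    (L : ⋀[ℝ]^k E →ₗ[ℝ] G) : ∃ C, 0 ≤ C ∧ ∀ α, ‖L α‖ ≤ C * massNorm α := by
  set Φ := exteriorPower.alternatingMapLinearEquiv.symm L
  have hL : L = exteriorPower.alternatingMapLinearEquiv Φ := by simp [Φ]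
  let b := stdOrthonormalBasis ℝ E
  have hC : 0 ≤ ∑ r : Fin k → Fin (Module.finrank ℝ E), ‖Φ fun i => b (r i)‖ := by positivity
  refine ⟨_, hC, fun α => ?_⟩
  rw [hL]
  refine norm_lift_le_massNorm Φ hC (fun e he => ?_) α
  have h1 : e = fun i => ∑ j, b.repr (e i) j • b j := by
    funext i
    exact (b.sum_repr (e i)).symm
  have h2 : Φ e = ∑ r : Fin k → Fin (Module.finrank ℝ E),
      (∏ i, b.repr (e i) (r i)) • Φ fun i => b (r i) := by
    conv_lhs => rw [h1]
    rw [← AlternatingMap.coe_multilinearMap, MultilinearMap.map_sum]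
    exact Finset.sum_congr rfl fun r _ => MultilinearMap.map_smul_univ _ _ _
  rw [h2]
  refine (norm_sum_le _ _).trans (Finset.sum_le_sum fun r _ => ?_)
  rw [norm_smul, norm_prod]
  refine mul_le_of_le_one_left (norm_nonneg _) (Finset.prod_le_one (fun _ _ => norm_nonneg _) ?_)
  intro i _
  refine (PiLp.norm_apply_le _ _).trans ?_
  rw [LinearIsometryEquiv.norm_map, he.1 i]

theorem eq_zero_of_massNorm_eq_zero {k : ℕ} {α : ⋀[ℝ]^k E} (h : massNorm α = 0) : α = 0 := by
  rw [← Module.forall_dual_apply_eq_zero_iff ℝ]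
  intro f
  obtain ⟨C, _, hC⟩ := exists_norm_le_massNorm f
  simpa [h] using hC α

instance (k : ℕ) : NormedAddCommGroup (⋀[ℝ]^k E) :=
  AddGroupNorm.toNormedAddCommGroup
    { toFun := massNorm
      map_zero' := map_zero (massSeminorm E k)
      add_le' := massNorm_add_le
      neg' := map_neg_eq_map (massSeminorm E k)
      eq_zero_of_map_eq_zero' := fun _ => eq_zero_of_massNorm_eq_zero }

instance (k : ℕ) : NormedSpace ℝ (⋀[ℝ]^k E) where
  norm_smul_le := massNorm_smul_le

end MassNorm

/-! ### Difference bounds and continuity of operators on Dirac chains -/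

section Differences

variable {E : Type*} [NormedAddCommGroup E] {G : Type*} [SeminormedAddCommGroup G]

/-- `g` is bounded by `C` and `C`-Lipschitz on `U`. -/
structure HasFirstDifferenceBound (U : Set E) (C : ℝ) (g : E → G) : Prop where
  norm_le : ∀ x ∈ U, ‖g x‖ ≤ C
  norm_sub_le : ∀ x ∈ U, ∀ u, x + u ∈ U → ‖g (x + u) - g x‖ ≤ C * ‖u‖

/-- `g` is bounded on `U`, with first and second differences of first and second order. -/
structure HasSecondDifferenceBound (U : Set E) (C : ℝ) (g : E → G) : Prop
    extends HasFirstDifferenceBound U C g where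
  norm_second_le : ∀ x ∈ U, ∀ u, x + u ∈ U → ∀ v, x + v ∈ U → x + u + v ∈ U →
    ‖g (x + u + v) - g (x + u) - (g (x + v) - g x)‖ ≤ C * ‖u‖ * ‖v‖

theorem HasFirstDifferenceBound.comp_linear [NormedSpace ℝ G] {H : Type*}
    [SeminormedAddCommGroup H] [NormedSpace ℝ H] {U : Set E} {C K : ℝ} {g : E → G}
    (hg : HasFirstDifferenceBound U C g)
    (hK : 0 ≤ K) (L : G →ₗ[ℝ] H) (hL : ∀ x, ‖L x‖ ≤ K * ‖x‖) :
    HasFirstDifferenceBound U (K * C) fun x => L (g x) where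
  norm_le x hx := (hL _).trans (mul_le_mul_of_nonneg_left (hg.norm_le x hx) hK)
  norm_sub_le x hx u hu := by
    rw [← map_sub, mul_assoc]
    exact (hL _).trans (mul_le_mul_of_nonneg_left (hg.norm_sub_le x hx u hu) hK)

theorem HasSecondDifferenceBound.comp_linear [NormedSpace ℝ G] {H : Type*}
    [SeminormedAddCommGroup H] [NormedSpace ℝ H] {U : Set E} {C K : ℝ} {g : E → G}
    (hg : HasSecondDifferenceBound U C g)
    (hK : 0 ≤ K) (L : G →ₗ[ℝ] H) (hL : ∀ x, ‖L x‖ ≤ K * ‖x‖) :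
    HasSecondDifferenceBound U (K * C) fun x => L (g x) where
  toHasFirstDifferenceBound := hg.toHasFirstDifferenceBound.comp_linear hK L hL
  norm_second_le x hx u hu v hv huv := by
    rw [← map_sub, ← map_sub, ← map_sub, mul_assoc, mul_assoc, ← mul_assoc C]
    exact (hL _).trans (mul_le_mul_of_nonneg_left (hg.norm_second_le x hx u hu v hv huv) hK)

theorem HasFirstDifferenceBound.mono {U : Set E} {C C' : ℝ} {g : E → G}
    (hg : HasFirstDifferenceBound U C g) (h : C ≤ C') : HasFirstDifferenceBound U C' g where
  norm_le x hx := (hg.norm_le x hx).trans h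
  norm_sub_le x hx u hu := (hg.norm_sub_le x hx u hu).trans (by gcongr)

theorem HasSecondDifferenceBound.mono {U : Set E} {C C' : ℝ} {g : E → G}
    (hg : HasSecondDifferenceBound U C g) (h : C ≤ C') : HasSecondDifferenceBound U C' g where
  toHasFirstDifferenceBound := hg.toHasFirstDifferenceBound.mono h
  norm_second_le x hx u hu v hv huv := (hg.norm_second_le x hx u hu v hv huv).trans (by gcongr)

end Differences

/-! ### Mean value estimates for second differences -/

section MeanValue

variable {E : Type*} [NormedAddCommGroup E] [NormedSpace ℝ E]
  {G : Type*} [NormedAddCommGroup G] [NormedSpace ℝ G]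

/-- Mean value inequality for `y ↦ g (y + v) - g y` on the convex set `U ∩ (U - v)`, where its
derivative is bounded by `K * ‖v‖`. -/
theorem norm_second_difference_le {U : Set E} (hUo : IsOpen U) (hUc : Convex ℝ U) {g : E → G}
    {K : ℝ} (hg : DifferentiableOn ℝ g U)
    (hK : ∀ x ∈ U, ∀ y ∈ U, ‖fderiv ℝ g x - fderiv ℝ g y‖ ≤ K * ‖x - y‖) {x u v : E} (hx : x ∈ U)
    (hu : x + u ∈ U) (hv : x + v ∈ U) (huv : x + u + v ∈ U) :
    ‖g (x + u + v) - g (x + u) - (g (x + v) - g x)‖ ≤ K * ‖u‖ * ‖v‖ := by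
  set s := U ∩ (fun y => y + v) ⁻¹' U with hs
  have hsc : Convex ℝ s := by
    refine hUc.inter ?_
    intro a ha b hb p q hp hq hpq
    have : p • a + q • b + v = p • (a + v) + q • (b + v) := by
      rw [smul_add, smul_add, add_add_add_comm, ← add_smul, hpq, one_smul]
    change p • a + q • b + v ∈ U
    rw [this]
    exact hUc ha hb hp hq hpq
  have hd : ∀ y ∈ s, HasFDerivWithinAt (fun y => g (y + v) - g y)
      (fderiv ℝ g (y + v) - fderiv ℝ g y) s y := by
    rintro y ⟨hy, hyv⟩
    have h1 := (hg.differentiableAt (hUo.mem_nhds hy)).hasFDerivAt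
    have h2 := (hg.differentiableAt (hUo.mem_nhds hyv)).hasFDerivAt
    exact ((hasFDerivAt_comp_add_right (f := g) v).2 h2 |>.sub h1).hasFDerivWithinAt
  have hb : ∀ y ∈ s, ‖fderiv ℝ g (y + v) - fderiv ℝ g y‖ ≤ K * ‖v‖ := by
    rintro y ⟨hy, hyv⟩
    simpa using hK _ hyv _ hy
  have := hsc.norm_image_sub_le_of_norm_hasFDerivWithin_le hd hb (x := x) (y := x + u)
    ⟨hx, hv⟩ ⟨hu, huv⟩
  rw [add_sub_cancel_left, mul_right_comm] at this
  exact this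

theorem norm_fderiv_sub_le (g : E → G) (x y : E) :
    ‖fderiv ℝ g x - fderiv ℝ g y‖ ≤ ‖iteratedFDeriv ℝ 1 g x - iteratedFDeriv ℝ 1 g y‖ := by
  refine ContinuousLinearMap.opNorm_le_bound _ (norm_nonneg _) fun v => ?_
  have := (iteratedFDeriv ℝ 1 g x - iteratedFDeriv ℝ 1 g y).le_opNorm fun _ => v
  simpa [iteratedFDeriv_one_apply] using this

end MeanValue

section Regularity

variable {E : Type*} [NormedAddCommGroup E] [InnerProductSpace ℝ E]
  {G : Type*} [NormedAddCommGroup G] [NormedSpace ℝ G]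

theorem IsClassB.hasFirstDifferenceBound {U : Set E} {g : E → G} (h : IsClassB U g 1) :
    ∃ C, 0 ≤ C ∧ HasFirstDifferenceBound U C g := by
  obtain ⟨-, h0, K, hK⟩ := h
  obtain ⟨C, hC⟩ := h0 0 le_rfl
  refine ⟨max (K : ℝ) C, le_max_of_le_left K.2, ⟨fun x hx => ?_, fun x hx u hu => ?_⟩⟩
  · simpa using (hC x hx).trans (le_max_right (K : ℝ) C)
  · have := hK.dist_le_mul _ hu _ hx
    rw [iteratedFDeriv_zero_eq_comp, Function.comp_apply, Function.comp_apply,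
      LinearIsometryEquiv.dist_map, dist_eq_norm, dist_eq_norm, add_sub_cancel_left] at this
    exact this.trans (by gcongr; exact le_max_left _ _)

theorem IsClassB.hasSecondDifferenceBound {U : Set E} (hUo : IsOpen U) (hUc : Convex ℝ U)
    {g : E → G} (h : IsClassB U g 2) : ∃ C, 0 ≤ C ∧ HasSecondDifferenceBound U C g := by
  obtain ⟨hd, h0, K, hK⟩ := h
  obtain ⟨C₀, hC₀⟩ := h0 0 (Nat.zero_le _)
  obtain ⟨C₁, hC₁⟩ := h0 1 le_rfl
  have hdiff : DifferentiableOn ℝ g U := hd.differentiableOn (by simp)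
  set C := max (K : ℝ) (max C₀ C₁)
  have hKC : (K : ℝ) ≤ C := le_max_left _ _
  have hC₀C : C₀ ≤ C := (le_max_left _ _).trans (le_max_right _ _)
  have hC₁C : C₁ ≤ C := (le_max_right _ _).trans (le_max_right _ _)
  refine ⟨C, K.2.trans hKC, ⟨⟨fun x hx => ?_, fun x hx u hu => ?_⟩,
    fun x hx u hu v hv huv => ?_⟩⟩
  · simpa using (hC₀ x hx).trans hC₀C
  · have := hUc.norm_image_sub_le_of_norm_fderiv_le (𝕜 := ℝ) (f := g) (C := C)
      (fun y hy => hdiff.differentiableAt (hUo.mem_nhds hy)) (fun y hy => ?_) hx hu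
    · rwa [add_sub_cancel_left] at this
    · rw [← norm_iteratedFDeriv_one]
      exact (hC₁ y hy).trans hC₁C
  · refine norm_second_difference_le hUo hUc hdiff (fun y hy z hz => ?_) hx hu hv huv
    have := hK.dist_le_mul _ hy _ hz
    rw [dist_eq_norm, dist_eq_norm] at this
    exact (norm_fderiv_sub_le g y z).trans (this.trans (by gcongr))

end Regularity

/-! ### Supports of first and second differences of point masses -/

section SingleDifferences

variable {E W : Type*} [AddCommGroup W]

theorem support_single_sub_single_subset {U : Set E} {a b : E} (α : W)
    (ha : a ∈ U) (hb : b ∈ U) :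
    ((Finsupp.single a α - Finsupp.single b α).support : Set E) ⊆ U := by
  classical
  intro x hx
  have := Finsupp.support_sub hx
  rw [Finset.mem_union] at this
  rcases this with h | h <;> rw [Finset.mem_singleton.1 (Finsupp.support_single_subset h)] <;>
    assumption

theorem support_sub_subset {U : Set E} {A B : E →₀ W}
    (hA : (A.support : Set E) ⊆ U) (hB : (B.support : Set E) ⊆ U) :
    ((A - B).support : Set E) ⊆ U := by
  classical
  intro x hx
  rcases Finset.mem_union.1 (Finsupp.support_sub hx) with h | h
  exacts [hA h, hB h]

variable [AddCommGroup E]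

theorem single_sub_single_pair (u v p : E) (α : W) :
    Finsupp.mapDomain (· + v) (Finsupp.single (p + u) α - Finsupp.single p α) -
      (Finsupp.single (p + u) α - Finsupp.single p α) =
    Finsupp.single (p + u + v) α - Finsupp.single (p + v) α -
      (Finsupp.single (p + u) α - Finsupp.single p α) := by
  rw [sub_eq_add_neg (Finsupp.single _ _), Finsupp.mapDomain_add, ← Finsupp.single_neg,
    Finsupp.mapDomain_single, Finsupp.mapDomain_single, Finsupp.single_neg, ← sub_eq_add_neg]

theorem mem_support_single_sub_single {u p : E} {α : W}
    (hu : u ≠ 0) (hα : α ≠ 0) :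
    p ∈ (Finsupp.single (p + u) α - Finsupp.single p α).support ∧
      p + u ∈ (Finsupp.single (p + u) α - Finsupp.single p α).support := by
  simp [hu, hα]

/-- Vertices can coincide only when `u = v` or `u = -v`; their coefficients then have equal signs
and give `∓ 2 α`, so nothing cancels. Thus the support condition on a decomposition forces all four
vertices into `U`. -/
theorem mem_support_single_sub_single_pair [Module ℝ W] {u v p : E}
    {α : W} (hu : u ≠ 0) (hv : v ≠ 0) (hα : α ≠ 0) {x : E}
    (hx : x = p ∨ x = p + u ∨ x = p + v ∨ x = p + u + v) :
    x ∈ (Finsupp.single (p + u + v) α - Finsupp.single (p + v) α -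
      (Finsupp.single (p + u) α - Finsupp.single p α)).support := by
  classical
  have h2 : α + α ≠ 0 := by
    rw [← two_smul ℝ]
    simpa using hα
  have h2' : -α + -α ≠ 0 := by
    rw [← neg_add]
    exact neg_ne_zero.2 h2
  rcases hx with rfl | rfl | rfl | rfl <;>
    simp only [Finsupp.mem_support_iff, Finsupp.sub_apply, Finsupp.single_apply, add_assoc,
      add_eq_left, left_eq_add, add_right_inj, right_eq_add, add_eq_right, hu, hv, if_true,
      if_false] <;> split_ifs <;> simp_all [sub_eq_add_neg]

end SingleDifferences

/-! ### Bounded linear maps on Dirac chains -/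

section DiracSums

variable {E : Type*} [NormedAddCommGroup E] [InnerProductSpace ℝ E]

/-- The linear map of Dirac chains with values `Φ p α` at `(p; α)`. -/
def Dirac.lift {H : Type*} [AddCommGroup H] [Module ℝ H] {U : Set E} {k r : ℕ}
    (Φ : E → ⋀[ℝ]^k E →ₗ[ℝ] H) : Dirac U k r →ₗ[ℝ] H :=
  (Finsupp.lsum ℝ fun p : U => Φ p : (U →₀ ⋀[ℝ]^k E) →ₗ[ℝ] H)

theorem Dirac.lift_apply {H : Type*} [AddCommGroup H] [Module ℝ H] {U : Set E} {k r : ℕ}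
    (Φ : E → ⋀[ℝ]^k E →ₗ[ℝ] H) (A : Dirac U k r) : Dirac.lift Φ A = A.sum fun p α => Φ p α := rfl

theorem element_of_mem {U : Set E} {k r : ℕ} {p : E} (hp : p ∈ U) (α : ⋀[ℝ]^k E) :
    (element U p α : Dirac U k r) = (Finsupp.single ⟨p, hp⟩ α : U →₀ ⋀[ℝ]^k E) := dif_pos hp

theorem Dirac.lift_element {H : Type*} [AddCommGroup H] [Module ℝ H] {U : Set E} {k r : ℕ}
    (Φ : E → ⋀[ℝ]^k E →ₗ[ℝ] H) {p : E} (hp : p ∈ U) (α : ⋀[ℝ]^k E) :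
    Dirac.lift Φ (element U p α : Dirac U k r) = Φ p α := by
  rw [element_of_mem hp]
  exact Finsupp.lsum_single ℝ (fun p : U => (Φ p : ⋀[ℝ]^k E →ₗ[ℝ] H)) ⟨p, hp⟩ α

theorem norm_eq_sInf {U : Set E} {k r : ℕ} (A : Dirac U k r) :
    ‖A‖ = sInf {s | ∃ D : List (List E × E × ⋀[ℝ]^k E), IsDecomposition U r D A ∧
      s = decompositionCost D} := rfl

section

variable {H : Type*} [SeminormedAddCommGroup H] [NormedSpace ℝ H] {U : Set E} {k r : ℕ}

theorem lsum_mapDomain_val (Φ : E → ⋀[ℝ]^k E →ₗ[ℝ] H) (A : U →₀ ⋀[ℝ]^k E) :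
    Finsupp.lsum ℝ Φ (Finsupp.mapDomain Subtype.val A) = Finsupp.lsum ℝ (fun p : U => Φ p) A := by
  rw [Finsupp.lsum_apply, Finsupp.sum_mapDomain_index (by simp) (by simp)]
  rfl

/-- The `B^r` norm is an infimum over sums of difference chains, so a linear map needs to be bounded
only on each difference chain supported in `U`. -/
theorem norm_lift_le_of_diffChain {C : ℝ} (hC : 0 ≤ C) {Φ : E → ⋀[ℝ]^k E →ₗ[ℝ] H}
    (h : ∀ (us : List E) (p : E) (α : ⋀[ℝ]^k E), us.length ≤ r →
      ((diffChain us p α).support : Set E) ⊆ U →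
      ‖Finsupp.lsum ℝ Φ (diffChain us p α)‖ ≤ C * ((us.map fun u => ‖u‖).prod * massNorm α))
    (A : Dirac U k r) : ‖Dirac.lift Φ A‖ ≤ C * ‖A‖ := by
  rw [norm_eq_sInf, ← smul_eq_mul, ← Real.sInf_smul_of_nonneg hC]
  obtain ⟨D₀, hD₀⟩ := exists_isDecomposition U r A
  refine le_csInf ⟨_, ⟨_, ⟨D₀, hD₀, rfl⟩, rfl⟩⟩ ?_
  rintro _ ⟨_, ⟨D, hD, rfl⟩, rfl⟩
  have e : Dirac.lift Φ A = Finsupp.lsum ℝ Φ (Finsupp.mapDomain Subtype.val A) :=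
    (lsum_mapDomain_val Φ A).symm
  rw [e, hD.2, map_list_sum, List.map_map]
  have hD' := hD.1
  simp only [smul_eq_mul]
  rw [decompositionCost, ← List.sum_map_mul_left]
  clear e hD
  induction D with
  | nil => simp
  | cons a D ih =>
    simp only [List.map_cons, List.sum_cons]
    obtain ⟨h1, h2⟩ := hD' a List.mem_cons_self
    exact (norm_add_le _ _).trans (add_le_add
      (h a.1 a.2.1 a.2.2 h1 ((subset_convexHull ℝ _).trans h2))
      (ih fun b hb => hD' b (List.mem_cons_of_mem _ hb)))

theorem lsum_translate (Φ : E → ⋀[ℝ]^k E →ₗ[ℝ] H) (u : E) (A : E →₀ ⋀[ℝ]^k E) :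
    Finsupp.lsum ℝ Φ (translate u A) = Finsupp.lsum ℝ (fun x => Φ (x + u)) A := by
  rw [translate, Finsupp.lsum_apply, Finsupp.sum_mapDomain_index (by simp) (by simp)]
  rfl

theorem lsum_diffChain_nil (Φ : E → ⋀[ℝ]^k E →ₗ[ℝ] H) (p : E) (α : ⋀[ℝ]^k E) :
    Finsupp.lsum ℝ Φ (diffChain [] p α) = Φ p α :=
  Finsupp.lsum_single ℝ Φ p α

theorem lsum_diffChain_cons (Φ : E → ⋀[ℝ]^k E →ₗ[ℝ] H) (u : E) (us : List E) (p : E)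
    (α : ⋀[ℝ]^k E) : Finsupp.lsum ℝ Φ (diffChain (u :: us) p α) =
      Finsupp.lsum ℝ (fun x => Φ (x + u)) (diffChain us p α) -
        Finsupp.lsum ℝ Φ (diffChain us p α) := by
  rw [← lsum_translate]
  exact map_sub (Finsupp.lsum ℝ Φ) (translate u (diffChain us p α)) (diffChain us p α)

theorem diffChain_nil (p : E) (α : ⋀[ℝ]^k E) : diffChain [] p α = Finsupp.single p α := rfl

theorem diffChain_singleton (u p : E) (α : ⋀[ℝ]^k E) :
    diffChain [u] p α = Finsupp.single (p + u) α - Finsupp.single p α :=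
  congrArg₂ (fun A B : E →₀ ⋀[ℝ]^k E => A - B) Finsupp.mapDomain_single rfl

theorem diffChain_pair (u v p : E) (α : ⋀[ℝ]^k E) :
    diffChain [v, u] p α = Finsupp.single (p + u + v) α - Finsupp.single (p + v) α -
      (Finsupp.single (p + u) α - Finsupp.single p α) :=
  (congrArg (fun A : E →₀ ⋀[ℝ]^k E => translate v A - A) (diffChain_singleton u p α)).trans
    (single_sub_single_pair u v p α)

theorem mem_support_diffChain_singleton {u p : E} {α : ⋀[ℝ]^k E} (hu : u ≠ 0) (hα : α ≠ 0) :
    p ∈ (diffChain [u] p α).support ∧ p + u ∈ (diffChain [u] p α).support := by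
  rw [diffChain_singleton]
  exact mem_support_single_sub_single hu hα

theorem mem_support_diffChain_pair {u v p : E} {α : ⋀[ℝ]^k E} (hu : u ≠ 0) (hv : v ≠ 0)
    (hα : α ≠ 0) {x : E} (hx : x = p ∨ x = p + u ∨ x = p + v ∨ x = p + u + v) :
    x ∈ (diffChain [v, u] p α).support := by
  rw [diffChain_pair]
  exact mem_support_single_sub_single_pair hu hv hα hx

theorem norm_lsum_diffChain_le_of_first {C : ℝ} (hC : 0 ≤ C) {Φ : E → ⋀[ℝ]^k E →ₗ[ℝ] H}
    (h : ∀ α, HasFirstDifferenceBound U (C * massNorm α) fun p => Φ p α) (us : List E) (p : E)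
    (α : ⋀[ℝ]^k E) (hus : us.length ≤ 1) (hs : ((diffChain us p α).support : Set E) ⊆ U) :
    ‖Finsupp.lsum ℝ Φ (diffChain us p α)‖ ≤ C * ((us.map fun u => ‖u‖).prod * massNorm α) := by
  -- Degenerate chains are treated apart: when `α = 0` or `u = 0` the difference chain vanishes, and
  -- its empty support does not place `p` in `U`.
  rcases eq_or_ne α 0 with rfl | hα
  · have h0 : diffChain us p (0 : ⋀[ℝ]^k E) = 0 := by simpa using diffChain_smul 0 us p 0
    have h3 : 0 ≤ (us.map fun u => ‖u‖).prod := List.prod_nonneg (by simp)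
    have := massNorm_nonneg (0 : ⋀[ℝ]^k E)
    rw [h0, map_zero, norm_zero]
    positivity
  match us, hus with
  | [], _ =>
    rw [lsum_diffChain_nil]
    rw [diffChain_nil] at hs
    simpa using (h α).norm_le p (hs (by simp [hα]))
  | [u], _ =>
    rw [lsum_diffChain_cons, lsum_diffChain_nil, lsum_diffChain_nil]
    rcases eq_or_ne u 0 with rfl | hu
    · simp
    obtain ⟨h0, h1⟩ := mem_support_diffChain_singleton (p := p) hu hα
    refine ((h α).norm_sub_le p (hs h0) u (hs h1)).trans (le_of_eq ?_)
    simp only [List.map_cons, List.map_nil, List.prod_cons, List.prod_nil]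
    ring

theorem norm_lift_le_of_first {C : ℝ} (hC : 0 ≤ C) {Φ : E → ⋀[ℝ]^k E →ₗ[ℝ] H}
    (h : ∀ α, HasFirstDifferenceBound U (C * massNorm α) fun p => Φ p α) (A : Dirac U k 1) :
    ‖Dirac.lift Φ A‖ ≤ C * ‖A‖ :=
  norm_lift_le_of_diffChain hC (norm_lsum_diffChain_le_of_first hC h) A

/-- Difference chains of order `0`, `1`, `2` are sent to values, first differences and second
differences of `p ↦ Φ p α`, which the hypothesis bounds by the corresponding costs. -/
theorem norm_lift_le_of_second {C : ℝ} (hC : 0 ≤ C) {Φ : E → ⋀[ℝ]^k E →ₗ[ℝ] H}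
    (h : ∀ α, HasSecondDifferenceBound U (C * massNorm α) fun p => Φ p α) (A : Dirac U k 2) :
    ‖Dirac.lift Φ A‖ ≤ C * ‖A‖ := by
  refine norm_lift_le_of_diffChain hC (fun us p α hus hs => ?_) A
  rcases Nat.le_succ_iff.1 hus with hus1 | hus2
  · exact norm_lsum_diffChain_le_of_first hC (fun α => (h α).toHasFirstDifferenceBound) us p α
      hus1 hs
  obtain ⟨v, u, rfl⟩ := List.length_eq_two.1 hus2
  simp only [lsum_diffChain_cons, lsum_diffChain_nil, List.map_cons, List.map_nil,
    List.prod_cons, List.prod_nil]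
  rcases eq_or_ne α 0 with rfl | hα
  · have := massNorm_nonneg (0 : ⋀[ℝ]^k E)
    simp only [map_zero, sub_zero, norm_zero]
    positivity
  rcases eq_or_ne u 0 with rfl | hu
  · simp
  rcases eq_or_ne v 0 with rfl | hv
  · simp
  have hmem := fun x hx => hs (mem_support_diffChain_pair (p := p) (x := x) hu hv hα hx)
  have := (h α).norm_second_le p (hmem _ (by simp)) u (hmem _ (by simp)) v (hmem _ (by simp))
    (hmem _ (by simp))
  rw [sub_sub_sub_comm]
  exact this.trans (le_of_eq (by ring))

end

/-! ### The norms of elements and their differences -/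

section Element

variable {U : Set E} {k r : ℕ}

theorem mapDomain_element {p : E} (hp : p ∈ U) (α : ⋀[ℝ]^k E) :
    Finsupp.mapDomain Subtype.val (element U p α : Dirac U k r) = Finsupp.single p α := by
  rw [element_of_mem hp]
  exact Finsupp.mapDomain_single

/-- The linear map `α ↦ (p; α)`. -/
def elementₗ (U : Set E) (k r : ℕ) (p : E) : ⋀[ℝ]^k E →ₗ[ℝ] Dirac U k r :=
  open Classical in
  if h : p ∈ U then (Finsupp.lsingle ⟨p, h⟩ : ⋀[ℝ]^k E →ₗ[ℝ] U →₀ ⋀[ℝ]^k E) else 0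

theorem elementₗ_apply (p : E) (α : ⋀[ℝ]^k E) : elementₗ U k r p α = element U p α := by
  by_cases h : p ∈ U
  · rw [element_of_mem h]
    have : elementₗ U k r p =
      (Finsupp.lsingle ⟨p, h⟩ : ⋀[ℝ]^k E →ₗ[ℝ] U →₀ ⋀[ℝ]^k E) := dif_pos h
    rw [this]
    rfl
  · have h1 : elementₗ U k r p = 0 := dif_neg h
    have h2 : (element U p α : Dirac U k r) = 0 := dif_neg h
    rw [h1, h2, LinearMap.zero_apply]

theorem norm_le_of_mapDomain_eq_diffChain (hU : Convex ℝ U) {A : Dirac U k r} {us : List E} {p : E}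
    {α : ⋀[ℝ]^k E} (hr : us.length ≤ r) (hs : ((diffChain us p α).support : Set E) ⊆ U)
    (hA : Finsupp.mapDomain Subtype.val A = diffChain us p α) :
    ‖A‖ ≤ (us.map fun u => ‖u‖).prod * massNorm α := by
  refine (bNorm_le (D := [(us, p, α)]) ⟨fun a ha => ?_, ?_⟩).trans (le_of_eq ?_)
  · obtain rfl := List.mem_singleton.1 ha
    exact ⟨hr, convexHull_min hs hU⟩
  · simpa using hA
  · simp [decompositionCost]

theorem norm_element_le (hU : Convex ℝ U) {p : E} (hp : p ∈ U) (α : ⋀[ℝ]^k E) :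
    ‖(element U p α : Dirac U k r)‖ ≤ massNorm α := by
  refine (norm_le_of_mapDomain_eq_diffChain hU (us := []) (p := p) (α := α) (Nat.zero_le _) ?_
    (mapDomain_element hp α)).trans (by simp)
  intro x hx
  rw [diffChain_nil] at hx
  rw [Finset.mem_singleton.1 (Finsupp.support_single_subset hx)]
  exact hp

theorem mapDomain_sub' (A B : Dirac U k r) :
    Finsupp.mapDomain Subtype.val (A - B : Dirac U k r) =
      (Finsupp.mapDomain Subtype.val A - Finsupp.mapDomain Subtype.val B : E →₀ ⋀[ℝ]^k E) :=
  map_sub (Finsupp.mapDomain.addMonoidHom (M := ⋀[ℝ]^k E) (Subtype.val : U → E)) A B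

theorem norm_element_sub_le (hU : Convex ℝ U) (hr : 1 ≤ r) {p u : E} (hp : p ∈ U) (hu : p + u ∈ U)
    (α : ⋀[ℝ]^k E) :
    ‖(element U (p + u) α - element U p α : Dirac U k r)‖ ≤ ‖u‖ * massNorm α := by
  refine (norm_le_of_mapDomain_eq_diffChain hU (us := [u]) (p := p) (α := α) hr ?_ ?_).trans
    (by simp)
  · rw [diffChain_singleton]
    exact support_single_sub_single_subset α hu hp
  · rw [mapDomain_sub', mapDomain_element hp, mapDomain_element hu, diffChain_singleton]

theorem norm_element_second_le (hU : Convex ℝ U) (hr : 2 ≤ r) {p u v : E} (hp : p ∈ U)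
    (hu : p + u ∈ U) (hv : p + v ∈ U) (huv : p + u + v ∈ U) (α : ⋀[ℝ]^k E) :
    ‖(element U (p + u + v) α - element U (p + u) α - (element U (p + v) α - element U p α) :
      Dirac U k r)‖ ≤ ‖u‖ * ‖v‖ * massNorm α := by
  refine (norm_le_of_mapDomain_eq_diffChain hU (us := [v, u]) (p := p) (α := α) hr ?_ ?_).trans
    (le_of_eq (by simp [mul_comm]))
  · rw [diffChain_pair]
    exact support_sub_subset (support_single_sub_single_subset α huv hv)
      (support_single_sub_single_subset α hu hp)
  · rw [mapDomain_sub', mapDomain_sub', mapDomain_sub', mapDomain_element hp, mapDomain_element hu,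
      mapDomain_element hv, mapDomain_element huv, diffChain_pair]
    exact sub_sub_sub_comm (Finsupp.single (p + u + v) α : E →₀ ⋀[ℝ]^k E) _ _ _

theorem hasFirstDifferenceBound_element (hU : Convex ℝ U) (hr : 1 ≤ r) (α : ⋀[ℝ]^k E) :
    HasFirstDifferenceBound U (massNorm α) fun p => (element U p α : Dirac U k r) where
  norm_le _ hp := norm_element_le hU hp α
  norm_sub_le _ hp _ hu := (norm_element_sub_le hU hr hp hu α).trans_eq (mul_comm _ _)

theorem hasSecondDifferenceBound_element (hU : Convex ℝ U) (hr : 2 ≤ r) (α : ⋀[ℝ]^k E) :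
    HasSecondDifferenceBound U (massNorm α) fun p => (element U p α : Dirac U k r) where
  toHasFirstDifferenceBound := hasFirstDifferenceBound_element hU (one_le_two.trans hr) α
  norm_second_le _ hp _ hu _ hv huv :=
    (norm_element_second_le hU hr hp hu hv huv α).trans_eq (by ring)

end Element

end DiracSums

/-! ### Continuous extensions, integration and linking maps -/

section Extension

/-- The continuous linear extension to the completion. -/
def extensionCLM {V G : Type*} [SeminormedAddCommGroup V] [NormedSpace ℝ V] [NormedAddCommGroup G]
    [NormedSpace ℝ G] [CompleteSpace G] (f : V →L[ℝ] G) : UniformSpace.Completion V →L[ℝ] G where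
  toFun := UniformSpace.Completion.extension f
  map_add' x y := by
    refine UniformSpace.Completion.induction_on₂ x y (isClosed_eq ?_ ?_) fun a b => ?_
    · exact UniformSpace.Completion.continuous_extension.comp continuous_add
    · exact (UniformSpace.Completion.continuous_extension.comp continuous_fst).add
        (UniformSpace.Completion.continuous_extension.comp continuous_snd)
    · rw [← UniformSpace.Completion.coe_add]
      simp only [UniformSpace.Completion.extension_coe f.uniformContinuous, map_add]
  map_smul' c x := by
    refine UniformSpace.Completion.induction_on x (isClosed_eq ?_ ?_) fun a => ?_
    · exact UniformSpace.Completion.continuous_extension.comp (continuous_const_smul c)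
    · exact UniformSpace.Completion.continuous_extension.const_smul _
    · rw [← UniformSpace.Completion.coe_smul]
      simp only [UniformSpace.Completion.extension_coe f.uniformContinuous, map_smul,
        RingHom.id_apply]
  cont := UniformSpace.Completion.continuous_extension

theorem extensionCLM_apply {V G : Type*} [SeminormedAddCommGroup V] [NormedSpace ℝ V]
    [NormedAddCommGroup G] [NormedSpace ℝ G] [CompleteSpace G] (f : V →L[ℝ] G)
    (x : UniformSpace.Completion V) : extensionCLM f x = UniformSpace.Completion.extension f x :=
  rfl

theorem extensionCLM_coe {V G : Type*} [SeminormedAddCommGroup V] [NormedSpace ℝ V]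
    [NormedAddCommGroup G] [NormedSpace ℝ G] [CompleteSpace G] (f : V →L[ℝ] G) (a : V) :
    extensionCLM f a = f a :=
  UniformSpace.Completion.extension_coe f.uniformContinuous a

end Extension

section Integral

variable {E : Type*} [NormedAddCommGroup E] [InnerProductSpace ℝ E] {U : Set E} {k r : ℕ}

theorem Dirac.hom_ext {H : Type*} [AddCommGroup H] [Module ℝ H] {f g : Dirac U k r →ₗ[ℝ] H}
    (h : ∀ p ∈ U, ∀ α, f (element U p α) = g (element U p α)) : f = g := by
  refine Finsupp.lhom_ext fun p α => ?_
  have := h p p.2 α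
  rw [element_of_mem p.2] at this
  exact this

/-- Evaluation of covectors on a fixed multivector. -/
def covectorEvalₗ (α : ⋀[ℝ]^k E) : (E [⋀^Fin k]→L[ℝ] ℝ) →ₗ[ℝ] ℝ where
  toFun φ := covectorEval φ α
  map_add' φ ψ := by
    rw [covectorEval, ContinuousAlternatingMap.toAlternatingMap_add, map_add]
    rfl
  map_smul' c φ := by
    rw [covectorEval, ContinuousAlternatingMap.toAlternatingMap_smul, map_smul]
    rfl

theorem norm_covectorEvalₗ_le (α : ⋀[ℝ]^k E) (φ : E [⋀^Fin k]→L[ℝ] ℝ) :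
    ‖covectorEvalₗ α φ‖ ≤ massNorm α * ‖φ‖ :=
  (norm_covectorEval_le φ α).trans_eq (mul_comm _ _)

/-- The bound makes the evaluation on Dirac chains uniformly continuous, so that
`UniformSpace.Completion.extension` in `integral` is the true extension and not its default value.
-/
theorem exists_integral_eq_of_bound {η : E → E [⋀^Fin k]→L[ℝ] ℝ} {C : ℝ}
    (h : ∀ A : Dirac U k r, ‖Dirac.lift (fun p => covectorEval (η p)) A‖ ≤ C * ‖A‖) :
    ∃ L : Chain U k r →L[ℝ] ℝ, (∀ J, integral η J = L J) ∧
      ∀ A : Dirac U k r, L A = Dirac.lift (fun p => covectorEval (η p)) A :=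
  ⟨extensionCLM ((Dirac.lift fun p => covectorEval (η p)).mkContinuous C h), fun _ => rfl,
    fun A => extensionCLM_coe _ A⟩

theorem exists_integral_eq_one {η : E → E [⋀^Fin k]→L[ℝ] ℝ} (hη : IsClassB U η 1) :
    ∃ L : Chain U k 1 →L[ℝ] ℝ, (∀ J, integral η J = L J) ∧
      ∀ A : Dirac U k 1, L A = Dirac.lift (fun p => covectorEval (η p)) A := by
  obtain ⟨C, hC, h⟩ := hη.hasFirstDifferenceBound
  refine exists_integral_eq_of_bound (norm_lift_le_of_first hC fun α => ?_)
  rw [mul_comm]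
  exact h.comp_linear (massNorm_nonneg α) (covectorEvalₗ α) (norm_covectorEvalₗ_le α)

theorem exists_integral_eq_two (hUo : IsOpen U) (hUc : Convex ℝ U) {η : E → E [⋀^Fin k]→L[ℝ] ℝ}
    (hη : IsClassB U η 2) :
    ∃ L : Chain U k 2 →L[ℝ] ℝ, (∀ J, integral η J = L J) ∧
      ∀ A : Dirac U k 2, L A = Dirac.lift (fun p => covectorEval (η p)) A := by
  obtain ⟨C, hC, h⟩ := hη.hasSecondDifferenceBound hUo hUc
  refine exists_integral_eq_of_bound (norm_lift_le_of_second hC fun α => ?_)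
  rw [mul_comm]
  exact h.comp_linear (massNorm_nonneg α) (covectorEvalₗ α) (norm_covectorEvalₗ_le α)

/-- The identity on Dirac chains. -/
def Dirac.linkₗ (U : Set E) (k r s : ℕ) : Dirac U k r →ₗ[ℝ] Dirac U k s :=
  (LinearMap.id : (U →₀ ⋀[ℝ]^k E) →ₗ[ℝ] (U →₀ ⋀[ℝ]^k E))

theorem Dirac.norm_linkₗ_le {s : ℕ} (h : r ≤ s) (A : Dirac U k r) :
    ‖Dirac.linkₗ U k r s A‖ ≤ 1 * ‖A‖ := by
  rw [one_mul]
  obtain ⟨D₀, hD₀⟩ := exists_isDecomposition U r A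
  refine le_csInf ⟨_, ⟨D₀, hD₀, rfl⟩⟩ ?_
  rintro _ ⟨D, hD, rfl⟩
  exact bNorm_le (r := s) ⟨fun a ha => ⟨(hD.1 a ha).1.trans h, (hD.1 a ha).2⟩, hD.2⟩

/-- The linking map as a continuous linear map. -/
def linkCLM {s : ℕ} (U : Set E) (k : ℕ) (h : r ≤ s) : Chain U k r →L[ℝ] Chain U k s :=
  extensionCLM (UniformSpace.Completion.toComplL.comp
    ((Dirac.linkₗ U k r s).mkContinuous 1 (Dirac.norm_linkₗ_le h)))

theorem link_eq {s : ℕ} (h : r ≤ s) (J : Chain U k r) : link r s J = linkCLM U k h J := rfl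

theorem linkCLM_coe {s : ℕ} (h : r ≤ s) (A : Dirac U k r) :
    linkCLM U k h A = (Dirac.linkₗ U k r s A : Chain U k s) := extensionCLM_coe _ A

theorem integral_link (hUo : IsOpen U) (hUc : Convex ℝ U) {η : E → E [⋀^Fin k]→L[ℝ] ℝ}
    (hη : IsClassB U η 1) (hη2 : IsClassB U η 2) (J : Chain U k 1) :
    integral η (link 1 2 J) = integral η J := by
  obtain ⟨L, hL, hLA⟩ := exists_integral_eq_one hη
  obtain ⟨L', hL', hLA'⟩ := exists_integral_eq_two hUo hUc hη2
  rw [hL, hL', link_eq one_le_two]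
  refine UniformSpace.Completion.induction_on J (isClosed_eq ?_ ?_) fun A => ?_
  · fun_prop
  · fun_prop
  · rw [linkCLM_coe, hLA, hLA']
    rfl

end Integral

/-! ### The chain of the unit interval -/

section UnitInterval

theorem HasFirstDifferenceBound.lipschitzOnWith {E G : Type*} [NormedAddCommGroup E]
    [SeminormedAddCommGroup G] {U : Set E} {C : ℝ} {g : E → G}
    (hg : HasFirstDifferenceBound U C g) : LipschitzOnWith (Real.toNNReal C) g U := by
  refine LipschitzOnWith.of_dist_le_mul fun x hx y hy => ?_
  have := hg.norm_sub_le y hy (x - y) (by rwa [add_sub_cancel])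
  rw [add_sub_cancel] at this
  rw [dist_eq_norm, dist_eq_norm]
  exact this.trans (by gcongr; exact Real.le_coe_toNNReal C)

theorem HasFirstDifferenceBound.isClassB {E G : Type*} [NormedAddCommGroup E]
    [InnerProductSpace ℝ E] [NormedAddCommGroup G] [NormedSpace ℝ G] {U : Set E} {C : ℝ}
    {g : E → G} (hg : HasFirstDifferenceBound U C g) : IsClassB U g 1 := by
  refine ⟨?_, fun j hj => ⟨C, fun x hx => ?_⟩, Real.toNNReal C, ?_⟩
  · simpa using hg.lipschitzOnWith.continuousOn
  · obtain rfl : j = 0 := Nat.le_zero.1 hj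
    simpa using hg.norm_le x hx
  · rw [iteratedFDeriv_zero_eq_comp]
    exact (LinearIsometryEquiv.lipschitz _).comp_lipschitzOnWith hg.lipschitzOnWith |>.weaken
      (by simp)

/-- The `1`-element at `t` with the unit vector of `ℝ`, as a chain. -/
def unitElement (t : ℝ) : Chain (Ioo (0 : ℝ) 1) 1 1 :=
  ((element (Ioo (0 : ℝ) 1) t (oneVector 1) : Dirac (Ioo (0 : ℝ) 1) 1 1) :
    Chain (Ioo (0 : ℝ) 1) 1 1)

/-- Being bounded and Lipschitz in the `B^1` norm, `t ↦ (t; 1)` is Bochner integrable over `(0, 1)`.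
-/
theorem hasFirstDifferenceBound_unitElement :
    HasFirstDifferenceBound (Ioo (0 : ℝ) 1) (massNorm (oneVector (1 : ℝ))) unitElement := by
  have h := hasFirstDifferenceBound_element (convex_Ioo (0 : ℝ) 1) le_rfl (oneVector (1 : ℝ))
  refine ⟨fun x hx => ?_, fun x hx u hu => ?_⟩
  · rw [unitElement, UniformSpace.Completion.norm_coe]
    exact h.norm_le x hx
  · rw [unitElement, unitElement, ← UniformSpace.Completion.coe_sub,
      UniformSpace.Completion.norm_coe]
    exact h.norm_sub_le x hx u hu

theorem HasFirstDifferenceBound.integrableOn {G : Type*} [NormedAddCommGroup G] {C : ℝ}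
    {g : ℝ → G} (hg : HasFirstDifferenceBound (Ioo (0 : ℝ) 1) C g) :
    IntegrableOn g (Ioo (0 : ℝ) 1) := by
  refine Integrable.of_bound
    (hg.lipschitzOnWith.continuousOn.aestronglyMeasurable measurableSet_Ioo) C ?_
  exact (ae_restrict_mem measurableSet_Ioo).mono fun x hx => hg.norm_le x hx

/-- The coordinate `1`-covector on the line. -/
def lineCovector : ℝ [⋀^Fin 1]→L[ℝ] ℝ :=
  ContinuousAlternatingMap.ofSubsingleton ℝ ℝ ℝ (0 : Fin 1) (ContinuousLinearMap.id ℝ ℝ)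

theorem exists_eq_smul_oneVector (α : ⋀[ℝ]^1 ℝ) : ∃ c : ℝ, α = c • oneVector (1 : ℝ) := by
  obtain ⟨L, rfl⟩ := exists_isSimpleSum α
  induction L with
  | nil => exact ⟨0, by simp⟩
  | cons a L ih =>
    obtain ⟨c, hc⟩ := ih
    refine ⟨a.1 * a.2 0 + c, ?_⟩
    have h : a.2 = fun i => a.2 0 • (fun _ : Fin 1 => (1 : ℝ)) i := by
      funext i
      rw [Subsingleton.elim i 0, smul_eq_mul, mul_one]
    have h' : exteriorPower.ιMulti ℝ 1 a.2 = a.2 0 • oneVector (1 : ℝ) := by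
      rw [oneVector]
      conv_lhs => rw [h, AlternatingMap.map_smul_univ]
      simp
    rw [List.map_cons, List.sum_cons, hc, h', add_smul, mul_smul]

/-- The form has coefficient `f (t; 1)`, which is Lipschitz because the unit elements are. Hence
integrals of `B^1` forms separate the `1`-chains of the interval. -/
theorem exists_form_eq (f : Chain (Ioo (0 : ℝ) 1) 1 1 →L[ℝ] ℝ) :
    ∃ η : ℝ → ℝ [⋀^Fin 1]→L[ℝ] ℝ, IsClassB (Ioo (0 : ℝ) 1) η 1 ∧ ∀ J, integral η J = f J := by
  set η : ℝ → ℝ [⋀^Fin 1]→L[ℝ] ℝ := fun t => f (unitElement t) • lineCovector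
  have hη : IsClassB (Ioo (0 : ℝ) 1) η 1 := by
    have h1 := hasFirstDifferenceBound_unitElement.comp_linear (norm_nonneg f) f.toLinearMap
      fun x => f.le_opNorm x
    exact (h1.comp_linear (norm_nonneg lineCovector)
      (LinearMap.toSpanSingleton ℝ _ lineCovector)
      fun x => by rw [LinearMap.toSpanSingleton_apply, norm_smul, mul_comm]).isClassB
  obtain ⟨L, hL, hLA⟩ := exists_integral_eq_one hη
  refine ⟨η, hη, fun J => ?_⟩
  rw [hL]
  refine UniformSpace.Completion.induction_on J (isClosed_eq ?_ ?_) fun A => ?_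
  · fun_prop
  · fun_prop
  · rw [hLA]
    have key : (Dirac.lift fun t => covectorEval (η t) :
        Dirac (Ioo (0 : ℝ) 1) 1 1 →ₗ[ℝ] ℝ) =
        f.toLinearMap ∘ₗ UniformSpace.Completion.toComplL.toLinearMap := by
      refine Dirac.hom_ext fun t ht α => ?_
      obtain ⟨c, rfl⟩ := exists_eq_smul_oneVector α
      rw [Dirac.lift_element _ ht, ← elementₗ_apply, map_smul, map_smul, map_smul, elementₗ_apply]
      change c • covectorEval (η t) (oneVector 1) = c • f (unitElement t)
      rw [covectorEval, oneVector, exteriorPower.alternatingMapLinearEquiv_apply_ιMulti]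
      simp [η, lineCovector]
    exact congrArg (fun T => T A) key

theorem integral_unitElement_spec :
    ∀ η : ℝ → ℝ [⋀^Fin 1]→L[ℝ] ℝ, IsClassB (Ioo (0 : ℝ) 1) η 1 →
      integral η (∫ t in Ioo (0 : ℝ) 1, unitElement t) = ∫ t in Ioo (0 : ℝ) 1, η t fun _ => 1 := by
  intro η hη
  obtain ⟨L, hL, hLA⟩ := exists_integral_eq_one hη
  rw [hL, ← L.integral_comp_comm hasFirstDifferenceBound_unitElement.integrableOn]
  refine setIntegral_congr_fun measurableSet_Ioo fun t ht => ?_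
  rw [unitElement, hLA, Dirac.lift_element _ ht, covectorEval, oneVector,
    exteriorPower.alternatingMapLinearEquiv_apply_ιMulti]
  rfl

/-- The Bochner integral shows that the `Classical.epsilon` choice has its defining property, and
the duality `exists_form_eq` shows that this property determines the chain. -/
theorem unitIntervalChain_eq : unitIntervalChain = ∫ t in Ioo (0 : ℝ) 1, unitElement t := by
  have h : ∀ η : ℝ → ℝ [⋀^Fin 1]→L[ℝ] ℝ, IsClassB (Ioo (0 : ℝ) 1) η 1 →
      integral η unitIntervalChain = ∫ t in Ioo (0 : ℝ) 1, η t fun _ => 1 :=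
    Classical.epsilon_spec (p := fun J : Chain (Ioo (0 : ℝ) 1) 1 1 =>
      ∀ η : ℝ → ℝ [⋀^Fin 1]→L[ℝ] ℝ, IsClassB (Ioo (0 : ℝ) 1) η 1 →
        integral η J = ∫ t in Ioo (0 : ℝ) 1, η t fun _ => 1) ⟨_, integral_unitElement_spec⟩
  refine (SeparatingDual.eq_iff_forall_dual_eq (R := ℝ)).2 fun f => ?_
  obtain ⟨η, hη, hf⟩ := exists_form_eq f
  rw [← hf, ← hf, h η hη, integral_unitElement_spec η hη]

end UnitInterval

/-! ### Products with the unit interval -/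

section ToLp

variable {E : Type*} [NormedAddCommGroup E]

theorem toLp_add_left (t u : ℝ) (p : E) : WithLp.toLp 2 (t + u, p) =
    (WithLp.toLp 2 (t, p) + WithLp.toLp 2 (u, 0) : WithLp 2 (ℝ × E)) := by
  rw [← WithLp.toLp_add, Prod.mk_add_mk, add_zero]

theorem toLp_add_right (t : ℝ) (p v : E) : WithLp.toLp 2 (t, p + v) =
    (WithLp.toLp 2 (t, p) + WithLp.toLp 2 (0, v) : WithLp 2 (ℝ × E)) := by
  rw [← WithLp.toLp_add, Prod.mk_add_mk, add_zero]

end ToLp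

section IntervalCross

variable {E : Type*} [NormedAddCommGroup E] [InnerProductSpace ℝ E] {U : Set E} {k : ℕ}

theorem convex_prodSet {V : Set ℝ} (hV : Convex ℝ V) (hU : Convex ℝ U) :
    Convex ℝ (prodSet V U) := by
  rintro x ⟨hx1, hx2⟩ y ⟨hy1, hy2⟩ a b ha hb hab
  exact ⟨hV hx1 hy1 ha hb hab, hU hx2 hy2 ha hb hab⟩

/-- The exterior product of a multivector of `ℝ` and a multivector of `E`. -/
def crossₗ {j k m : ℕ} (h : j + k = m) :
    ⋀[ℝ]^j ℝ →ₗ[ℝ] ⋀[ℝ]^k E →ₗ[ℝ] ⋀[ℝ]^m (WithLp 2 (ℝ × E)) :=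
  LinearMap.mk₂ ℝ
    (fun β α => wedge h (exteriorPower.map j inclLeft β) (exteriorPower.map k inclRight α))
    (fun β β' α => by
      apply Subtype.ext
      simp [wedge, add_mul])
    (fun c β α => by
      apply Subtype.ext
      simp [wedge])
    (fun β α α' => by
      apply Subtype.ext
      simp [wedge, mul_add])
    (fun c β α => by
      apply Subtype.ext
      simp [wedge])

/-- The product of elements, as a bilinear map. -/
def crossElementₗ {j k m : ℕ} (s : ℕ) (h : j + k = m) (V : Set ℝ) (U : Set E) (t : ℝ) (p : E) :
    ⋀[ℝ]^j ℝ →ₗ[ℝ] ⋀[ℝ]^k E →ₗ[ℝ] Dirac (prodSet V U) m s :=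
  (crossₗ h).compr₂ (elementₗ (prodSet V U) m s (WithLp.toLp 2 (t, p)))

theorem crossElementₗ_apply {j k m : ℕ} (s : ℕ) (h : j + k = m) (V : Set ℝ) (t : ℝ) (p : E)
    (β : ⋀[ℝ]^j ℝ) (α : ⋀[ℝ]^k E) : crossElementₗ s h V U t p β α =
      element (prodSet V U) (WithLp.toLp 2 (t, p)) (crossₗ h β α) := elementₗ_apply _ _

/-- The product of an element at `t` with a Dirac chain, as a linear map. -/
def crossAt {j k m r' : ℕ} (s : ℕ) (h : j + k = m) (V : Set ℝ) (A : Dirac U k r') (t : ℝ) :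
    ⋀[ℝ]^j ℝ →ₗ[ℝ] Dirac (prodSet V U) m s :=
  Dirac.lift (fun p => (crossElementₗ s h V U t p).flip) A

theorem crossAt_apply {j k m r' : ℕ} (s : ℕ) (h : j + k = m) (V : Set ℝ) (A : Dirac U k r') (t : ℝ)
    (β : ⋀[ℝ]^j ℝ) : crossAt s h V A t β =
      Dirac.lift (fun p => crossElementₗ s h V U t p β) A := by
  have h : LinearMap.applyₗ β ∘ₗ Dirac.lift (U := U) (r := r')
      (fun p => (crossElementₗ s h V U t p).flip) =
      Dirac.lift fun p => crossElementₗ s h V U t p β := by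
    refine Dirac.hom_ext fun p hp α => ?_
    rw [LinearMap.comp_apply, Dirac.lift_element _ hp, Dirac.lift_element _ hp]
    rfl
  exact LinearMap.congr_fun h A

theorem crossDirac_eq {j k m r r' : ℕ} (s : ℕ) (h : j + k = m) {V : Set ℝ} (Q : Dirac V j r)
    (A : Dirac U k r') : crossDirac s h Q A = Dirac.lift (fun t => crossAt s h V A t) Q := by
  rw [Dirac.lift_apply]
  simp only [crossAt_apply, Dirac.lift_apply, crossElementₗ_apply]
  rfl

theorem HasFirstDifferenceBound.sum {E G ι : Type*} [NormedAddCommGroup E]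
    [SeminormedAddCommGroup G] {U : Set E} {C : ι → ℝ} {g : ι → E → G} (s : Finset ι)
    (h : ∀ i ∈ s, HasFirstDifferenceBound U (C i) (g i)) :
    HasFirstDifferenceBound U (∑ i ∈ s, C i) fun x => ∑ i ∈ s, g i x where
  norm_le x hx := norm_sum_le_of_le s fun i hi => (h i hi).norm_le x hx
  norm_sub_le x hx u hu := by
    rw [← Finset.sum_sub_distrib, Finset.sum_mul]
    exact norm_sum_le_of_le s fun i hi => (h i hi).norm_sub_le x hx u hu

variable [FiniteDimensional ℝ E]

theorem exists_massNorm_crossₗ_le {j k m : ℕ} (h : j + k = m) : ∃ C, 0 ≤ C ∧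
    ∀ (β : ⋀[ℝ]^j ℝ) (α : ⋀[ℝ]^k E), massNorm (crossₗ h β α) ≤ C * massNorm β * massNorm α := by
  let T : ⋀[ℝ]^j ℝ →ₗ[ℝ] (⋀[ℝ]^k E →L[ℝ] ⋀[ℝ]^m (WithLp 2 (ℝ × E))) :=
    { toFun := fun β => LinearMap.toContinuousLinearMap (crossₗ h β)
      map_add' := fun β β' => by
        ext1 α
        exact LinearMap.congr_fun (map_add (crossₗ h) β β') α
      map_smul' := fun c β => by
        ext1 α
        exact LinearMap.congr_fun (map_smul (crossₗ h) c β) α }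
  obtain ⟨C, hC, hCb⟩ := exists_norm_le_massNorm
    (G := ⋀[ℝ]^k E →L[ℝ] ⋀[ℝ]^m (WithLp 2 (ℝ × E))) T
  refine ⟨C, hC, fun β α => ?_⟩
  refine ((T β).le_opNorm α).trans ?_
  exact mul_le_mul_of_nonneg_right (hCb β) (massNorm_nonneg α)

/-- With `A` fixed the product is a finite sum over its support, so a constant depending on `A`
suffices. It only serves to make the extension in `Q` legitimate. -/
theorem exists_norm_crossDirac_le {V : Set ℝ} (hV : Convex ℝ V) (hU : Convex ℝ U) {j m : ℕ}
    (h : j + k = m) (A : Dirac U k 2) :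
    ∃ C, ∀ Q : Dirac V j 1, ‖Dirac.lift (fun t => crossAt 2 h V A t) Q‖ ≤ C * ‖Q‖ := by
  obtain ⟨C, hC, hCb⟩ := exists_massNorm_crossₗ_le (E := E) (k := k) h
  let B : U →₀ ⋀[ℝ]^k E := A
  have hK : 0 ≤ ∑ p ∈ B.support, C * massNorm (B p) :=
    Finset.sum_nonneg fun p _ => mul_nonneg hC (massNorm_nonneg _)
  refine ⟨_, norm_lift_le_of_first hK fun β => ?_⟩
  have e : (fun t => crossAt 2 h V A t β) = fun t => ∑ p ∈ B.support,
      (element (prodSet V U) (WithLp.toLp 2 (t, (p : E))) (crossₗ h β (B p)) :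
        Dirac (prodSet V U) m 2) := by
    funext t
    rw [crossAt_apply, Dirac.lift_apply]
    simp only [crossElementₗ_apply]
    rfl
  rw [e, Finset.sum_mul]
  refine HasFirstDifferenceBound.sum _ fun p _ => ?_
  have hb := hasFirstDifferenceBound_element (convex_prodSet hV hU) one_le_two
    (crossₗ h β (B p))
  refine HasFirstDifferenceBound.mono ?_ ((hCb β (B p)).trans_eq (mul_right_comm _ _ _))
  refine ⟨fun t ht => hb.norm_le _ ⟨ht, p.2⟩, fun t ht u hu => ?_⟩
  have := hb.norm_sub_le (WithLp.toLp 2 (t, (p : E))) ⟨ht, p.2⟩ (WithLp.toLp 2 (u, 0))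
    (by rw [← toLp_add_left]; exact ⟨hu, p.2⟩)
  rwa [← toLp_add_left, WithLp.norm_toLp_fst] at this

/-- The inclusion of the slice `{t} × U` is isometric, so the constant depends neither on `t` nor on
`A`. -/
theorem exists_norm_crossElement_le {V : Set ℝ} (hV : Convex ℝ V) (hU : Convex ℝ U) {j m : ℕ}
    (h : j + k = m) (β : ⋀[ℝ]^j ℝ) : ∃ C, 0 ≤ C ∧ ∀ t ∈ V, ∀ A : Dirac U k 2,
      ‖Dirac.lift (fun p => crossElementₗ 2 h V U t p β) A‖ ≤ C * ‖A‖ := by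
  obtain ⟨C, hC, hCb⟩ := exists_massNorm_crossₗ_le (E := E) (k := k) h
  have hC' := mul_nonneg hC (massNorm_nonneg β)
  refine ⟨C * massNorm β, hC', fun t ht => norm_lift_le_of_second hC' fun α => ?_⟩
  simp only [crossElementₗ_apply]
  have hb := hasSecondDifferenceBound_element (convex_prodSet hV hU) le_rfl (crossₗ h β α)
  refine HasSecondDifferenceBound.mono ?_ (hCb β α)
  refine ⟨⟨fun p hp => hb.norm_le _ ⟨ht, hp⟩, fun p hp u hu => ?_⟩,
    fun p hp u hu v hv huv => ?_⟩
  · have := hb.norm_sub_le (WithLp.toLp 2 (t, p)) ⟨ht, hp⟩ (WithLp.toLp 2 (0, u))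
      (by rw [← toLp_add_right]; exact ⟨ht, hu⟩)
    rwa [← toLp_add_right, WithLp.norm_toLp_snd] at this
  · have := hb.norm_second_le (WithLp.toLp 2 (t, p)) ⟨ht, hp⟩ (WithLp.toLp 2 (0, u))
      (by rw [← toLp_add_right]; exact ⟨ht, hu⟩) (WithLp.toLp 2 (0, v))
      (by rw [← toLp_add_right]; exact ⟨ht, hv⟩)
      (by rw [← toLp_add_right, ← toLp_add_right]; exact ⟨ht, huv⟩)
    rwa [← toLp_add_right, ← toLp_add_right, ← toLp_add_right, WithLp.norm_toLp_snd,
      WithLp.norm_toLp_snd] at this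

/-- The product of the interval with `A` is the integral over `t ∈ (0, 1)` of the products of `(t;
1)` with `A`. The slices are bounded by `K * ‖A‖` uniformly in `t`, hence so is the integral. -/
theorem continuous_intervalCross (hU : Convex ℝ U) :
    Continuous (intervalCross : Chain U k 2 → Chain (prodSet (Ioo 0 1) U) (k + 1) 2) := by
  have hV : Convex ℝ (Ioo (0 : ℝ) 1) := convex_Ioo 0 1
  choose C hC using exists_norm_crossDirac_le (U := U) (k := k) hV hU (Nat.add_comm 1 k)
  let L : Dirac U k 2 → Chain (Ioo (0 : ℝ) 1) 1 1 →L[ℝ] Chain (prodSet (Ioo 0 1) U) (k + 1) 2 :=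
    fun A => extensionCLM (UniformSpace.Completion.toComplL.comp
      (LinearMap.mkContinuous (Dirac.lift fun t => crossAt 2 (Nat.add_comm 1 k) (Ioo 0 1) A t)
        (C A) (hC A)))
  let g : ℝ → Dirac U k 2 →ₗ[ℝ] Chain (prodSet (Ioo 0 1) U) (k + 1) 2 := fun t =>
    UniformSpace.Completion.toComplL.toLinearMap ∘ₗ
      Dirac.lift fun p => crossElementₗ 2 (Nat.add_comm 1 k) (Ioo 0 1) U t p (oneVector 1)
  have hLg : ∀ A, ∀ t ∈ Ioo (0 : ℝ) 1, L A (unitElement t) = g t A := fun A t ht => by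
    change extensionCLM _ _ = _
    rw [unitElement, extensionCLM_coe]
    refine congrArg (fun B : Dirac (prodSet (Ioo 0 1) U) (k + 1) 2 =>
      (B : Chain (prodSet (Ioo 0 1) U) (k + 1) 2)) ?_
    exact (Dirac.lift_element _ ht _).trans (crossAt_apply _ _ _ _ _ _)
  have hint : ∀ A, IntegrableOn (fun t => g t A) (Ioo (0 : ℝ) 1) := fun A =>
    ((L A).integrable_comp hasFirstDifferenceBound_unitElement.integrableOn).congr
      ((ae_restrict_mem measurableSet_Ioo).mono fun t ht => hLg A t ht)
  have hL : ∀ A, L A unitIntervalChain = ∫ t in Ioo (0 : ℝ) 1, g t A := fun A => by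
    rw [unitIntervalChain_eq,
      ← (L A).integral_comp_comm hasFirstDifferenceBound_unitElement.integrableOn]
    exact setIntegral_congr_fun measurableSet_Ioo fun t ht => hLg A t ht
  obtain ⟨K, hK0, hK⟩ := exists_norm_crossElement_le (U := U) (k := k) hV hU (Nat.add_comm 1 k)
    (oneVector (1 : ℝ))
  let T : Dirac U k 2 →ₗ[ℝ] Chain (prodSet (Ioo 0 1) U) (k + 1) 2 :=
    { toFun := fun A => ∫ t in Ioo (0 : ℝ) 1, g t A
      map_add' := fun A B => by
        rw [← integral_add (hint A) (hint B)]
        simp only [map_add]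
      map_smul' := fun c A => by
        rw [RingHom.id_apply, ← integral_smul]
        simp only [map_smul] }
  have hT : ∀ A, ‖T A‖ ≤ K * ‖A‖ := fun A => by
    have := norm_setIntegral_le_of_norm_le_const (μ := volume) (s := Ioo (0 : ℝ) 1)
      (f := fun t => g t A) (C := K * ‖A‖) (by simp) fun t ht =>
        (UniformSpace.Completion.norm_coe _).trans_le (hK t ht A)
    change ‖∫ t in Ioo (0 : ℝ) 1, g t A‖ ≤ _
    simpa using this
  have e : (intervalCross : Chain U k 2 → Chain (prodSet (Ioo 0 1) U) (k + 1) 2) =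
      extensionCLM (T.mkContinuous K hT) := by
    funext J
    rw [extensionCLM_apply, intervalCross]
    congr 1
    funext A
    change _ = ∫ t in Ioo (0 : ℝ) 1, g t A
    rw [← hL A]
    simp only [crossDirac_eq]
    rfl
  rw [e]
  exact ContinuousLinearMap.continuous _

end IntervalCross

/-! ### Pushforward -/

section SecondDifferences

theorem norm_grid_difference_le {H : Type*} [SeminormedAddCommGroup H] (G : ℕ → ℕ → H) {c : ℝ}
    {N : ℕ} (h : ∀ i < N, ∀ j < N,
      ‖G (i + 1) (j + 1) - G (i + 1) j - (G i (j + 1) - G i j)‖ ≤ c) :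
    ‖G N N - G N 0 - (G 0 N - G 0 0)‖ ≤ N * (N * c) := by
  have h1 : ∀ i, G i N - G i 0 = ∑ j ∈ Finset.range N, (G i (j + 1) - G i j) := fun i =>
    (Finset.sum_range_sub (G i) N).symm
  rw [← Finset.sum_range_sub (fun i => G i N - G i 0) N]
  refine (norm_sum_le_of_le _ (f := fun i => G (i + 1) N - G (i + 1) 0 - (G i N - G i 0))
    (n := fun _ => N * c) fun i hi => ?_).trans (by simp)
  simp only [h1]
  rw [← Finset.sum_sub_distrib]
  exact (norm_sum_le_of_le _ fun j hj => h i (Finset.mem_range.1 hi) j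
    (Finset.mem_range.1 hj)).trans (by simp)

/-- The values `a, b, c, e` of `g` at the four vertices do not form a parallelogram, so `e` is
compared with `b + c - a`. The parallelogram part is controlled by the Lipschitz constant of the
derivative of `P`, the rest by that of `P` and the second difference of `g`. The radius `3 * C + 1`
makes room for `b + c - a`. -/
theorem HasSecondDifferenceBound.comp_contDiff {E X Z : Type*} [NormedAddCommGroup E]
    [NormedAddCommGroup X] [NormedSpace ℝ X] [FiniteDimensional ℝ X] [NormedAddCommGroup Z]
    [NormedSpace ℝ Z] {P : X → Z} (hP : ContDiff ℝ 2 P) {U : Set E} {C : ℝ} (hC : 0 ≤ C)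
    {g : E → X} (hg : HasSecondDifferenceBound U C g) :
    ∃ C', 0 ≤ C' ∧ HasSecondDifferenceBound U C' fun x => P (g x) := by
  have hs := isCompact_closedBall (0 : X) (3 * C + 1)
  have hsc := convex_closedBall (0 : X) (3 * C + 1)
  obtain ⟨B, hB⟩ := hs.exists_bound_of_continuousOn hP.continuous.continuousOn
  obtain ⟨K, hK⟩ := (hP.contDiffOn (s := Metric.closedBall 0 (3 * C + 1))).exists_lipschitzOnWith
    (by simp) hsc hs
  obtain ⟨K', hK'⟩ := ((hP.fderiv_right (m := 1) (by norm_num)).contDiffOn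
    (s := Metric.closedBall 0 (3 * C + 1))).exists_lipschitzOnWith (by simp) hsc hs
  have hB0 : 0 ≤ B := (norm_nonneg _).trans (hB 0 (Metric.mem_closedBall_self (by linarith)))
  have hK0 : 0 ≤ (K : ℝ) := K.2
  have hK0' : 0 ≤ (K' : ℝ) := K'.2
  have hKn : ∀ y z : X, ‖y‖ < 3 * C + 1 → ‖z‖ < 3 * C + 1 → ‖P y - P z‖ ≤ K * ‖y - z‖ := by
    intro y z hy hz
    rw [← dist_eq_norm, ← dist_eq_norm]
    exact hK.dist_le_mul _ (by simpa using hy.le) _ (by simpa using hz.le)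
  have hb : ∀ x ∈ U, ‖g x‖ < 3 * C + 1 := fun x hx => (hg.norm_le x hx).trans_lt (by linarith)
  have h1 := mul_nonneg hK0 hC
  have h2 := mul_nonneg (mul_nonneg hK0' hC) hC
  refine ⟨B + K * C + K' * C * C, by positivity,
    ⟨⟨fun x hx => (hB (g x) (by simpa using (hb x hx).le)).trans (by linarith),
      fun x hx u hu => ?_⟩, fun x hx u hu v hv huv => ?_⟩⟩
  · refine (hKn _ _ (hb _ hu) (hb _ hx)).trans ?_
    refine (mul_le_mul_of_nonneg_left (hg.norm_sub_le x hx u hu) hK0).trans ?_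
    rw [← mul_assoc]
    exact mul_le_mul_of_nonneg_right (by linarith) (norm_nonneg u)
  · have hbu := hg.norm_sub_le x hx u hu
    have hbv := hg.norm_sub_le x hx v hv
    have hbuv := hg.norm_second_le x hx u hu v hv huv
    have n0 := hg.norm_le x hx
    have n1 := hg.norm_le _ hu
    have n2 := hg.norm_le _ hv
    have n3 := hb _ huv
    generalize g x = a at *
    generalize g (x + u) = b at *
    generalize g (x + v) = c at *
    generalize g (x + u + v) = e at *
    have ha : a + (b - a) + (c - a) = b + c - a := by abel
    have n4 : ‖b + c - a‖ < 3 * C + 1 := by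
      have := norm_sub_le (b + c) a
      have := norm_add_le b c
      linarith
    have key := norm_second_difference_le (Metric.isOpen_ball (x := (0 : X)) (ε := 3 * C + 1))
      (convex_ball 0 _) (hP.differentiable (by simp)).differentiableOn (K := K')
      (fun y hy z hz => by
        rw [← dist_eq_norm, ← dist_eq_norm]
        exact hK'.dist_le_mul _ (Metric.ball_subset_closedBall hy) _
          (Metric.ball_subset_closedBall hz)) (x := a) (u := b - a) (v := c - a)
      (by rw [mem_ball_zero_iff]; linarith)
      (by rw [mem_ball_zero_iff, add_sub_cancel]; linarith)
      (by rw [mem_ball_zero_iff, add_sub_cancel]; linarith)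
      (by rwa [mem_ball_zero_iff, ha])
    rw [ha, add_sub_cancel, add_sub_cancel] at key
    have e1 : P e - P b - (P c - P a) = (P (b + c - a) - P b - (P c - P a)) +
        (P e - P (b + c - a)) := by abel
    have e2 : e - (b + c - a) = e - b - (c - a) := by abel
    have l1 := hKn e (b + c - a) n3 n4
    rw [e2] at l1
    have l2 := mul_le_mul_of_nonneg_left hbuv hK0
    have l3 : (K' : ℝ) * ‖b - a‖ * ‖c - a‖ ≤ K' * (C * ‖u‖) * (C * ‖v‖) := by gcongr
    have l4 : 0 ≤ B * (‖u‖ * ‖v‖) := by positivity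
    rw [e1]
    refine (norm_add_le _ _).trans ?_
    nlinarith

end SecondDifferences

/-! ### Smoothness of the induced map on multivectors -/

section ExteriorPower

variable {E E' : Type*} [NormedAddCommGroup E] [InnerProductSpace ℝ E] [FiniteDimensional ℝ E]
  [NormedAddCommGroup E'] [InnerProductSpace ℝ E'] [FiniteDimensional ℝ E']

theorem contDiff_ιMulti {Z : Type*} [NormedAddCommGroup Z] [NormedSpace ℝ Z] {k : ℕ} {n : ℕ∞ω}
    {w : Z → Fin k → E} (hw : ∀ i, ContDiff ℝ n fun z => w z i) :
    ContDiff ℝ n fun z => (exteriorPower.ιMulti ℝ k (w z) : ⋀[ℝ]^k E) := by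
  let b := stdOrthonormalBasis ℝ E
  have h : ∀ z, (exteriorPower.ιMulti ℝ k (w z) : ⋀[ℝ]^k E) =
      ∑ r : Fin k → Fin (Module.finrank ℝ E), (∏ i, inner ℝ (b (r i)) (w z i)) •
        exteriorPower.ιMulti ℝ k fun i => b (r i) := by
    intro z
    have h1 : w z = fun i => ∑ j, inner ℝ (b j) (w z i) • b j := by
      funext i
      exact (b.sum_repr' (w z i)).symm
    conv_lhs => rw [h1]
    rw [← AlternatingMap.coe_multilinearMap, MultilinearMap.map_sum]
    exact Finset.sum_congr rfl fun r _ => MultilinearMap.map_smul_univ _ _ _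
  simp only [h]
  exact ContDiff.sum fun r _ => ContDiff.smul
    (contDiff_prod fun i _ => contDiff_const.inner ℝ (hw i)) contDiff_const

/-- The map induced on multivectors. -/
def exteriorMap (k : ℕ) (T : E →L[ℝ] E') : ⋀[ℝ]^k E →L[ℝ] ⋀[ℝ]^k E' :=
  LinearMap.toContinuousLinearMap (exteriorPower.map k T.toLinearMap)

theorem contDiff_exteriorMap (k : ℕ) {n : ℕ∞ω} :
    ContDiff ℝ n (exteriorMap k : (E →L[ℝ] E') → ⋀[ℝ]^k E →L[ℝ] ⋀[ℝ]^k E') := by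
  rw [contDiff_clm_apply_iff]
  intro α
  obtain ⟨L, rfl⟩ := exists_isSimpleSum α
  induction L with
  | nil => simpa using contDiff_const
  | cons a L ih =>
    have h : ∀ T : E →L[ℝ] E', exteriorMap k T (exteriorPower.ιMulti ℝ k a.2) =
        exteriorPower.ιMulti ℝ k fun i => T (a.2 i) := fun T =>
      exteriorPower.map_apply_ιMulti _ _
    simp only [List.map_cons, List.sum_cons, map_add, map_smul, h]
    refine ContDiff.add (ContDiff.const_smul _ (contDiff_ιMulti fun i => ?_)) ih
    fun_prop

end ExteriorPower

section Pushforward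

variable {E E' : Type*} [NormedAddCommGroup E] [InnerProductSpace ℝ E]
  [NormedAddCommGroup E'] [InnerProductSpace ℝ E'] [FiniteDimensional ℝ E']

/-- Product rule for second differences when the point and the multivector both vary, with `b + c -
a` completing the parallelogram of base points. -/
theorem norm_element_add_parallelogram_le {W : Set E'} (hW : Convex ℝ W) {k : ℕ} {a b c e : E'}
    (ha : a ∈ W) (hb : b ∈ W) (hc : c ∈ W) (he : e ∈ W) (hbc : b + c - a ∈ W) {A L s t : ℝ}
    (hL : 0 ≤ L) (hs : 0 ≤ s) (ht : 0 ≤ t)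
    {α β γ δ : ⋀[ℝ]^k E'} (hα : ‖α‖ ≤ A) (hβ : ‖β - α‖ ≤ A * s) (hγ : ‖γ - α‖ ≤ A * t)
    (hδ : ‖δ - β - (γ - α)‖ ≤ A * s * t) (hab : ‖b - a‖ ≤ L * s) (hac : ‖c - a‖ ≤ L * t)
    (heb : ‖e - b‖ ≤ L * t)
    (hec : ‖e - c‖ ≤ L * s) (habc : ‖e - b - (c - a)‖ ≤ L * s * t) :
    ‖(element W e δ - element W b β - (element W c γ - element W a α) : Dirac W k 2)‖ ≤
      (1 + 3 * L + L * L) * A * s * t := by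
  simp only [← elementₗ_apply]
  set T := elementₗ W k 2 with hT
  -- The five terms are the exact second difference of points, the defect of the fourth point, the
  -- second difference of multivectors, and two mixed first differences; they contribute `L²`, `L`,
  -- `1`, `L`, `L` times `A * s * t`.
  have e1 : T e δ - T b β - (T c γ - T a α) =
      (T (b + c - a) α - T b α - (T c α - T a α)) + (T e α - T (b + c - a) α) +
        T e (δ - β - (γ - α)) + (T e (β - α) - T b (β - α)) + (T e (γ - α) - T c (γ - α)) := by
    simp only [map_sub]
    abel
  rw [e1]
  have hsub : ∀ p ∈ W, ∀ q ∈ W, ∀ η : ⋀[ℝ]^k E', ‖T q η - T p η‖ ≤ ‖q - p‖ * ‖η‖ := by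
    intro p hp q hq η
    have := norm_element_sub_le (r := 2) hW one_le_two hp (u := q - p) (by rwa [add_sub_cancel]) η
    rw [add_sub_cancel] at this
    rw [hT, elementₗ_apply, elementₗ_apply]
    exact this
  have n1 : ‖T (b + c - a) α - T b α - (T c α - T a α)‖ ≤ ‖b - a‖ * ‖c - a‖ * ‖α‖ := by
    have h : a + (b - a) + (c - a) = b + c - a := by abel
    have := norm_element_second_le (r := 2) hW le_rfl ha (u := b - a) (v := c - a)
      (by rwa [add_sub_cancel]) (by rwa [add_sub_cancel]) (by rwa [h]) α
    rw [h, add_sub_cancel, add_sub_cancel] at this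
    rw [hT, elementₗ_apply, elementₗ_apply, elementₗ_apply, elementₗ_apply]
    exact this
  have n2 := hsub _ hbc e he α
  rw [show e - (b + c - a) = e - b - (c - a) by abel] at n2
  have n3 : ‖T e (δ - β - (γ - α))‖ ≤ ‖δ - β - (γ - α)‖ := by
    rw [hT, elementₗ_apply]
    exact norm_element_le hW he _
  have n4 := hsub b hb e he (β - α)
  have n5 := hsub c hc e he (γ - α)
  have m1 : ‖b - a‖ * ‖c - a‖ * ‖α‖ ≤ L * s * (L * t) * A := by gcongr
  have m2 : ‖e - b - (c - a)‖ * ‖α‖ ≤ L * s * t * A := by gcongr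
  have m4 : ‖e - b‖ * ‖β - α‖ ≤ L * t * (A * s) := by gcongr
  have m5 : ‖e - c‖ * ‖γ - α‖ ≤ L * s * (A * t) := by gcongr
  refine (norm_add_le_of_le (norm_add_le_of_le (norm_add_le_of_le (norm_add_le_of_le
    (n1.trans m1) (n2.trans m2)) (n3.trans hδ)) (n4.trans m4)) (n5.trans m5)).trans (le_of_eq ?_)
  ring

/-- Cut the parallelogram into `N²` equal cells and sum: the scale `σ = 1 / N` enters each cell
bound twice, so no constant is lost. -/
theorem norm_second_difference_le_of_local {H : Type*} [SeminormedAddCommGroup H] (Q : E → H)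
    {x u v : E} {C δ : ℝ} (hδ : 0 < δ)
    (h : ∀ s ∈ Icc (0 : ℝ) 1, ∀ t ∈ Icc (0 : ℝ) 1, ∀ σ ∈ Ioo 0 δ, s + σ ∈ Icc (0 : ℝ) 1 →
      t + σ ∈ Icc (0 : ℝ) 1 →
      ‖Q (x + (s + σ) • u + (t + σ) • v) - Q (x + (s + σ) • u + t • v) -
        (Q (x + s • u + (t + σ) • v) - Q (x + s • u + t • v))‖ ≤ C * (σ * ‖u‖) * (σ * ‖v‖)) :
    ‖Q (x + u + v) - Q (x + u) - (Q (x + v) - Q x)‖ ≤ C * ‖u‖ * ‖v‖ := by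
  obtain ⟨n, hn⟩ := exists_nat_one_div_lt hδ
  set σ : ℝ := 1 / (n + 1) with hσ
  have hσ0 : 0 < σ := by positivity
  have hσ1 : ((n + 1 : ℕ) : ℝ) * σ = 1 := by
    rw [hσ]
    push_cast
    field_simp
  have hmem : ∀ i : ℕ, i ≤ n + 1 → (i : ℝ) * σ ∈ Icc (0 : ℝ) 1 := fun i hi =>
    ⟨by positivity, hσ1 ▸ by gcongr⟩
  have key := norm_grid_difference_le
    (fun i j => Q (x + ((i : ℝ) * σ) • u + ((j : ℝ) * σ) • v)) (N := n + 1)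
    (c := C * (σ * ‖u‖) * (σ * ‖v‖)) fun i hi j hj => by
      have e : ∀ i : ℕ, ((i + 1 : ℕ) : ℝ) * σ = i * σ + σ := fun i => by push_cast; ring
      rw [e, e]
      exact h _ (hmem i hi.le) _ (hmem j hj.le) σ ⟨hσ0, hn⟩ (e i ▸ hmem _ hi) (e j ▸ hmem _ hj)
  simp only [hσ1, Nat.cast_zero, zero_mul, zero_smul, one_smul, add_zero] at key
  refine key.trans (le_of_eq ?_)
  have : ((n + 1 : ℕ) : ℝ) * (((n + 1 : ℕ) : ℝ) * (C * (σ * ‖u‖) * (σ * ‖v‖))) =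
      (((n + 1 : ℕ) : ℝ) * σ) * (((n + 1 : ℕ) : ℝ) * σ) * (C * ‖u‖ * ‖v‖) := by ring
  rw [this, hσ1]
  ring

/-- The point completing the parallelogram of images may lie outside `W`, where no element exists.
The image of the parallelogram is compact in the open set `W`, so for small cells this point stays
in `W`, and the local bound globalizes. -/
theorem HasSecondDifferenceBound.element_comp {V : Set E} (hV : Convex ℝ V) {W : Set E'}
    (hWo : IsOpen W) (hW : Convex ℝ W) {k : ℕ} {F : E → E'} (hF : MapsTo F V W) {L A : ℝ}
    (hFc : ContinuousOn F V) (hL : 0 ≤ L) (hA : 0 ≤ A)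
    (hF1 : ∀ x ∈ V, ∀ u, x + u ∈ V → ‖F (x + u) - F x‖ ≤ L * ‖u‖)
    (hF2 : ∀ x ∈ V, ∀ u, x + u ∈ V → ∀ v, x + v ∈ V → x + u + v ∈ V →
      ‖F (x + u + v) - F (x + u) - (F (x + v) - F x)‖ ≤ L * ‖u‖ * ‖v‖)
    {ψ : E → ⋀[ℝ]^k E'} (hψ : HasSecondDifferenceBound V A ψ) :
    HasSecondDifferenceBound V ((1 + 3 * L + L * L) * A)
      fun p => (element W (F p) (ψ p) : Dirac W k 2) := by
  have hLL := mul_nonneg hL hL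
  refine ⟨⟨fun x hx => ?_, fun x hx u hu => ?_⟩, fun x hx u hu v hv huv => ?_⟩
  · refine (norm_element_le hW (hF hx) _).trans ((hψ.norm_le x hx).trans ?_)
    exact le_mul_of_one_le_left hA (by linarith)
  · have h1 := norm_element_sub_le (r := 2) hW one_le_two (hF hx) (u := F (x + u) - F x)
      (by rw [add_sub_cancel]; exact hF hu) (ψ x)
    rw [add_sub_cancel] at h1
    have h2 := norm_element_le (r := 2) hW (hF hu) (ψ (x + u) - ψ x)
    simp only [← elementₗ_apply] at h1 h2 ⊢
    rw [map_sub] at h2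
    have h3 : ‖F (x + u) - F x‖ * massNorm (ψ x) ≤ L * ‖u‖ * A :=
      mul_le_mul (hF1 x hx u hu) (hψ.norm_le x hx) (massNorm_nonneg _) (by positivity)
    have h4 : massNorm (ψ (x + u) - ψ x) ≤ A * ‖u‖ := hψ.norm_sub_le x hx u hu
    rw [← sub_add_sub_cancel _ (elementₗ W k 2 (F (x + u)) (ψ x))]
    refine (norm_add_le_of_le (h2.trans h4) (h1.trans h3)).trans ?_
    have : 0 ≤ (2 * L + L * L) * (A * ‖u‖) := by positivity
    linarith
  · set γ : ℝ × ℝ → E := fun z => x + z.1 • u + z.2 • v with hγ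
    have hmem : ∀ s ∈ Icc (0 : ℝ) 1, ∀ t ∈ Icc (0 : ℝ) 1, x + s • u + t • v ∈ V := by
      intro s hs t ht
      have a1 : x + s • u ∈ V := hV.add_smul_mem hx hu hs
      have a2 : x + v + s • u ∈ V := hV.add_smul_mem hv (by rwa [add_right_comm]) hs
      exact hV.add_smul_mem a1 (by rwa [add_right_comm]) ht
    have hK : IsCompact ((fun z => F (γ z)) '' (Icc (0 : ℝ) 1 ×ˢ Icc (0 : ℝ) 1)) :=
      (isCompact_Icc.prod isCompact_Icc).image_of_continuousOn
        (hFc.comp (by fun_prop) fun z hz => hmem _ hz.1 _ hz.2)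
    obtain ⟨ρ, hρ, hρW⟩ := hK.exists_cthickening_subset_open hWo (by
      rintro _ ⟨z, hz, rfl⟩
      exact hF (hmem _ hz.1 _ hz.2))
    -- With this `δ` the displacement `L * σ * ‖u‖` is less than `ρ`, the width of a neighbourhood
    -- of the compact image inside `W`.
    refine norm_second_difference_le_of_local
      (fun p => (element W (F p) (ψ p) : Dirac W k 2))
      (δ := ρ / (L * ‖u‖ + 1)) (by positivity) fun s hs t ht σ hσ hsσ htσ => ?_
    set y := x + s • u + t • v with hy
    have e1 : x + (s + σ) • u + t • v = y + σ • u := by rw [hy, add_smul]; abel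
    have e2 : x + s • u + (t + σ) • v = y + σ • v := by rw [hy, add_smul]; abel
    have e3 : x + (s + σ) • u + (t + σ) • v = y + σ • u + σ • v := by
      rw [hy, add_smul, add_smul]; abel
    have m0 : y ∈ V := hmem s hs t ht
    have m1 : y + σ • u ∈ V := e1 ▸ hmem _ hsσ t ht
    have m2 : y + σ • v ∈ V := e2 ▸ hmem s hs _ htσ
    have m3 : y + σ • u + σ • v ∈ V := e3 ▸ hmem _ hsσ _ htσ
    have m3' : y + σ • v + σ • u ∈ V := by rwa [add_right_comm]
    have nu : ‖σ • u‖ = σ * ‖u‖ := by rw [norm_smul, Real.norm_of_nonneg hσ.1.le]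
    have nv : ‖σ • v‖ = σ * ‖v‖ := by rw [norm_smul, Real.norm_of_nonneg hσ.1.le]
    rw [e1, e2, e3]
    have hb := hF1 y m0 _ m1
    have hc := hF1 y m0 _ m2
    have hbe := hF1 _ m1 _ m3
    have hce := hF1 _ m2 _ m3'
    rw [add_right_comm] at hce
    have hbc := hF2 y m0 _ m1 _ m2 m3
    have p0 := hψ.norm_le y m0
    have p1 := hψ.norm_sub_le y m0 _ m1
    have p2 := hψ.norm_sub_le y m0 _ m2
    have p3 := hψ.norm_second_le y m0 _ m1 _ m2 m3
    rw [nu] at hb hce p1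
    rw [nv] at hc hbe p2
    rw [nu, nv] at hbc p3
    refine norm_element_add_parallelogram_le hW (hF m0) (hF m1) (hF m2) (hF m3) (hρW ?_) hL
      (mul_nonneg hσ.1.le (norm_nonneg u)) (mul_nonneg hσ.1.le (norm_nonneg v))
      p0 p1 p2 p3 hb hc hbe hce hbc
    refine Metric.mem_cthickening_of_dist_le _ (F (y + σ • v)) _ _
      ⟨(s, t + σ), ⟨hs, htσ⟩, by simp only [hγ]; rw [e2]⟩ ?_
    rw [dist_eq_norm, show F (y + σ • u) + F (y + σ • v) - F y - F (y + σ • v) =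
      F (y + σ • u) - F y by abel]
    refine hb.trans ?_
    have h1 := (lt_div_iff₀ (by positivity)).1 hσ.2
    have h2 := hσ.1
    nlinarith

variable [FiniteDimensional ℝ E]

/-- The `B^2` bounds on `fderiv ℝ F` control second differences of `F` by the mean value inequality,
and those of the induced map on multivectors because that map depends smoothly on the derivative. -/
theorem continuous_pushforward {V : Set E} (hVo : IsOpen V) (hV : Convex ℝ V) {W : Set E'}
    (hWo : IsOpen W) (hW : Convex ℝ W) {k : ℕ} {F : E → E'} (hF : MapsTo F V W)
    (hFd : DifferentiableOn ℝ F V) (hF' : IsClassB V (fderiv ℝ F) 2) :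
    Continuous (pushforward F W : Chain V k 2 → Chain W k 2) := by
  obtain ⟨L, hL, hFL⟩ := hF'.hasSecondDifferenceBound hVo hV
  obtain ⟨C, hC, hPC⟩ := hFL.comp_contDiff (contDiff_exteriorMap k) hL
  have hF1 : ∀ x ∈ V, ∀ u, x + u ∈ V → ‖F (x + u) - F x‖ ≤ L * ‖u‖ := fun x hx u hu => by
    have := hV.norm_image_sub_le_of_norm_fderiv_le (𝕜 := ℝ) (f := F) (C := L)
      (fun y hy => hFd.differentiableAt (hVo.mem_nhds hy)) hFL.norm_le hx hu
    rwa [add_sub_cancel_left] at this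
  have hF2 : ∀ x ∈ V, ∀ u, x + u ∈ V → ∀ v, x + v ∈ V → x + u + v ∈ V →
      ‖F (x + u + v) - F (x + u) - (F (x + v) - F x)‖ ≤ L * ‖u‖ * ‖v‖ :=
    fun x hx u hu v hv huv => norm_second_difference_le hVo hV hFd (fun y hy z hz => by
      have := hFL.norm_sub_le z hz (y - z) (by rwa [add_sub_cancel])
      rwa [add_sub_cancel] at this) hx hu hv huv
  let Φ : E → ⋀[ℝ]^k E →ₗ[ℝ] Dirac W k 2 := fun p =>
    elementₗ W k 2 (F p) ∘ₗ exteriorPower.map k (fderiv ℝ F p).toLinearMap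
  have hb : ∀ A : Dirac V k 2, ‖Dirac.lift Φ A‖ ≤ (1 + 3 * L + L * L) * C * ‖A‖ :=
    norm_lift_le_of_second (by positivity) fun α => by
      have h1 := hPC.comp_linear (massNorm_nonneg α)
        (ContinuousLinearMap.apply ℝ (⋀[ℝ]^k E') α).toLinearMap
        fun T => (T.le_opNorm α).trans_eq (mul_comm _ _)
      have h2 := h1.element_comp hV hWo hW hF hFd.continuousOn hL
        (mul_nonneg (massNorm_nonneg α) hC) hF1 hF2
      have e : (fun p => Φ p α) = fun p =>
          (element W (F p) (exteriorMap k (fderiv ℝ F p) α) : Dirac W k 2) :=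
        funext fun p => elementₗ_apply _ _
      rw [e, mul_assoc, mul_comm C]
      exact h2
  have e : (pushforward F W : Chain V k 2 → Chain W k 2) = extensionCLM
      (UniformSpace.Completion.toComplL.comp ((Dirac.lift Φ).mkContinuous _ hb)) := by
    funext J
    rw [extensionCLM_apply, pushforward]
    congr 1
    funext A
    change _ = ((Dirac.lift Φ A : Dirac W k 2) : Chain W k 2)
    rw [Dirac.lift_apply]
    simp only [Φ, LinearMap.comp_apply, elementₗ_apply]
  rw [e]
  exact ContinuousLinearMap.continuous _

end Pushforward

/-! ### Area-minimizing limits of film chains -/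

section Cone

variable {E : Type*} [NormedAddCommGroup E] [InnerProductSpace ℝ E]

theorem isOpen_prodSet {V : Set ℝ} {U : Set E} (hV : IsOpen V) (hU : IsOpen U) :
    IsOpen (prodSet V U) := by
  have h1 : Continuous fun z : WithLp 2 (ℝ × E) => z.fst := by fun_prop
  have h2 : Continuous fun z : WithLp 2 (ℝ × E) => z.snd := by fun_prop
  exact (hV.preimage h1).inter (hU.preimage h2)

theorem IsSmoothNullHomotopy.continuous_cone [FiniteDimensional ℝ E] {U : Set E} {q : E}
    {F : WithLp 2 (ℝ × E) → E} (hF : IsSmoothNullHomotopy U q F) (hUo : IsOpen U)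
    (hU : Convex ℝ U) {k : ℕ} : Continuous (cone F : Chain U k 2 → Chain U (k + 1) 2) := by
  have h : prodSet (Ioo 0 1) U ⊆ prodSet (Icc 0 1) U := fun z hz => ⟨Ioo_subset_Icc_self hz.1, hz.2⟩
  exact (continuous_pushforward (isOpen_prodSet isOpen_Ioo hUo) (convex_prodSet (convex_Ioo 0 1) hU)
    hUo hU (hF.mapsTo.mono_left h) ((hF.smooth.mono h).differentiableOn (by simp))
    (hF.bounded 2)).comp (continuous_intervalCross hU)

theorem isClassB_const {G : Type*} [NormedAddCommGroup G] [NormedSpace ℝ G] (U : Set E) (c : G)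
    (r : ℕ) : IsClassB U (fun _ => c) r := by
  have h : ∀ j (x y : E), iteratedFDeriv ℝ j (fun _ : E => c) x =
      iteratedFDeriv ℝ j (fun _ : E => c) y := by
    intro j x y
    rcases j with _ | j
    · ext m
      simp
    · simp [iteratedFDeriv_succ_const]
  cases r with
  | zero => exact ⟨‖c‖, fun _ _ => le_rfl⟩
  | succ r =>
    refine ⟨contDiffOn_const, fun j _ => ⟨‖iteratedFDeriv ℝ j (fun _ : E => c) 0‖, fun x _ => ?_⟩,
      0, LipschitzOnWith.of_dist_le_mul fun x _ y _ => ?_⟩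
    · rw [h j x 0]
    · rw [h r x y]
      simp

theorem IsClassB.of_two {G : Type*} [NormedAddCommGroup G] [NormedSpace ℝ G] {U : Set E}
    (hUo : IsOpen U) (hUc : Convex ℝ U) {g : E → G} (h : IsClassB U g 2) : IsClassB U g 1 := by
  obtain ⟨C, -, hC⟩ := h.hasSecondDifferenceBound hUo hUc
  exact hC.toHasFirstDifferenceBound.isClassB

end Cone

/-! ### Forms of top degree as multiples of the volume form -/

section TopDegree

variable {n : ℕ}

/-- The unit multivector of top degree. -/
def unitMultivector (n : ℕ) : ⋀[ℝ]^n (EuclideanSpace ℝ (Fin n)) :=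
  exteriorPower.ιMulti ℝ n (EuclideanSpace.basisFun (Fin n) ℝ)

theorem covectorEval_unitMultivector (φ : EuclideanSpace ℝ (Fin n) [⋀^Fin n]→L[ℝ] ℝ) :
    covectorEval φ (unitMultivector n) = φ (EuclideanSpace.basisFun (Fin n) ℝ) :=
  exteriorPower.alternatingMapLinearEquiv_apply_ιMulti _ _

theorem eq_smul_volumeForm (φ : EuclideanSpace ℝ (Fin n) [⋀^Fin n]→L[ℝ] ℝ) :
    φ = covectorEval φ (unitMultivector n) • volumeForm n := by
  apply ContinuousAlternatingMap.toAlternatingMap_injective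
  rw [covectorEval_unitMultivector]
  have := AlternatingMap.eq_smul_basis_det (EuclideanSpace.basisFun (Fin n) ℝ).toBasis
    φ.toAlternatingMap
  rw [OrthonormalBasis.coe_toBasis] at this
  exact this

theorem covectorEval_volumeForm : covectorEval (volumeForm n) (unitMultivector n) = 1 := by
  rw [covectorEval_unitMultivector]
  have := (EuclideanSpace.basisFun (Fin n) ℝ).toBasis.det_self
  rw [OrthonormalBasis.coe_toBasis] at this
  exact this

theorem IsClassB.hasFirstDifferenceBound_coefficient {U : Set (EuclideanSpace ℝ (Fin n))}
    {η : EuclideanSpace ℝ (Fin n) → EuclideanSpace ℝ (Fin n) [⋀^Fin n]→L[ℝ] ℝ}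
    (hη : IsClassB U η 1) : ∃ C, HasFirstDifferenceBound U C fun x =>
      covectorEval (η x) (unitMultivector n) := by
  obtain ⟨C, -, hC⟩ := hη.hasFirstDifferenceBound
  exact ⟨_, hC.comp_linear (massNorm_nonneg _) (covectorEvalₗ _) (norm_covectorEvalₗ_le _)⟩

end TopDegree

/-! ### Vanishing of the limit away from the convex hull -/

section Minimizing

variable {d : ℕ} {M U : Set (EuclideanSpace ℝ (Fin (d + 2)))}
  {τ : EuclideanSpace ℝ (Fin (d + 2)) → ⋀[ℝ]^d (EuclideanSpace ℝ (Fin (d + 2)))}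
  {Y : EuclideanSpace ℝ (Fin (d + 2)) → EuclideanSpace ℝ (Fin (d + 2))}
  {F : WithLp 2 (ℝ × EuclideanSpace ℝ (Fin (d + 2))) → EuclideanSpace ℝ (Fin (d + 2))}

/-- A top-degree form is its coefficient times `volumeForm`. The coefficient is bounded and
Lipschitz, hence an admissible test function for the measure of the underlying `B^1` chain. -/
theorem exists_integral_cone_eq (hUo : IsOpen U) (hUc : Convex ℝ U) {S : Chain U (d + 1) 2}
    (hS : S ∈ filmChains M τ Y F U) : ∃ X ∈ spanningSets M U,
      ∀ η : EuclideanSpace ℝ (Fin (d + 2)) → EuclideanSpace ℝ (Fin (d + 2)) [⋀^Fin (d + 2)]→L[ℝ] ℝ,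
        IsClassB U η 2 → integral η (cone F S) =
          ∫ x in X, covectorEval (η x) (unitMultivector (d + 2)) ∂(spherical (d + 1)) := by
  obtain ⟨-, J, -, hJ, X, hX, -, -, hμ⟩ := hS
  refine ⟨X, hX, fun η hη => ?_⟩
  have hη1 := hη.of_two hUo hUc
  obtain ⟨C, hC⟩ := hη1.hasFirstDifferenceBound_coefficient
  have h := hμ _ hC.isClassB
  rw [Measure.restrict_restrict hUo.measurableSet, inter_eq_self_of_subset_right hX.2.1] at h
  rw [← hJ, integral_link hUo hUc hη1 hη, h]
  congr 1
  funext x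
  exact eq_smul_volumeForm (η x)

theorem exists_area_eq (hUo : IsOpen U) (hUc : Convex ℝ U) {S : Chain U (d + 1) 2}
    (hS : S ∈ filmChains M τ Y F U) : ∃ X ∈ spanningSets M U,
      area F S = (spherical (d + 1) X).toReal ∧
      ∀ η : EuclideanSpace ℝ (Fin (d + 2)) → EuclideanSpace ℝ (Fin (d + 2)) [⋀^Fin (d + 2)]→L[ℝ] ℝ,
        IsClassB U η 2 → integral η (cone F S) =
          ∫ x in X, covectorEval (η x) (unitMultivector (d + 2)) ∂(spherical (d + 1)) := by
  obtain ⟨X, hX, h⟩ := exists_integral_cone_eq hUo hUc hS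
  refine ⟨X, hX, ?_, h⟩
  rw [area, h _ (isClassB_const U _ 2)]
  simp [covectorEval_volumeForm, Measure.real]

/-- Subtract the comparison inequality from `S(X) = S(X \ B) + S(X ∩ B)` and solve for `S(X ∩ B)`;
the exponent `d + 1` is nonzero, so `1 - θ ^ (d + 1)` is positive. -/
theorem toReal_spherical_inter_ball_le {X : Set (EuclideanSpace ℝ (Fin (d + 2)))} {θ : ℝ≥0}
    (hθ : θ < 1) {m : ℝ≥0∞} {p : EuclideanSpace ℝ (Fin (d + 2))} {ε : ℝ}
    (hX : spherical (d + 1) X < ⊤)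
    (h : m ≤ spherical (d + 1) (X \ Metric.ball p ε) +
      (θ : ℝ≥0∞) ^ (d + 1) * spherical (d + 1) (X ∩ Metric.ball p ε)) :
    (spherical (d + 1) (X ∩ Metric.ball p ε)).toReal ≤
      (1 - (θ : ℝ) ^ (d + 1))⁻¹ * ((spherical (d + 1) X).toReal - m.toReal) := by
  have hθ' : (θ : ℝ) ^ (d + 1) < 1 := pow_lt_one₀ θ.2 (by exact_mod_cast hθ) (by simp)
  have h1 := measure_sdiff_add_inter (μ := spherical (d + 1)) X
    (Metric.isOpen_ball (x := p) (ε := ε)).measurableSet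
  have hd : spherical (d + 1) (X \ Metric.ball p ε) ≠ ⊤ :=
    ((measure_mono sdiff_subset).trans_lt hX).ne
  have hi : spherical (d + 1) (X ∩ Metric.ball p ε) ≠ ⊤ :=
    ((measure_mono inter_subset_left).trans_lt hX).ne
  have hi' : (θ : ℝ≥0∞) ^ (d + 1) * spherical (d + 1) (X ∩ Metric.ball p ε) ≠ ⊤ :=
    ENNReal.mul_ne_top (by simp) hi
  have h2 := ENNReal.toReal_mono (ENNReal.add_ne_top.2 ⟨hd, hi'⟩) h
  rw [ENNReal.toReal_add hd hi', ENNReal.toReal_mul, ENNReal.toReal_pow, ENNReal.coe_toReal] at h2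
  rw [← h1, ENNReal.toReal_add hd hi, inv_mul_eq_div, le_div_iff₀ (by linarith)]
  linarith

theorem abs_setIntegral_le {Ω : Type*} [MeasurableSpace Ω] {μ : Measure Ω} {X B : Set Ω} {f : Ω → ℝ}
    {C : ℝ} (hX : MeasurableSet X) (hμ : μ X < ⊤) (hf : ∀ x ∈ X, ‖f x‖ ≤ C)
    (h0 : ∀ x ∈ X, x ∉ B → f x = 0) : |∫ x in X, f x ∂μ| ≤ C * (μ (X ∩ B)).toReal := by
  rw [setIntegral_eq_of_subset_of_forall_sdiff_eq_zero hX inter_subset_left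
    (s := X ∩ B) fun x hx => h0 x hx.1 fun hb => hx.2 ⟨hx.1, hb⟩]
  exact norm_setIntegral_le_of_norm_le_const ((measure_mono inter_subset_left).trans_lt hμ)
    fun x hx => hf x hx.1

theorem support_cone_subset_convexHull (hM : IsCompact M) (hUo : IsOpen U) (hUc : Convex ℝ U)
    (hUb : Bornology.IsBounded U) (hMU : M ⊆ U) {q : EuclideanSpace ℝ (Fin (d + 2))}
    (hF : IsSmoothNullHomotopy U q F) {S₀ : Chain U (d + 1) 2} (hS₀ : S₀ ∈ limitChains M τ Y F U)
    (hmin : area F S₀ = (minimalSize M U).toReal) : support (cone F S₀) ⊆ convexHull ℝ M := by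
  intro p hp
  by_contra hpM
  obtain ⟨T, hT, hlim⟩ := hS₀
  obtain ⟨ε, hε, θ, hθ, hsq⟩ := exists_minimalSize_le hM hUo hUc hUb ⟨q, hF.mem⟩ hMU hpM
  choose X hX harea hint using fun i => exists_area_eq hUo hUc (hT i).1
  obtain ⟨η, hη, hη0, hne⟩ := hp ε hε
  have hcone := (hF.continuous_cone hUo hUc (k := d + 1)).tendsto S₀ |>.comp hlim
  obtain ⟨L, hL, -⟩ := exists_integral_eq_two hUo hUc hη
  obtain ⟨L', hL', -⟩ := exists_integral_eq_two hUo hUc (isClassB_const U (volumeForm (d + 2)) 2)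
  -- Continuity of the cone operator and of integrating the volume form turns minimality of `S₀`
  -- into convergence of the areas to the infimum.
  have hA : Tendsto (fun i => (spherical (d + 1) (X i)).toReal) atTop
      (𝓝 (minimalSize M U).toReal) := by
    rw [← hmin]
    simp only [← harea, area, hL']
    exact (L'.continuous.tendsto _).comp hcone
  obtain ⟨C, hC⟩ := (hη.of_two hUo hUc).hasFirstDifferenceBound_coefficient
  have hC0 : 0 ≤ C := (norm_nonneg _).trans (hC.norm_le q hF.mem)
  have hbound : ∀ i, ‖integral η (cone F (T i))‖ ≤ C * ((1 - (θ : ℝ) ^ (d + 1))⁻¹ *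
      ((spherical (d + 1) (X i)).toReal - (minimalSize M U).toReal)) := fun i => by
    obtain ⟨hXc, hXU, -, hXt, -⟩ := hX i
    rw [hint i η hη, Real.norm_eq_abs]
    refine (abs_setIntegral_le (B := Metric.ball p ε) hXc.measurableSet
      hXt (fun x hx => hC.norm_le x (hXU hx)) fun x hx hxp => ?_).trans
        (mul_le_mul_of_nonneg_left (toReal_spherical_inter_ball_le hθ hXt (hsq _ (hX i))) hC0)
    rw [hη0 x (hXU hx) hxp]
    exact map_zero (covectorEvalₗ _)
  have hzero : Tendsto (fun i => integral η (cone F (T i))) atTop (𝓝 0) := by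
    refine squeeze_zero_norm hbound ?_
    simpa using ((hA.sub_const (minimalSize M U).toReal).const_mul
      (1 - (θ : ℝ) ^ (d + 1))⁻¹).const_mul C
  refine hne (tendsto_nhds_unique ?_ hzero)
  simp only [hL]
  exact (L.continuous.tendsto _).comp hcone

end Minimizing

end FilmChain

end

theorem mainTheorem9 (d : ℕ)
    (M U : Set (EuclideanSpace ℝ (Fin (d + 2))))
    (τ : EuclideanSpace ℝ (Fin (d + 2)) → ⋀[ℝ]^d (EuclideanSpace ℝ (Fin (d + 2))))
    (hMcompact : IsCompact M) (hM : FilmChain.IsSubmanifold 2 M)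
    (hτ : FilmChain.IsOrientation M τ)
    (hUopen : IsOpen U) (hUconvex : Convex ℝ U) (hUbounded : Bornology.IsBounded U)
    (hMU : M ⊆ U)
    (Y : EuclideanSpace ℝ (Fin (d + 2)) → EuclideanSpace ℝ (Fin (d + 2)))
    (hYsmooth : ContDiffOn ℝ ∞ Y U) (hYbounded : ∀ r, FilmChain.IsClassB U Y r)
    (hYunit : ∀ p ∈ M, ‖Y p‖ = 1)
    (hYnormal : ∀ p ∈ M, ∀ v ∈ FilmChain.tangentVectors M p, inner ℝ (Y p) v = 0)
    (q : EuclideanSpace ℝ (Fin (d + 2)))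
    (F : WithLp 2 (ℝ × EuclideanSpace ℝ (Fin (d + 2))) → EuclideanSpace ℝ (Fin (d + 2)))
    (hF : FilmChain.IsSmoothNullHomotopy U q F)
    (hFY : ∀ p ∈ M,
      HasDerivWithinAt (fun t : ℝ => F (WithLp.toLp 2 (t, p))) (Y p) (Icc 0 1) 0)
    (S₀ : FilmChain.Chain U (d + 1) 2)
    (hS₀ : S₀ ∈ FilmChain.limitChains M τ Y F U)
    (hmin : FilmChain.area F S₀ = (FilmChain.minimalSize M U).toReal) :
    FilmChain.support (FilmChain.cone F S₀) ⊆ convexHull ℝ M := by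
  exact FilmChain.support_cone_subset_convexHull hMcompact hUopen hUconvex hUbounded hMU hF hS₀
    hmin
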